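/- Let $D<0$ be a fundamental discriminant, $\mathcal O_D$ the ring of integers of $\mathbb Q(\sqrt D)$ and $\mathfrak d_D=\sqrt D\,\mathcal O_D$. Let $L$ be the lattice of matrices $X=\begin{pmatrix}a&b\\ \bar b&c\end{pmatrix}$ with $a,c\in\mathbb Z$, $b\in\mathcal O_D$, with quadratic form $Q(X)=\det X=ac-|b|^2$ and bilinear form $(X_1,X_2)=a_1c_2+a_2c_1-\mathrm{tr}(b_1\bar b_2)$; it is even of signature $(1,3)$, and its dual lattice $L'$ is given by $a,c\in\mathbb Z$, $b\in\mathfrak d_D^{-1}$. Put $V=L\otimes\mathbb Q$, $G=\mathrm{SO}(V)$, $L_p=L\otimes\mathbb Z_p$, $L_p'=L'\otimes\mathbb Z_p$ and $e(x)=e^{2\pi i x}$. Write $D=\prod_{p\mid D}p^*$ with prime discriminants $p^*$ (so $p^*=(\frac{-1}{p})p$ for odd $p$, and $p^*\in\{-4,\pm8\}$ for $p=2$). Let $L_D=\{X\in L':Q(X)\in D\mathbb Z\}$. For $X\in L_D$ put $\chi_D(X)=\prod_{p\mid D}\chi_p(X)$, where, in terms of Kronecker symbols, $\chi_p(X)=(\frac{p^*}{a})$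 if $p\nmid a$, $\chi_p(X)=(\frac{p^*}{c})$ if $p\nmid c$, and $\chi_p(X)=0$ otherwise; put $\chi_D(X)=0$ for $X\in V\setminus L_D$. On $V(\mathbb A_f)$ put $\chi_D(X)=\prod_{p<\infty}\chi_{D,p}(X_p)$. Here, for $p\nmid D$, $\chi_{D,p}$ is the characteristic function of $L_p'=L_p$. For $p\mid D$ and $X_p\in L_p'$ with $Q(X_p)\in D\mathbb Z_p$, $\chi_{D,p}(X_p)$ is the Hilbert symbol $(a,D)_p$ if $p\nmid a$, the Hilbert symbol $(c,D)_p$ if $p\nmid c$, and $0$ otherwise; for all other $X_p$ it is $0$. Let $L(D)$ be the lattice $DL$ with the quadratic form $Q/|D|$. Its dual lattice is $L'$ as a set, and $\mathcal L(D)=L'/L(D)$ denotes its discriminant group. Let $\mathfrak e_\delta$ ($\delta\in\mathcal L(D)$) be the standard basis of $\mathbb C[\mathcal L(D)]$. Let $\mathrm{Mp}_2(\mathbb Z)$ be the group of pairs $(M,\phi)$ with $M=\begin{pmatrix}a&b\\c&d\end{pmatrix}\in\mathrm{SL}_2(\mathbb Z)$ and $\phi$ holomorphic on the upper half-plane $\mathbb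 H$ with $\phi(\tau)^2=c\tau+d$. It is generated by $T=\left(\begin{pmatrix}1&1\\0&1\end{pmatrix},1\right)$ and $S=\left(\begin{pmatrix}0&-1\\1&0\end{pmatrix},\sqrt\tau\right)$. The dual Weil representation $\bar\rho$ of $\mathrm{Mp}_2(\mathbb Z)$ on $\mathbb C[\mathcal L(D)]$ is determined by $$\bar\rho(T)\mathfrak e_\gamma=e\!\left(-\tfrac{Q(\gamma)}{|D|}\right)\mathfrak e_\gamma,\qquad \bar\rho(S)\mathfrak e_\gamma=\frac{e((1-3)/8)}{\sqrt{|\mathcal L(D)|}}\sum_{\beta\in\mathcal L(D)}e\!\left(\tfrac{(\beta,\gamma)}{|D|}\right)\mathfrak e_\beta .$$ Then the following hold. (i) The restriction of $\chi_D$ to $L'$ depends only on $X$ modulo $DL$, and the vector $\psi_D=\sum_{\delta\in\mathcal L(D)}\chi_D(\delta)\mathfrak e_\delta$ is invariant under $\bar\rho$, i.e. $\bar\rho(g)\psi_D=\psi_D$ for all $g\in\mathrm{Mp}_2(\mathbb Z)$. (ii) For $h=(h_p)\in G(\mathbb A_f)$ and $P=z+rj$ with $z\in\mathbb C$, $r>0$,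 let $hL=V\cap\bigcap_p h_pL_p$ and $v(P)=\frac1{\sqrt2\,r}\begin{pmatrix}r^2+|z|^2&z\\ \bar z&1\end{pmatrix}\in V(\mathbb R)$, and let $X_v$ and $X_{v^\perp}$ be the orthogonal projections of $X$ to $v=\mathbb R v(P)$ and to $v^\perp$. For $\tau\in\mathbb H$ the series $$\Theta^*_{L,\chi_D}(\tau,P,h)=\mathrm{Im}(\tau)^{3/2}\sum_{X\in hL}\chi_D(h^{-1}X)\,\tfrac1{|D|}(X,v(P))\,e\!\left(\frac{Q(X_v)}{|D|}\tau+\frac{Q(X_{v^\perp})}{|D|}\bar\tau\right)$$ converges absolutely, and as a function of $\tau$ it transforms like a scalar-valued modular form of weight $0$ for the full modular group: $$\Theta^*_{L,\chi_D}(M\tau,P,h)=\Theta^*_{L,\chi_D}(\tau,P,h)\qquad\text{for all }M\in\mathrm{SL}_2(\mathbb Z).$$ -/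

import Mathlib

open UpperHalfPlane
open scoped ModularForm MatrixGroups Manifold RestrictedProduct

noncomputable section

namespace TwistedTheta

/-! ### Discriminants and the Kronecker symbol -/

/-- `D` is the discriminant of a quadratic number field. -/
def IsFundamentalDiscriminant (D : ℤ) : Prop :=
  D ≠ 1 ∧ ((D % 4 = 1 ∧ Squarefree D) ∨
    ∃ m : ℤ, D = 4 * m ∧ (m % 4 = 2 ∨ m % 4 = 3) ∧ Squarefree m)

/-- The Kronecker symbol `(n / a)` for arbitrary integers `n` and `a`: for `a ≠ 0` it is the product
of the sign factor `(n / ±1)`, the power of `(n / 2)` with exponent `v_2(a)`, where `(n / 2)` is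
`0, 1, -1` according to `n` even, `n ≡ ±1 mod 8`, `n ≡ ±3 mod 8`, and the Jacobi symbol at the odd
part of `|a|`. -/
def kronecker (n a : ℤ) : ℤ :=
  if a = 0 then (if n.natAbs = 1 then 1 else 0)
  else (if a < 0 ∧ n < 0 then -1 else 1) *
    (ZMod.χ₈ (n : ZMod 8)) ^ (padicValNat 2 a.natAbs) *
    jacobiSym n (a.natAbs / 2 ^ padicValNat 2 a.natAbs)

/-- The prime discriminant `p^*` for odd `p`: `p^* = (-1/p) p`. -/
def oddPrimeDisc (p : ℕ) : ℤ := ZMod.χ₄ (p : ZMod 4) * p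

/-- The prime discriminant `p^*` occurring in the factorization `D = ∏_{p ∣ D} p^*` of a
fundamental discriminant `D`. -/
def primeDisc (D : ℤ) (p : ℕ) : ℤ :=
  if p = 2 then D / ∏ q ∈ D.natAbs.primeFactors.erase 2, oddPrimeDisc q else oddPrimeDisc p

/-! ### The quadratic space of binary hermitian forms -/

/-- `F ⊗ ℚ(√D) = F ⊕ F √D`, with the conjugation `star`. -/
abbrev QuadExt (D : ℤ) (F : Type) [Field F] : Type := QuadraticAlgebra F (D : F) 0

/-- The space `V(F)` of hermitian matrices `(a, b; b̄, c)` with `a, c ∈ F` and `b ∈ F ⊗ ℚ(√D)`, the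
matrix being recorded as `(a, b, c)`. -/
abbrev V (D : ℤ) (F : Type) [Field F] : Type := F × QuadExt D F × F

/-- `Q(X) = det X = a c - |b|²`. -/
def Q {D : ℤ} {F : Type} [Field F] (X : V D F) : F :=
  X.1 * X.2.2 - QuadraticAlgebra.norm X.2.1

/-- `(X₁, X₂) = a₁ c₂ + a₂ c₁ - tr(b₁ b̄₂)`. -/
def bil {D : ℤ} {F : Type} [Field F] (X Y : V D F) : F :=
  X.1 * Y.2.2 + Y.1 * X.2.2 - QuadraticAlgebra.trace (X.2.1 * star Y.2.1)

/-- Extension of scalars `V(ℚ) → V(F)`. -/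
def baseChange {D : ℤ} (F : Type) [Field F] [Algebra ℚ F] (X : V D ℚ) : V D F :=
  (algebraMap ℚ F X.1, ⟨algebraMap ℚ F X.2.1.re, algebraMap ℚ F X.2.1.im⟩, algebraMap ℚ F X.2.2)

/-- `√D`. -/
def sqrtD (D : ℤ) (F : Type) [Field F] : QuadExt D F := ⟨0, 1⟩

/-- `ω_D = (D + √D) / 2`. -/
def omegaD (D : ℤ) (F : Type) [Field F] : QuadExt D F := ⟨(D : F) / 2, 1 / 2⟩

section Lattices

variable (D : ℤ) (R F : Type) [CommRing R] [Field F] [Algebra R F]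

/-- `R ⊗ O_D = R ⊕ R ω_D`. -/
def intO : Submodule R (QuadExt D F) := Submodule.span R {1, omegaD D F}

/-- The inverse different `R ⊗ 𝔡_D⁻¹ = (√D)⁻¹ (R ⊗ O_D)`; note that `(√D)⁻¹ = D⁻¹ √D`. -/
def invDifferent : Submodule R (QuadExt D F) :=
  (intO D R F).map (LinearMap.mulLeft R ((D : F)⁻¹ • sqrtD D F))

/-- The lattice `L` (for `R = ℤ`, `F = ℚ`) or `L_p` (for `R = ℤ_p`, `F = ℚ_p`) of all `(a, b; b̄, c)`
with `a, c ∈ R` and `b ∈ R ⊗ O_D`. -/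
def lattice : Submodule R (V D F) :=
  (1 : Submodule R F).prod ((intO D R F).prod (1 : Submodule R F))

/-- The dual lattice `L'` or `L_p'` of all `(a, b; b̄, c)` with `a, c ∈ R`, `b ∈ R ⊗ 𝔡_D⁻¹`. -/
def dualLattice : Submodule R (V D F) :=
  (1 : Submodule R F).prod ((invDifferent D R F).prod (1 : Submodule R F))

end Lattices

/-! ### The twisting function on the rational points -/

/-- `L_D = {X ∈ L' : Q(X) ∈ D ℤ}`. -/
def LD (D : ℤ) : Set (V D ℚ) :=
  {X | X ∈ dualLattice D ℤ ℚ ∧ ∃ k : ℤ, Q X = (D : ℚ) * k}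

/-- `χ_p(X)` for `p ∣ D` and `X ∈ L_D`; the entries `a` and `c` are integers, so they agree with
their numerators. -/
def chiPrime (D : ℤ) (p : ℕ) (X : V D ℚ) : ℤ :=
  if ¬ (p : ℤ) ∣ X.1.num then kronecker (primeDisc D p) X.1.num
  else if ¬ (p : ℤ) ∣ X.2.2.num then kronecker (primeDisc D p) X.2.2.num
  else 0

open Classical in
/-- `χ_D` on `V(ℚ)`. -/
def chi (D : ℤ) (X : V D ℚ) : ℤ :=
  if X ∈ LD D then ∏ p ∈ D.natAbs.primeFactors, chiPrime D p X else 0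

/-! ### The discriminant group of the rescaled lattice -/

/-- The underlying group `D L` of the rescaled lattice `L(D) = (D L, Q / |D|)`. -/
def rescaledLattice (D : ℤ) : Submodule ℤ (V D ℚ) :=
  (lattice D ℤ ℚ).map (LinearMap.lsmul ℤ (V D ℚ) D)

/-- The discriminant group `𝓛(D) = L' / L(D)`. -/
abbrev DiscGroup (D : ℤ) : Type :=
  dualLattice D ℤ ℚ ⧸ (rescaledLattice D).submoduleOf (dualLattice D ℤ ℚ)

theorem mem_one_iff {x : ℚ} : x ∈ (1 : Submodule ℤ ℚ) ↔ ∃ n : ℤ, (n : ℚ) = x := by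
  simp [Submodule.mem_one]

theorem exists_of_mem_intO {D : ℤ} {z : QuadExt D ℚ} (h : z ∈ intO D ℤ ℚ) :
    ∃ m n : ℤ, z.re = m + n * (D / 2 : ℚ) ∧ z.im = n / 2 := by
  obtain ⟨m, n, rfl⟩ := Submodule.mem_span_pair.1 h
  refine ⟨m, n, ?_, ?_⟩
  · simp [omegaD]
  · simp [omegaD]; ring

theorem exists_of_mem_invDifferent {D : ℤ} {z : QuadExt D ℚ} (h : z ∈ invDifferent D ℤ ℚ) :
    ∃ m n : ℤ, z.re = (D : ℚ) * (D : ℚ)⁻¹ * (n / 2) ∧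
      z.im = (D : ℚ)⁻¹ * (m + n * (D / 2 : ℚ)) := by
  obtain ⟨w, hw, rfl⟩ := Submodule.mem_map.1 h
  obtain ⟨m, n, h1, h2⟩ := exists_of_mem_intO hw
  refine ⟨m, n, ?_, ?_⟩
  · simp [sqrtD, h2]
  · simp [sqrtD, h1]

/-- For a discriminant `D`, the class of `Q(X) / |D|` modulo `1` depends only on `X ∈ L'` modulo
`D L`. -/
theorem Q_congr {D : ℤ} (hD4 : D % 4 = 0 ∨ D % 4 = 1) {X Y : V D ℚ}
    (hX : X ∈ dualLattice D ℤ ℚ) (h : X - Y ∈ rescaledLattice D) :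
    ∃ k : ℤ, Q X / ((|D| : ℤ) : ℚ) - Q Y / ((|D| : ℤ) : ℚ) = k := by
  rcases eq_or_ne D 0 with hD | hD
  · exact ⟨0, by simp [hD]⟩
  obtain ⟨Z, hZ, hXY⟩ := Submodule.mem_map.1 h
  have hY : Y = X - D • Z := by
    have : D • Z = X - Y := by simpa using hXY
    rw [this]; abel
  subst hY
  obtain ⟨hXa, hXb, hXc⟩ := hX
  obtain ⟨hZa, hZb, hZc⟩ := hZ
  obtain ⟨a, ha⟩ := mem_one_iff.1 hXa
  obtain ⟨c, hc⟩ := mem_one_iff.1 hXc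
  obtain ⟨a', ha'⟩ := mem_one_iff.1 hZa
  obtain ⟨c', hc'⟩ := mem_one_iff.1 hZc
  obtain ⟨m, n, h1, h2⟩ := exists_of_mem_invDifferent hXb
  obtain ⟨m', n', h3, h4⟩ := exists_of_mem_intO hZb
  obtain ⟨t, ht⟩ : ∃ t : ℤ, D * D - D = 4 * t := by
    rcases hD4 with h0 | h0
    · obtain ⟨r, hr⟩ : ∃ r, D = 4 * r := ⟨D / 4, by omega⟩
      exact ⟨4 * r * r - r, by rw [hr]; ring⟩
    · obtain ⟨r, hr⟩ : ∃ r, D = 4 * r + 1 := ⟨D / 4, by omega⟩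
      exact ⟨(4 * r + 1) * r, by rw [hr]; ring⟩
  have hD' : (D : ℚ) ≠ 0 := by exact_mod_cast hD
  have ht' : (D : ℚ) * D - D = 4 * t := by exact_mod_cast ht
  have key : Q X - Q (X - D • Z) =
      D * (((a * c' + a' * c - (n * m' - m * n')) -
        D * (a' * c' - (m' * m' + D * m' * n' + t * n' * n')) : ℤ) : ℚ) := by
    have e1 : (D • Z).1 = D * a' := by rw [Prod.smul_fst, ← ha', zsmul_eq_mul]
    have e2 : (D • Z).2.2 = D * c' := by
      rw [Prod.smul_snd, Prod.smul_snd, ← hc', zsmul_eq_mul]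
    have e3 : (D • Z).2.1.re = D * (m' + n' * (D / 2)) := by
      rw [Prod.smul_snd, Prod.smul_fst, QuadraticAlgebra.re_smul, h3, zsmul_eq_mul]
    have e4 : (D • Z).2.1.im = D * (n' / 2) := by
      rw [Prod.smul_snd, Prod.smul_fst, QuadraticAlgebra.im_smul, h4, zsmul_eq_mul]
    simp only [Q, QuadraticAlgebra.norm_def, Prod.fst_sub, Prod.snd_sub, QuadraticAlgebra.re_sub,
      QuadraticAlgebra.im_sub, e1, e2, e3, e4, ← ha, ← hc, h1, h2]
    push_cast
    have : (t : ℚ) = (D * D - D) / 4 := by linarith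
    rw [this]
    field_simp
    ring
  rw [← sub_div, key]
  rcases abs_choice D with h | h
  · rw [h]; exact ⟨_, mul_div_cancel_left₀ _ hD'⟩
  · rw [h, Int.cast_neg, div_neg, mul_div_cancel_left₀ _ hD', ← Int.cast_neg]; exact ⟨_, rfl⟩

/-- The discriminant group is finite. -/
theorem finite_discGroup {D : ℤ} (hD : D ≠ 0) : Finite (DiscGroup D) := by
  have hD' : (D : ℚ) ≠ 0 := by exact_mod_cast hD
  have hO : (intO D ℤ ℚ).FG := Submodule.fg_span (by simp)
  have h1 : (1 : Submodule ℤ ℚ).FG := by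
    rw [Submodule.one_eq_span]; exact Submodule.fg_span (by simp)
  have hfg : (dualLattice D ℤ ℚ).FG := h1.prod ((hO.map _).prod h1)
  have : Module.Finite ℤ (dualLattice D ℤ ℚ) := Module.Finite.iff_fg.2 hfg
  refine Module.finite_of_fg_torsion (DiscGroup D) ?_
  intro x
  obtain ⟨⟨X, hX⟩, rfl⟩ := Submodule.Quotient.mk_surjective _ x
  refine ⟨⟨D * D, mem_nonZeroDivisors_of_ne_zero (mul_ne_zero hD hD)⟩, ?_⟩
  refine (Submodule.Quotient.mk_eq_zero _).2 (Submodule.mem_map.2 ⟨D • X, ?_, ?_⟩)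
  · obtain ⟨hXa, hXb, hXc⟩ := hX
    refine ⟨Submodule.smul_mem _ _ hXa, ?_, Submodule.smul_mem _ _ hXc⟩
    obtain ⟨m, n, h1, h2⟩ := exists_of_mem_invDifferent hXb
    obtain ⟨t, ht⟩ : ∃ t : ℤ, D * (D - 1) = 2 * t :=
      ⟨D * (D - 1) / 2, (Int.two_mul_ediv_two_of_even (Int.even_mul_pred_self D)).symm⟩
    have ht' : (D : ℚ) * (D - 1) = 2 * t := by exact_mod_cast ht
    refine Submodule.mem_span_pair.2 ⟨-(m * D) - n * t, 2 * m + n * D, ?_⟩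
    ext
    · simp [omegaD, h1]
      field_simp
      linear_combination (n : ℚ) * ht'
    · simp [omegaD, h2]
      field_simp
  · simp [mul_smul]

/-- The quadratic form `𝓛(D) → ℝ / ℤ` induced by `Q / |D|`, computed on a representative. -/
def discQ (D : ℤ) (δ : DiscGroup D) : UnitAddCircle :=
  (((Q (δ.out : V D ℚ) / ((|D| : ℤ) : ℚ) : ℚ) : ℝ) : UnitAddCircle)

/-- The value of the quadratic form does not depend on the representative. -/
theorem discQ_mk {D : ℤ} (hD : IsFundamentalDiscriminant D) (X : dualLattice D ℤ ℚ) :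
    discQ D (Submodule.Quotient.mk X) =
      (((Q (X : V D ℚ) / ((|D| : ℤ) : ℚ) : ℚ) : ℝ) : UnitAddCircle) := by
  have hD4 : D % 4 = 0 ∨ D % 4 = 1 := by
    rcases hD with ⟨-, ⟨h, -⟩ | ⟨m, rfl, -⟩⟩ <;> omega
  have h : X - (Submodule.Quotient.mk X : DiscGroup D).out ∈
      (rescaledLattice D).submoduleOf (dualLattice D ℤ ℚ) :=
    (Submodule.Quotient.eq _).1 (Quotient.out_eq _).symm
  obtain ⟨k, hk⟩ := Q_congr hD4 X.2 h
  rw [discQ, eq_comm, ← sub_eq_zero, ← AddCircle.coe_sub, AddCircle.coe_eq_zero_iff]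
  exact ⟨k, by rw [← Rat.cast_sub, hk]; simp⟩

/-- `ψ_D = ∑_{δ ∈ 𝓛(D)} χ_D(δ) 𝔢_δ` in `ℂ[𝓛(D)]`, where `𝔢_δ` is `Finsupp.single δ 1` and `χ_D(δ)`
is computed on a representative of `δ`. -/
def psi (D : ℤ) : DiscGroup D →₀ ℂ :=
  ∑ᶠ δ : DiscGroup D, Finsupp.single δ ((chi D (δ.out : V D ℚ) : ℤ) : ℂ)

/-! ### The metaplectic group and the Weil representation -/

/-- `Mp₂(ℤ)`: pairs `(M, φ)` with `M ∈ SL₂(ℤ)` and `φ : ℍ → ℂ` holomorphic with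
`φ(τ)² = c τ + d`. -/
@[ext]
structure Mp2Z where
  M : SL(2, ℤ)
  φ : ℍ → ℂ
  holo : MDifferentiable 𝓘(ℂ) 𝓘(ℂ) φ
  sq : ∀ τ : ℍ, φ τ ^ 2 = (M 1 0 : ℂ) * τ + (M 1 1 : ℂ)

namespace Mp2Z

theorem denom_eq (M : SL(2, ℤ)) (τ : ℍ) :
    UpperHalfPlane.denom M τ = (M 1 0 : ℂ) * τ + (M 1 1 : ℂ) := by
  simp [UpperHalfPlane.denom]

theorem denom_mul (M N : SL(2, ℤ)) (τ : ℍ) :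
    UpperHalfPlane.denom (M * N : SL(2, ℤ)) τ =
      UpperHalfPlane.denom M (N • τ : ℍ) * UpperHalfPlane.denom N τ := by
  rw [map_mul, map_mul]
  have := UpperHalfPlane.denom_cocycle_σ (M : GL (Fin 2) ℝ) (N : GL (Fin 2) ℝ) τ
  simpa [UpperHalfPlane.σ] using this

theorem mdiff_smul (M : SL(2, ℤ)) :
    MDifferentiable 𝓘(ℂ) 𝓘(ℂ) (fun τ : ℍ => M • τ) :=
  UpperHalfPlane.mdifferentiable_smul (g := (M : GL (Fin 2) ℝ)) (by simp)

theorem φ_ne (g : Mp2Z) (τ : ℍ) : g.φ τ ≠ 0 := by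
  intro h
  have := g.sq τ
  rw [h, ← denom_eq] at this
  exact UpperHalfPlane.denom_ne_zero (g.M : GL (Fin 2) ℝ) τ (by rw [← this]; simp)

/-- `(M₁, φ₁)(M₂, φ₂) = (M₁ M₂, φ₁(M₂ τ) φ₂(τ))`. -/
instance : Mul Mp2Z where
  mul g h :=
    { M := g.M * h.M
      φ := fun τ => g.φ (h.M • τ) * h.φ τ
      holo := (g.holo.comp (mdiff_smul h.M)).mul h.holo
      sq := fun τ => by
        rw [mul_pow, g.sq, h.sq, ← denom_eq, ← denom_eq, ← denom_eq, denom_mul] }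

instance : One Mp2Z where
  one :=
    { M := 1
      φ := fun _ => 1
      holo := mdifferentiable_const
      sq := fun τ => by simp }

instance : Inv Mp2Z where
  inv g :=
    { M := g.M⁻¹
      φ := fun τ => (g.φ (g.M⁻¹ • τ))⁻¹
      holo := (g.holo.comp (mdiff_smul g.M⁻¹)).inv fun τ => g.φ_ne _
      sq := fun τ => by
        have h := denom_mul g.M g.M⁻¹ τ
        rw [mul_inv_cancel] at h
        rw [inv_pow, g.sq, ← denom_eq, ← denom_eq]
        refine inv_eq_of_mul_eq_one_right ?_
        rw [← h]; simp [UpperHalfPlane.denom] }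

theorem mul_M (g h : Mp2Z) : (g * h).M = g.M * h.M := rfl
theorem mul_φ (g h : Mp2Z) (τ : ℍ) : (g * h).φ τ = g.φ (h.M • τ) * h.φ τ := rfl
theorem one_M : (1 : Mp2Z).M = 1 := rfl
theorem one_φ (τ : ℍ) : (1 : Mp2Z).φ τ = 1 := rfl
theorem inv_M (g : Mp2Z) : (g⁻¹).M = g.M⁻¹ := rfl
theorem inv_φ (g : Mp2Z) (τ : ℍ) : (g⁻¹).φ τ = (g.φ (g.M⁻¹ • τ))⁻¹ := rfl

instance : Group Mp2Z where
  mul_assoc a b c := by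
    ext τ
    · simp [mul_M, mul_assoc]
    · simp [mul_φ, mul_M, mul_smul, mul_assoc]
  one_mul a := by ext τ <;> simp [mul_M, mul_φ, one_M, one_φ]
  mul_one a := by ext τ <;> simp [mul_M, mul_φ, one_M, one_φ]
  inv_mul_cancel a := by
    ext τ
    · simp [mul_M, inv_M, one_M]
    · simp [mul_φ, inv_φ, one_φ, a.φ_ne]

/-- `T = ((1, 1; 0, 1), 1)`. -/
def T : Mp2Z where
  M := ModularGroup.T
  φ := fun _ => 1
  holo := mdifferentiable_const
  sq := fun τ => by simp [ModularGroup.T]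

/-- `S = ((0, -1; 1, 0), √τ)` with the principal branch of the square root. -/
def S : Mp2Z where
  M := ModularGroup.S
  φ := fun τ => (τ : ℂ) ^ (1 / 2 : ℂ)
  holo := by
    rw [UpperHalfPlane.mdifferentiable_iff]
    intro z hz
    have h : DifferentiableAt ℂ (fun w : ℂ => w ^ (1 / 2 : ℂ)) z :=
      differentiableAt_id.cpow_const (Or.inr (ne_of_gt hz))
    exact (h.congr_of_eventuallyEq ((UpperHalfPlane.eventuallyEq_coe_comp_ofComplex hz).fun_comp
      (fun w : ℂ => w ^ (1 / 2 : ℂ)))).differentiableWithinAt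
  sq := fun τ => by
    simp [ModularGroup.S]

end Mp2Z

section Weil

variable {A : Type} [AddCommGroup A]

/-- `e(x) = exp(2 π i x)` on `ℝ / ℤ`. -/
def eC (x : UnitAddCircle) : ℂ := (AddCircle.toCircle x : ℂ)

/-- `ρ(T) 𝔢_γ = e(q(γ)) 𝔢_γ` on `ℂ[A]`, for a finite abelian group `A` with a quadratic form
`q : A → ℝ / ℤ`. -/
def weilT (q : A → UnitAddCircle) : Module.End ℂ (A →₀ ℂ) :=
  Finsupp.linearCombination ℂ (fun γ => eC (q γ) • Finsupp.single γ (1 : ℂ))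

/-- `ρ(S) 𝔢_γ = e((b⁻ - b⁺) / 8) |A|^{-1/2} ∑_β e(-(β, γ)) 𝔢_β`, for signature `(b⁺, b⁻)`, where
`(β, γ) = q(β + γ) - q(β) - q(γ)`. -/
def weilS (q : A → UnitAddCircle) (bp bm : ℕ) : Module.End ℂ (A →₀ ℂ) :=
  Finsupp.linearCombination ℂ (fun γ =>
    (Complex.exp (2 * Real.pi * Complex.I * (((bm : ℂ) - bp) / 8)) / (√(Nat.card A : ℝ) : ℂ)) •
      ∑ᶠ β : A, eC (-(q (β + γ) - q β - q γ)) • Finsupp.single β (1 : ℂ))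

/-- The graph of the Weil representation `ρ` of `Mp₂(ℤ)` on `ℂ[A]`, generated by its values at `T`
and `S`: `IsWeilOperator q b⁺ b⁻ g B` says that `B = ρ(g)`. -/
inductive IsWeilOperator (q : A → UnitAddCircle) (bp bm : ℕ) :
    Mp2Z → Module.End ℂ (A →₀ ℂ) → Prop
  | gen_T : IsWeilOperator q bp bm Mp2Z.T (weilT q)
  | gen_S : IsWeilOperator q bp bm Mp2Z.S (weilS q bp bm)
  | one : IsWeilOperator q bp bm 1 1
  | mul {g h : Mp2Z} {B C : Module.End ℂ (A →₀ ℂ)} : IsWeilOperator q bp bm g B →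
      IsWeilOperator q bp bm h C → IsWeilOperator q bp bm (g * h) (B * C)
  | inv {g : Mp2Z} {B C : Module.End ℂ (A →₀ ℂ)} : IsWeilOperator q bp bm g B →
      B * C = 1 → C * B = 1 → IsWeilOperator q bp bm g⁻¹ C

/-- A representation of `Mp₂(ℤ)` with the prescribed values at `T` and `S` has the graph above. -/
theorem IsWeilOperator.eq_of_representation {q : A → UnitAddCircle} {bp bm : ℕ}
    (ρ : Representation ℂ Mp2Z (A →₀ ℂ)) (hT : ρ Mp2Z.T = weilT q)
    (hS : ρ Mp2Z.S = weilS q bp bm) {g : Mp2Z} {B : Module.End ℂ (A →₀ ℂ)}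
    (h : IsWeilOperator q bp bm g B) : B = ρ g := by
  induction h with
  | gen_T => exact hT.symm
  | gen_S => exact hS.symm
  | one => simp
  | mul _ _ h1 h2 => rw [map_mul, h1, h2]
  | @inv g B C _ h1 h2 h3 =>
    have h4 : ρ g * ρ g⁻¹ = 1 := by rw [← map_mul, mul_inv_cancel, map_one]
    rw [← h3] at h4
    calc C = C * (B * ρ g⁻¹) := by rw [h4, mul_one]
      _ = ρ g⁻¹ := by rw [← mul_assoc, h2, one_mul]

end Weil

/-- The graph of the dual Weil representation `ρ̄_{𝓛(D)}`, that is, of the Weil representation of the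
lattice `(D L, -Q / |D|)` of signature `(3, 1)`. -/
def IsDualWeilOperator (D : ℤ) (g : Mp2Z) (B : Module.End ℂ (DiscGroup D →₀ ℂ)) : Prop :=
  IsWeilOperator (fun δ => -discQ D δ) 3 1 g B

/-! ### The finite adelic special orthogonal group -/

/-- `SO(V)(F)`. -/
def SO (D : ℤ) (F : Type) [Field F] : Subgroup (V D F ≃ₗ[F] V D F) where
  carrier := {g | (∀ X, Q (g X) = Q X) ∧ LinearMap.det (g : V D F →ₗ[F] V D F) = 1}
  one_mem' := ⟨fun _ => rfl, by simp⟩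
  mul_mem' {g h} hg hh := ⟨fun X => by simp [hg.1, hh.1], by
    have : ((g * h : V D F ≃ₗ[F] V D F) : V D F →ₗ[F] V D F) =
      (g : V D F →ₗ[F] V D F) * (h : V D F →ₗ[F] V D F) := rfl
    rw [this, map_mul, hg.2, hh.2, one_mul]⟩
  inv_mem' {g} hg := ⟨fun X => by
    have := hg.1 (g⁻¹ X)
    rw [← this]; simp, by
    have h1 : (g : V D F →ₗ[F] V D F) * ((g⁻¹ : V D F ≃ₗ[F] V D F) : V D F →ₗ[F] V D F) = 1 := by
      ext X <;> simp
    have := congrArg LinearMap.det h1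
    rw [map_mul, hg.2, one_mul, map_one] at this
    exact this⟩

instance factPrime (p : Nat.Primes) : Fact p.1.Prime := ⟨p.2⟩

/-- The stabilizer of `L_p` in `SO(V)(ℚ_p)`. -/
def stabLattice (D : ℤ) (p : Nat.Primes) : Set (SO D ℚ_[p.1]) :=
  {g | (g : V D ℚ_[p.1] ≃ₗ[ℚ_[p.1]] V D ℚ_[p.1]) '' (lattice D ℤ_[p.1] ℚ_[p.1]) =
    lattice D ℤ_[p.1] ℚ_[p.1]}

/-- `G(𝔸_f)` for `G = SO(V)`: the restricted product of the groups `SO(V)(ℚ_p)` with respect to the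
stabilizers of the lattices `L_p`. -/
abbrev GAf (D : ℤ) : Type :=
  Πʳ p : Nat.Primes, [SO D ℚ_[p.1], stabLattice D p]

/-- The component `h_p`, acting on `V(ℚ_p)`. -/
def GAf.comp {D : ℤ} (h : GAf D) (p : Nat.Primes) : V D ℚ_[p.1] ≃ₗ[ℚ_[p.1]] V D ℚ_[p.1] :=
  (h p : SO D ℚ_[p.1])

/-- `h L = V(ℚ) ∩ ⋂_p h_p L_p`. -/
def translate {D : ℤ} (h : GAf D) : Set (V D ℚ) :=
  {X | ∀ p : Nat.Primes, ∃ Y ∈ lattice D ℤ_[p.1] ℚ_[p.1], h.comp p Y = baseChange ℚ_[p.1] X}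

/-! ### The adelic twisting function -/

open Classical in
/-- The Hilbert symbol of a field `F`: it is `1` if `z² = a x² + b y²` has a non-trivial solution in
`F`, and `-1` otherwise. -/
def hilbertSym {F : Type} [Field F] (a b : F) : ℤ :=
  if ∃ x y z : F, (x, y, z) ≠ (0, 0, 0) ∧ z ^ 2 = a * x ^ 2 + b * y ^ 2 then 1 else -1

open Classical in
/-- `χ_{D,p}` on `V(ℚ_p)`; for `x ∈ ℤ_p`, the condition `p ∤ x` is `‖x‖ = 1`. -/
def chiLocal (D : ℤ) (p : Nat.Primes) (X : V D ℚ_[p.1]) : ℤ :=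
  if X ∈ dualLattice D ℤ_[p.1] ℚ_[p.1] then
    if (p.1 : ℤ) ∣ D then
      if ∃ k : ℤ_[p.1], Q X = (D : ℚ_[p.1]) * k then
        if ‖X.1‖ = 1 then hilbertSym X.1 (D : ℚ_[p.1])
        else if ‖X.2.2‖ = 1 then hilbertSym X.2.2 (D : ℚ_[p.1])
        else 0
      else 0
    else 1
  else 0

/-- `χ_D(X) = ∏_p χ_{D,p}(X_p)` on `V(𝔸_f)`; for `X ∈ V(𝔸_f)` almost all factors are `1`. -/
def chiAdelic (D : ℤ) (X : ∀ p : Nat.Primes, V D ℚ_[p.1]) : ℤ :=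
  ∏ᶠ p : Nat.Primes, chiLocal D p (X p)

/-! ### Hyperbolic space and the twisted theta function -/

/-- Hyperbolic `3`-space, the set of points `P = z + r j` with `z ∈ ℂ` and `r > 0`. -/
structure H3 where
  z : ℂ
  r : ℝ
  pos : 0 < r

/-- The element of `ℝ ⊗ ℚ(√D)`, `D < 0`, corresponding to a complex number under `√D = i √|D|`. -/
def ofComplexNumber (D : ℤ) (z : ℂ) : QuadExt D ℝ := ⟨z.re, z.im / √((|D| : ℤ) : ℝ)⟩

/-- `v(P) = (√2 r)⁻¹ (r² + |z|², z; z̄, 1) ∈ V(ℝ)`. -/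
def vec (D : ℤ) (P : H3) : V D ℝ :=
  (√2 * P.r)⁻¹ • (P.r ^ 2 + ‖P.z‖ ^ 2, ofComplexNumber D P.z, 1)

/-- The orthogonal projection `X_v` of `X` to the line `v = ℝ v(P)`. -/
def proj {D : ℤ} (P : H3) (X : V D ℝ) : V D ℝ :=
  (bil X (vec D P) / bil (vec D P) (vec D P)) • vec D P

/-- The summand of the twisted theta function at `X ∈ h L`, with `X_{v^⊥} = X - X_v`. -/
def thetaTerm (D : ℤ) (h : GAf D) (P : H3) (τ : ℍ) (X : V D ℚ) : ℂ :=
  (chiAdelic D (fun p => (h.comp p).symm (baseChange ℚ_[p.1] X)) : ℂ) *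
    ((1 / ((|D| : ℤ) : ℝ) * bil (baseChange ℝ X) (vec D P) : ℝ) : ℂ) *
    Complex.exp (2 * Real.pi * Complex.I *
      (((Q (proj P (baseChange ℝ X)) / ((|D| : ℤ) : ℝ) : ℝ) : ℂ) * (τ : ℂ) +
        ((Q (baseChange ℝ X - proj P (baseChange ℝ X)) / ((|D| : ℤ) : ℝ) : ℝ) : ℂ) *
          (starRingEnd ℂ) (τ : ℂ)))

/-- The `D`-twisted modified Siegel theta function `Θ*_{L,χ_D}(τ, P, h)`. -/
def theta (D : ℤ) (h : GAf D) (P : H3) (τ : ℍ) : ℂ :=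
  ((τ.im ^ (3 / 2 : ℝ) : ℝ) : ℂ) * ∑' X : translate h, thetaTerm D h P τ X

end TwistedTheta

end

/-!
The genus character `χ_D` is a function on the isotropic vectors of the discriminant group
`L' / D L`, supported on classes of hermitian matrices over `ℤ / D` (`chi_latVec`). The argument has
a finite, an analytic and an adelic part.

*Finite part.* The genus character is unchanged by the exchange of the diagonal entries and by
unipotent shears, which preserve the bilinear form, and a matrix in its support can be moved by them
to `diag(a, 0)`. There the finite Fourier transform is the Gauss sum of the product of the local
characters, so that `χ_D` satisfies the eigenvalue equation of the Fourier transform on its support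
(`IsGenusSystem.fourier_genusFun`). By Parseval's identity the transform has no mass left outside
the support, since the Gauss sum has the absolute value that makes the eigenvalue unitary
(`fourier_eq_of_support`, `fourier_chiDisc`). Invariance of `ψ_D` under `T` holds since the support
is isotropic (`discQ_of_chiDisc_ne_zero`).

*Analytic part.* For a lattice whose quotient by a sublattice is the discriminant group, Poisson
summation for the product of a Gaussian with the linear form `(X, v)` shows that the theta series
of an eigenfunction of the Fourier transform is multiplied by a constant under `τ ↦ -1 / τ`
(`hasSum_inversion`, `IsThetaLattice.exists_inversion`). If the series does not vanish identically
and has period `1`, the relations `S² = -1` and `(S T)³ = -1` in `SL₂(ℤ)` force the constant to be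
`1` (`inversion_const_eq_one`). Applied to `L'` at the point `j`, where the vectors of least majorant
keep the series from vanishing (`exists_latticeTheta_ne_zero`), this gives the sign of the Gauss sum
(`eigenvalue_eq`), and with it the invariance of `ψ_D` under `S`; as `S` and `T` generate the
metaplectic group (`mem_of_generators`), the invariance under `Mp₂(ℤ)` follows.

*Adelic part.* For `h ∈ G(𝔸_f)`, strong approximation for the additive group provides vectors of
`h L` with prescribed local behaviour (`exists_translate_approx`). Hence `h L'` is dual to `h L`, and
`h⁻¹` identifies `h L' / D h L` with `L' / D L` as quadratic modules (`transfer`,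
`isThetaLattice_dualTranslate`). Under this identification `χ_D(h⁻¹ X)` is the genus character,
because the Hilbert symbols `(a, D)_p` are the values of the local characters
(`hilbertSym_eq_localChar`, `chiAdelic_pullback`). So the twisted theta function is a theta series
of the kind treated in the analytic part (`theta_eq_latticeTheta`), and `slash_eq_of_inversion`
gives weight `0`.
-/


noncomputable section

namespace TwistedTheta

/-! ### Genus characters over a finite ring -/

section Genus

variable {R ι : Type} [CommRing R]

/-- A family of multiplicative functions `l i : R → {0, ±1}`, `i ∈ S`, behaving like the prime
components of a genus character on `R = ℤ / D`: `l i` is trivial on values of the norm form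
`m² + t n²`, its zeros form a proper ideal, at which the norm form ramifies, and `l i` cannot be
defined modulo a smaller ideal (`twist`). -/
structure IsGenusSystem (S : Finset ι) (l : ι → R →* ℤ) (t : R) : Prop where
  sq : ∀ i ∈ S, ∀ u, l i u ≠ 0 → l i u * l i u = 1
  isUnit : ∀ u, (∀ i ∈ S, l i u ≠ 0) → IsUnit u
  norm : ∀ i ∈ S, ∀ m n, l i (m ^ 2 + t * n ^ 2) ≠ 0 → l i (m ^ 2 + t * n ^ 2) = 1
  add : ∀ i ∈ S, ∀ u v, l i u = 0 → l i v = 0 → l i (u + v) = 0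
  ram : ∀ i ∈ S, ∀ m n, l i (m ^ 2 + t * n ^ 2) = 0 → ∀ s r, l i (2 * (m * s + t * n * r)) = 0
  sep : ∀ i ∈ S, ∃ w, l i w = 0 ∧ ∀ j ∈ S, j ≠ i → l j w ≠ 0
  twist : ∀ i ∈ S, ∃ w, l i w = -1 ∧ (∀ j ∈ S, j ≠ i → l j w = 1) ∧ ∀ u, l i u = 0 → w * u = u

/-- The product of the prime components. -/
def genusChar (S : Finset ι) (l : ι → R →* ℤ) (u : R) : ℤ := ∏ i ∈ S, l i u

/-- The determinant `a c - (m² + t n²)` of the hermitian matrix with entries `a`, `c` and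
off-diagonal coordinates `m`, `n`, recorded as `(a, m, n, c)`. -/
def genusForm (t : R) (x : R × R × R × R) : R :=
  x.1 * x.2.2.2 - (x.2.1 ^ 2 + t * x.2.2.1 ^ 2)

/-- The bilinear form of `genusForm`. -/
def genusBil (t : R) (x y : R × R × R × R) : R :=
  x.1 * y.2.2.2 + y.1 * x.2.2.2 - 2 * (x.2.1 * y.2.1 + t * x.2.2.1 * y.2.2.1)

/-- `x` if this is non-zero, and `y` otherwise. -/
def firstNonzero (x y : ℤ) : ℤ := if x = 0 then y else x

theorem firstNonzero_zero (y : ℤ) : firstNonzero 0 y = y := if_pos rfl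

theorem firstNonzero_of_ne {x : ℤ} (hx : x ≠ 0) (y : ℤ) : firstNonzero x y = x := if_neg hx

open Classical in
/-- The genus character of an isotropic matrix: the value of each component at whichever diagonal
entry is prime to it. -/
def genusFun (S : Finset ι) (l : ι → R →* ℤ) (t : R) (x : R × R × R × R) : ℤ :=
  if genusForm t x = 0 then ∏ i ∈ S, firstNonzero (l i x.1) (l i x.2.2.2) else 0

/-- The action of the lower unipotent matrix with entry `s + r ω` on hermitian matrices. -/
def genusShear (t s r : R) : R × R × R × R ≃ R × R × R × R where
  toFun x := (x.1, x.2.1 + x.1 * s, x.2.2.1 + x.1 * r,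
    x.2.2.2 + 2 * (x.2.1 * s + t * x.2.2.1 * r) + x.1 * (s ^ 2 + t * r ^ 2))
  invFun x := (x.1, x.2.1 - x.1 * s, x.2.2.1 - x.1 * r,
    x.2.2.2 - 2 * (x.2.1 * s + t * x.2.2.1 * r) + x.1 * (s ^ 2 + t * r ^ 2))
  left_inv x := by ext <;> simp <;> ring
  right_inv x := by ext <;> simp <;> ring

/-- The exchange of the two diagonal entries. -/
def genusSwap : R × R × R × R ≃ R × R × R × R where
  toFun x := (x.2.2.2, x.2.1, x.2.2.1, x.1)
  invFun x := (x.2.2.2, x.2.1, x.2.2.1, x.1)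
  left_inv _ := rfl
  right_inv _ := rfl

theorem genusForm_shear (t s r : R) (x : R × R × R × R) :
    genusForm t (genusShear t s r x) = genusForm t x := by
  simp only [genusForm, genusShear, Equiv.coe_fn_mk]; ring

theorem genusBil_shear (t s r : R) (x y : R × R × R × R) :
    genusBil t (genusShear t s r x) (genusShear t s r y) = genusBil t x y := by
  simp only [genusBil, genusShear, Equiv.coe_fn_mk]; ring

theorem genusForm_swap (t : R) (x : R × R × R × R) :
    genusForm t (genusSwap x) = genusForm t x := by
  simp only [genusForm, genusSwap, Equiv.coe_fn_mk]; ring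

theorem genusBil_swap (t : R) (x y : R × R × R × R) :
    genusBil t (genusSwap x) (genusSwap y) = genusBil t x y := by
  simp only [genusBil, genusSwap, Equiv.coe_fn_mk]; ring

variable {S : Finset ι} {l : ι → R →* ℤ} {t : R}

theorem genusChar_mul (u v : R) : genusChar S l (u * v) = genusChar S l u * genusChar S l v := by
  simp [genusChar, Finset.prod_mul_distrib]

theorem genusChar_one : genusChar S l 1 = 1 := by simp [genusChar]

theorem genusChar_eq_zero {i : ι} (hi : i ∈ S) {u : R} (h : l i u = 0) : genusChar S l u = 0 :=
  Finset.prod_eq_zero hi h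

theorem int_eq_of_mul_eq_one {u v : ℤ} (h : u * v = 1) : u = v := by
  rcases Int.mul_eq_one_iff_eq_one_or_neg_one.1 h with ⟨rfl, rfl⟩ | ⟨rfl, rfl⟩ <;> rfl

namespace IsGenusSystem

variable (H : IsGenusSystem S l t)
include H

theorem isUnit_iff {u : R} : IsUnit u ↔ ∀ i ∈ S, l i u ≠ 0 :=
  ⟨fun h i _ => (h.map (l i)).ne_zero, H.isUnit u⟩

theorem genusChar_sq {u : R} (hu : IsUnit u) : genusChar S l u * genusChar S l u = 1 := by
  rw [genusChar, ← Finset.prod_mul_distrib]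
  exact Finset.prod_eq_one fun i hi => H.sq i hi u (H.isUnit_iff.1 hu i hi)

theorem genusChar_of_not_isUnit {u : R} (hu : ¬ IsUnit u) : genusChar S l u = 0 := by
  rw [H.isUnit_iff] at hu
  push Not at hu
  obtain ⟨i, hi, h⟩ := hu
  exact genusChar_eq_zero hi h

theorem exists_twist {u : R} (hu : ¬ IsUnit u) :
    ∃ i ∈ S, ∃ w, IsUnit w ∧ genusChar S l w = -1 ∧ w * u = u ∧ l i u = 0 ∧ l i w = -1 ∧
      ∀ j ∈ S, j ≠ i → l j w = 1 := by
  classical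
  rw [H.isUnit_iff] at hu
  push Not at hu
  obtain ⟨i, hi, h⟩ := hu
  obtain ⟨w, h1, h2, h3⟩ := H.twist i hi
  refine ⟨i, hi, w, H.isUnit w fun j hj => ?_, ?_, h3 u h, h, h1, h2⟩
  · by_cases hji : j = i
    · rw [hji, h1]; decide
    · rw [h2 j hj hji]; decide
  · rw [genusChar, ← Finset.mul_prod_erase S _ hi, h1, Finset.prod_eq_one, mul_one]
    exact fun j hj => h2 j (Finset.mem_of_mem_erase hj) (Finset.ne_of_mem_erase hj)

theorem add_ne_zero {i : ι} (hi : i ∈ S) {u v : R} (hu : l i u ≠ 0) (hv : l i v = 0) :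
    l i (u + v) ≠ 0 := by
  intro h
  refine hu ?_
  have : l i (-v) = 0 := by rw [← neg_one_mul, map_mul, hv, mul_zero]
  simpa using H.add i hi _ _ h this

theorem eq_of_mul_eq_norm {i : ι} (hi : i ∈ S) {a c m n : R} (h : a * c = m ^ 2 + t * n ^ 2)
    (ha : l i a ≠ 0) (hc : l i c ≠ 0) : l i a = l i c := by
  refine int_eq_of_mul_eq_one ?_
  have := H.norm i hi m n
  rw [← h, map_mul] at this
  exact this (mul_ne_zero ha hc)

theorem genusFun_swap (x : R × R × R × R) : genusFun S l t (genusSwap x) = genusFun S l t x := by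
  unfold genusFun
  rw [genusForm_swap]
  by_cases h : genusForm t x = 0
  · rw [if_pos h, if_pos h]
    refine Finset.prod_congr rfl fun i hi => ?_
    have h' : x.1 * x.2.2.2 = x.2.1 ^ 2 + t * x.2.2.1 ^ 2 := sub_eq_zero.1 h
    have key := H.eq_of_mul_eq_norm hi h'
    simp only [genusSwap, Equiv.coe_fn_mk]
    by_cases ha : l i x.1 = 0 <;> by_cases hc : l i x.2.2.2 = 0 <;>
      simp [firstNonzero, ha, hc]
    exact (key ha hc).symm
  · rw [if_neg h, if_neg h]

theorem genusFun_shear (s r : R) (x : R × R × R × R) :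
    genusFun S l t (genusShear t s r x) = genusFun S l t x := by
  unfold genusFun
  rw [genusForm_shear]
  by_cases h : genusForm t x = 0
  · rw [if_pos h, if_pos h]
    refine Finset.prod_congr rfl fun i hi => ?_
    have h' : x.1 * x.2.2.2 = x.2.1 ^ 2 + t * x.2.2.1 ^ 2 := sub_eq_zero.1 h
    simp only [genusShear, Equiv.coe_fn_mk]
    by_cases ha : l i x.1 = 0
    · rw [ha, firstNonzero_zero, firstNonzero_zero]
      have hz : l i (2 * (x.2.1 * s + t * x.2.2.1 * r) + x.1 * (s ^ 2 + t * r ^ 2)) = 0 :=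
        H.add i hi _ _ (H.ram i hi _ _ (by rw [← h', map_mul, ha, zero_mul]) s r)
          (by rw [map_mul, ha, zero_mul])
      by_cases hc : l i x.2.2.2 = 0
      · rw [hc, add_assoc, H.add i hi _ _ hc hz]
      · symm
        -- the old times the new entry is the norm of `c + (m + n ω) conj (s + r ω)`
        refine H.eq_of_mul_eq_norm hi (m := x.2.2.2 + (x.2.1 * s + t * x.2.2.1 * r))
          (n := x.2.2.1 * s - x.2.1 * r) ?_ hc ?_
        · linear_combination (s ^ 2 + t * r ^ 2) * h'
        · rw [add_assoc]; exact H.add_ne_zero hi hc hz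
    · rw [firstNonzero_of_ne ha, firstNonzero_of_ne ha]
  · rw [if_neg h, if_neg h]

/-- A vector on which the genus character does not vanish can be moved to `(a, 0, 0, 0)`, with `a` a
unit, by exchanges of the diagonal and unipotent transformations. -/
theorem induction_of_genusFun_ne_zero {P : R × R × R × R → Prop}
    (hswap : ∀ x, P (genusSwap x) → P x) (hshear : ∀ s r x, P (genusShear t s r x) → P x)
    (hbase : ∀ a, IsUnit a → P (a, 0, 0, 0)) {x : R × R × R × R} (hx : genusFun S l t x ≠ 0) :
    P x := by
  classical
  -- after a first step the upper left entry is a unit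
  have key : ∀ x, genusForm t x = 0 → IsUnit x.1 → P x := by
    rintro ⟨a, m, n, c⟩ h ha
    obtain ⟨u, rfl⟩ := ha
    refine hshear (-(↑u⁻¹ * m)) (-(↑u⁻¹ * n)) _ ?_
    have h1 := genusForm_shear t (-(↑u⁻¹ * m)) (-(↑u⁻¹ * n)) ((u : R), m, n, c)
    have e : (genusShear t (-(↑u⁻¹ * m)) (-(↑u⁻¹ * n))) ((u : R), m, n, c) =
        ((u : R), 0, 0, ((genusShear t (-(↑u⁻¹ * m)) (-(↑u⁻¹ * n))) ((u : R), m, n, c)).2.2.2) := by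
      simp [genusShear]
    rw [e] at h1 ⊢
    rw [h] at h1
    have h2 : (u : R) * ((genusShear t (-(↑u⁻¹ * m)) (-(↑u⁻¹ * n))) ((u : R), m, n, c)).2.2.2 = 0 := by
      simpa [genusForm] using h1
    rw [(Units.mul_right_eq_zero u).1 h2]
    exact hbase _ u.isUnit
  have h0 : genusForm t x = 0 := by
    by_contra h
    exact hx (by rw [genusFun, if_neg h])
  have h' : x.1 * x.2.2.2 = x.2.1 ^ 2 + t * x.2.2.1 ^ 2 := sub_eq_zero.1 h0
  have hx' : ∀ i ∈ S, l i x.1 = 0 → l i x.2.2.2 ≠ 0 := by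
    intro i hi ha hc
    refine hx ?_
    rw [genusFun, if_pos h0]
    exact Finset.prod_eq_zero hi (by rw [ha, hc, firstNonzero_zero])
  choose! w hw1 hw2 using H.sep
  set s := ∏ i ∈ S.filter (fun i => l i x.1 ≠ 0), w i with hs
  have hs1 : ∀ i ∈ S, l i x.1 ≠ 0 → l i s = 0 := fun i hi h => by
    rw [hs, map_prod]
    exact Finset.prod_eq_zero (Finset.mem_filter.2 ⟨hi, h⟩) (hw1 i hi)
  have hs2 : ∀ i ∈ S, l i x.1 = 0 → l i s ≠ 0 := fun i hi h => by
    rw [hs, map_prod]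
    refine Finset.prod_ne_zero_iff.2 fun j hj => hw2 j (Finset.mem_filter.1 hj).1 i hi ?_
    rintro rfl
    exact (Finset.mem_filter.1 hj).2 h
  refine hswap _ (hshear s 0 _ (hswap _ (key _ ?_ ?_)))
  · rw [genusForm_swap, genusForm_shear, genusForm_swap, h0]
  · refine H.isUnit _ fun i hi => ?_
    simp only [genusSwap, genusShear, Equiv.coe_fn_mk]
    by_cases ha : l i x.1 = 0
    · have hz := H.add i hi _ _ ha
        (H.ram i hi x.2.1 x.2.2.1 (by rw [← h', map_mul, ha, zero_mul]) s 0)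
      rw [add_comm]
      refine H.add_ne_zero hi ?_ hz
      have h1 := hs2 i hi ha
      have h2 := hx' i hi ha
      simp [h1, h2]
    · rw [add_assoc]
      refine H.add_ne_zero hi ha ?_
      have : 2 * (x.2.1 * s + t * x.2.2.1 * 0) + x.2.2.2 * (s ^ 2 + t * 0 ^ 2) =
        s * (2 * x.2.1 + x.2.2.2 * s) := by ring
      rw [this, map_mul, hs1 i hi ha, zero_mul]

variable [Fintype R] (ψ : AddChar R ℂ)

/-- The Gauss sum of the product character is separable. -/
theorem gauss_separable (v : R) :
    ∑ u, (genusChar S l u : ℂ) * ψ (u * v) =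
      genusChar S l v * ∑ u, (genusChar S l u : ℂ) * ψ u := by
  by_cases hv : IsUnit v
  · obtain ⟨v, rfl⟩ := hv
    rw [Finset.mul_sum]
    refine Fintype.sum_equiv (Units.mulRight v) _ _ fun u => ?_
    have h1 : (genusChar S l (v : R) : ℂ) * genusChar S l (v : R) = 1 := by
      exact_mod_cast H.genusChar_sq v.isUnit
    simp only [Units.mulRight_apply, genusChar_mul, Int.cast_mul]
    linear_combination (-(genusChar S l u : ℂ) * ψ (u * v)) * h1
  · obtain ⟨i, hi, w, ⟨w, rfl⟩, h1, h2, -⟩ := H.exists_twist hv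
    rw [H.genusChar_of_not_isUnit hv, Int.cast_zero, zero_mul]
    rw [← self_eq_neg, ← Finset.sum_neg_distrib]
    refine Fintype.sum_equiv (Units.mulRight w) _ _ fun u => ?_
    rw [Units.mulRight_apply, genusChar_mul, h1, mul_assoc u, h2]
    push_cast; ring

/-- For a unit `c` the isotropy condition determines `a`, and the character is constant on the
solutions. -/
theorem sum_genusFun_unit (c : R) (hc : IsUnit c) :
    ∑ a, ∑ m, ∑ n, (genusFun S l t (a, m, n, c) : ℂ) =
      (Fintype.card R : ℂ) ^ 2 * genusChar S l c := by
  classical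
  obtain ⟨c, rfl⟩ := hc
  have h1 : ∀ a m n : R, genusFun S l t (a, m, n, (c : R)) =
      if a = (m ^ 2 + t * n ^ 2) * ↑c⁻¹ then genusChar S l (c : R) else 0 := by
    intro a m n
    have e : genusForm t (a, m, n, (c : R)) = 0 ↔ a = (m ^ 2 + t * n ^ 2) * ↑c⁻¹ := by
      rw [Units.eq_mul_inv_iff_mul_eq, genusForm, sub_eq_zero]
    unfold genusFun
    by_cases h : a = (m ^ 2 + t * n ^ 2) * ↑c⁻¹
    · rw [if_pos (e.2 h), if_pos h]
      refine Finset.prod_congr rfl fun i hi => ?_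
      by_cases ha : l i a = 0
      · rw [ha, firstNonzero_zero]
      · rw [firstNonzero_of_ne ha]
        exact H.eq_of_mul_eq_norm hi (Units.eq_mul_inv_iff_mul_eq _ |>.1 h) ha
          (H.isUnit_iff.1 c.isUnit i hi)
    · rw [if_neg (fun h' => h (e.1 h')), if_neg h]
  simp_rw [h1]
  have : ∀ m n : R, ∑ a, (((if a = (m ^ 2 + t * n ^ 2) * ↑c⁻¹ then
      genusChar S l (c : R) else 0 : ℤ)) : ℂ) = genusChar S l (c : R) := fun m n => by
    simp [apply_ite (Int.cast : ℤ → ℂ)]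
  rw [Finset.sum_comm, Finset.sum_congr rfl fun m _ => Finset.sum_comm]
  simp_rw [this]
  simp; ring

/-- For `c` not a unit, some local character vanishes at `c`. Multiplication of `a` by a unit that
fixes `c`, and at which only this character is `-1`, reverses the sign of the summands. -/
theorem sum_genusFun_of_not_isUnit (c : R) (hc : ¬ IsUnit c) (m n : R) :
    ∑ a, (genusFun S l t (a, m, n, c) : ℂ) = 0 := by
  classical
  obtain ⟨i, hi, w, ⟨w, rfl⟩, h1, h2, h3, h4, h5⟩ := H.exists_twist hc
  rw [← self_eq_neg, ← Finset.sum_neg_distrib]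
  refine Fintype.sum_equiv (Units.mulRight w) _ _ fun a => ?_
  rw [← Int.cast_neg, Int.cast_inj]
  have e : genusForm t (a * w, m, n, c) = genusForm t (a, m, n, c) := by
    simp only [genusForm]; rw [mul_assoc, h2]
  simp only [Units.mulRight_apply, genusFun, e]
  by_cases h : genusForm t (a, m, n, c) = 0
  · rw [if_pos h, if_pos h, ← Finset.mul_prod_erase S _ hi, ← Finset.mul_prod_erase S _ hi,
      Finset.prod_congr rfl fun j hj => ?_]
    · rw [← neg_mul]
      congr 1
      simp only [map_mul, h4, h3]
      by_cases ha : l i a = 0 <;> simp [firstNonzero, ha]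
    · simp only [map_mul, h5 j (Finset.mem_of_mem_erase hj) (Finset.ne_of_mem_erase hj), mul_one]
  · rw [if_neg h, if_neg h, neg_zero]

theorem fourier_genusFun_base (a' : R) :
    ∑ x, (genusFun S l t x : ℂ) * ψ (genusBil t x (a', 0, 0, 0)) =
      (Fintype.card R : ℂ) ^ 2 * (∑ u, (genusChar S l u : ℂ) * ψ u) * genusChar S l a' := by
  have h : ∀ x : R × R × R × R, ψ (genusBil t x (a', 0, 0, 0)) = ψ (x.2.2.2 * a') := fun x => by
    simp [genusBil, mul_comm]
  simp_rw [h, Fintype.sum_prod_type]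
  have : ∀ c, ∑ a, ∑ m, ∑ n, (genusFun S l t (a, m, n, c) : ℂ) =
      (Fintype.card R : ℂ) ^ 2 * genusChar S l c := by
    intro c
    by_cases hc : IsUnit c
    · exact H.sum_genusFun_unit c hc
    · rw [H.genusChar_of_not_isUnit hc, Int.cast_zero, mul_zero, Finset.sum_comm]
      refine Finset.sum_eq_zero fun m _ => ?_
      rw [Finset.sum_comm]
      exact Finset.sum_eq_zero fun n _ => H.sum_genusFun_of_not_isUnit c hc m n
  have e : ∑ a, ∑ m, ∑ n, ∑ c, (genusFun S l t (a, m, n, c) : ℂ) * ψ (c * a') =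
      ∑ c, (∑ a, ∑ m, ∑ n, (genusFun S l t (a, m, n, c) : ℂ)) * ψ (c * a') := by
    simp_rw [Finset.sum_mul]
    rw [Finset.sum_congr rfl fun a _ => Finset.sum_congr rfl fun m _ => Finset.sum_comm,
      Finset.sum_congr rfl fun a _ => Finset.sum_comm, Finset.sum_comm]
  rw [e]
  simp_rw [this, mul_assoc, ← Finset.mul_sum]
  rw [H.gauss_separable]; ring

/-- The genus character on isotropic hermitian matrices is, on its support, an eigenfunction of the
Fourier transform. -/
theorem fourier_genusFun {y : R × R × R × R} (hy : genusFun S l t y ≠ 0) :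
    ∑ x, (genusFun S l t x : ℂ) * ψ (genusBil t x y) =
      (Fintype.card R : ℂ) ^ 2 * (∑ u, (genusChar S l u : ℂ) * ψ u) * genusFun S l t y := by
  refine H.induction_of_genusFun_ne_zero (P := fun y =>
    ∑ x, (genusFun S l t x : ℂ) * ψ (genusBil t x y) =
      (Fintype.card R : ℂ) ^ 2 * (∑ u, (genusChar S l u : ℂ) * ψ u) * genusFun S l t y)
    (fun y h => ?_) (fun s r y h => ?_) (fun a ha => ?_) hy
  · rw [H.genusFun_swap] at h
    rw [← h]
    refine Fintype.sum_equiv genusSwap _ _ fun x => ?_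
    rw [H.genusFun_swap, genusBil_swap]
  · rw [H.genusFun_shear] at h
    rw [← h]
    refine Fintype.sum_equiv (genusShear t s r) _ _ fun x => ?_
    rw [H.genusFun_shear, genusBil_shear]
  · rw [H.fourier_genusFun_base]
    congr 2
    have : genusForm t (a, 0, 0, 0) = 0 := by simp [genusForm]
    rw [genusFun, if_pos this, genusChar]
    exact Finset.prod_congr rfl fun i hi => (firstNonzero_of_ne (H.isUnit_iff.1 ha i hi) _).symm

/-- The Gauss sum of the product character has absolute value `√|R|`. -/
theorem normSq_gauss (hψ : ψ.IsPrimitive) :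
    Complex.normSq (∑ u, (genusChar S l u : ℂ) * ψ u) = Fintype.card R := by
  classical
  set g := ∑ u, (genusChar S l u : ℂ) * ψ u with hg
  set U : ℂ := ∑ u : R, (genusChar S l u : ℂ) * genusChar S l u with hU
  have hU0 : U ≠ 0 := by
    have h1 : (0 : ℤ) < ∑ u : R, genusChar S l u * genusChar S l u :=
      Finset.sum_pos' (fun u _ => mul_self_nonneg _) ⟨1, Finset.mem_univ _, by simp [genusChar_one]⟩
    rw [hU]
    exact_mod_cast h1.ne'
  -- both sides compute the square norm of the Fourier transform of the character
  have h1 : ∑ v : R, (∑ u, (genusChar S l u : ℂ) * ψ (u * v)) *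
      (starRingEnd ℂ) (∑ u, (genusChar S l u : ℂ) * ψ (u * v)) = U * (Complex.normSq g : ℂ) := by
    rw [hU, Finset.sum_mul]
    refine Finset.sum_congr rfl fun v _ => ?_
    rw [H.gauss_separable, map_mul, map_intCast, ← Complex.mul_conj]; ring
  have h2 : ∑ v : R, (∑ u, (genusChar S l u : ℂ) * ψ (u * v)) *
      (starRingEnd ℂ) (∑ u, (genusChar S l u : ℂ) * ψ (u * v)) = U * (Fintype.card R : ℂ) := by
    simp_rw [map_sum, Finset.sum_mul_sum, map_mul, map_intCast, ← AddChar.map_neg_eq_conj]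
    rw [Finset.sum_comm, hU, Finset.sum_mul]
    refine Finset.sum_congr rfl fun u _ => ?_
    rw [Finset.sum_comm]
    have : ∀ u' : R, ∑ v, (genusChar S l u : ℂ) * ψ (u * v) *
        ((genusChar S l u' : ℂ) * ψ (-(u' * v))) =
        if u' = u then (genusChar S l u : ℂ) * genusChar S l u' * Fintype.card R else 0 := by
      intro u'
      have h3 := AddChar.sum_mulShift (u - u') hψ
      have h4 : ∀ v, (genusChar S l u : ℂ) * ψ (u * v) *
          ((genusChar S l u' : ℂ) * ψ (-(u' * v))) =
          (genusChar S l u : ℂ) * genusChar S l u' * ψ (v * (u - u')) := fun v => by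
        rw [show v * (u - u') = u * v + -(u' * v) by ring, AddChar.map_add_eq_mul]; ring
      simp_rw [h4]
      rw [← Finset.mul_sum, h3]
      by_cases huu : u' = u
      · simp [huu]
      · rw [if_neg huu, if_neg (sub_ne_zero.2 (Ne.symm huu)), Nat.cast_zero, mul_zero]
    simp_rw [this]
    simp
  have := mul_left_cancel₀ hU0 (h1.symm.trans h2)
  exact_mod_cast this

end IsGenusSystem

end Genus

/-! ### The prime components of the genus character of a discriminant -/

/-- The number `(D² - D) / 4`, the norm of `ω_D`. -/
def normOmega (D : ℤ) : ℤ := (D * D - D) / 4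

namespace IsFundamentalDiscriminant

variable {D : ℤ} (hD : IsFundamentalDiscriminant D)
include hD

theorem ne_zero : D ≠ 0 := by
  rintro rfl
  rcases hD with ⟨-, ⟨h, -⟩ | ⟨m, h, h1, h2⟩⟩ <;> omega

theorem natAbs_ne_zero : D.natAbs ≠ 0 := Int.natAbs_ne_zero.2 hD.ne_zero

theorem emod_four : D % 4 = 0 ∨ D % 4 = 1 := by
  rcases hD with ⟨-, ⟨h, -⟩ | ⟨m, rfl, -⟩⟩ <;> omega

theorem four_mul_normOmega : 4 * normOmega D = D * D - D := by
  refine Int.mul_ediv_cancel' ?_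
  rcases hD.emod_four with h | h
  · exact dvd_sub (Dvd.dvd.mul_right (by omega) _) (by omega)
  · have : D * D - D = D * (D - 1) := by ring
    rw [this]
    exact Dvd.dvd.mul_left (by omega) _

/-- The three possible residues of an even fundamental discriminant. -/
theorem two_dvd_cases (h : 2 ∣ D) : D % 8 = 4 ∧ D % 16 = 12 ∨ D % 32 = 8 ∨ D % 32 = 24 := by
  rcases hD with ⟨-, ⟨h, -⟩ | ⟨m, rfl, h1, -⟩⟩ <;> omega

theorem not_sq_dvd {p : ℕ} (hp : p.Prime) (h2 : p ≠ 2) : ¬ (p : ℤ) * p ∣ D := by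
  intro h
  have hp' : Prime (p : ℤ) := Nat.prime_iff_prime_int.1 hp
  rcases hD with ⟨-, ⟨-, hs⟩ | ⟨m, rfl, -, hs⟩⟩
  · exact hp'.not_isUnit (hs _ h)
  · refine hp'.not_isUnit (hs _ ?_)
    have hc : IsCoprime ((p : ℤ) * p) 4 := by
      have : IsCoprime (p : ℤ) 2 := by
        rw [show (2 : ℤ) = ((2 : ℕ) : ℤ) by rfl, Nat.isCoprime_iff_coprime]
        exact (Nat.coprime_primes hp Nat.prime_two).2 h2
      rw [show (4 : ℤ) = 2 * 2 by norm_num]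
      exact (this.mul_left this).mul_right (this.mul_left this)
    exact hc.dvd_of_dvd_mul_left h

theorem dvd_normOmega {p : ℕ} (hp : p.Prime) (h2 : p ≠ 2) (h : (p : ℤ) ∣ D) :
    (p : ℤ) ∣ normOmega D := by
  have hp' : Prime (p : ℤ) := Nat.prime_iff_prime_int.1 hp
  have h4 : (p : ℤ) ∣ 4 * normOmega D := by
    rw [hD.four_mul_normOmega]
    exact dvd_sub (h.mul_right _) h
  refine (hp'.dvd_or_dvd h4).resolve_left fun h' => h2 ?_
  have : p ∣ 2 ^ 2 := by exact_mod_cast h'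
  exact (Nat.prime_dvd_prime_iff_eq hp Nat.prime_two).1 (hp.dvd_of_dvd_pow this)

end IsFundamentalDiscriminant

open Classical in
/-- The component at a prime `p ∣ D` of the genus character of `D`, as a function on `ℤ / D`: the
Legendre symbol modulo `p` for odd `p`, and a character modulo `4` or `8` for `p = 2`. -/
def localChar (D : ℤ) (p : ℕ) : ZMod D.natAbs →* ℤ :=
  if h : p = 2 ∧ 8 ∣ D.natAbs then
    (if D % 32 = 8 then ZMod.χ₈ else ZMod.χ₈').toMonoidHom.comp
      (ZMod.castHom h.2 (ZMod 8)).toMonoidHom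
  else if h : p = 2 ∧ 4 ∣ D.natAbs then
    ZMod.χ₄.toMonoidHom.comp (ZMod.castHom h.2 (ZMod 4)).toMonoidHom
  else if h : p.Prime ∧ p ∣ D.natAbs then
    haveI := Fact.mk h.1
    (quadraticChar (ZMod p)).toMonoidHom.comp (ZMod.castHom h.2 (ZMod p)).toMonoidHom
  else 1

theorem localChar_odd {D : ℤ} {p : ℕ} [hp : Fact p.Prime] (h2 : p ≠ 2) (h : (p : ℤ) ∣ D) (a : ℤ) :
    localChar D p (a : ZMod D.natAbs) = legendreSym p a := by
  have h' : p.Prime ∧ p ∣ D.natAbs := ⟨hp.1, Int.natCast_dvd.1 h⟩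
  rw [localChar, dif_neg (by simp [h2]), dif_neg (by simp [h2]), dif_pos h']
  simp [legendreSym]

theorem localChar_two_four {D : ℤ} (h : D % 8 = 4) (a : ℤ) :
    localChar D 2 (a : ZMod D.natAbs) = ZMod.χ₄ a := by
  rw [localChar, dif_neg (by omega), dif_pos ⟨rfl, by omega⟩]
  simp

theorem localChar_two_eight {D : ℤ} (h : D % 32 = 8) (a : ℤ) :
    localChar D 2 (a : ZMod D.natAbs) = ZMod.χ₈ a := by
  rw [localChar, dif_pos ⟨rfl, by omega⟩, if_pos h]
  simp

theorem localChar_two_eight' {D : ℤ} (h : D % 32 = 24) (a : ℤ) :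
    localChar D 2 (a : ZMod D.natAbs) = ZMod.χ₈' a := by
  rw [localChar, dif_pos ⟨rfl, by omega⟩, if_neg (by omega)]
  simp

namespace IsFundamentalDiscriminant

variable {D : ℤ} (hD : IsFundamentalDiscriminant D)
include hD

theorem localChar_eq_zero_iff {p : ℕ} (hp : p.Prime) (h : (p : ℤ) ∣ D) (a : ℤ) :
    localChar D p (a : ZMod D.natAbs) = 0 ↔ (p : ℤ) ∣ a := by
  have := Fact.mk hp
  by_cases h2 : p = 2
  · subst h2
    rcases hD.two_dvd_cases h with ⟨h', -⟩ | h' | h'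
    · rw [localChar_two_four h', ZMod.χ₄_int_eq_if_mod_four, Nat.cast_ofNat]
      split_ifs <;> simp <;> omega
    · rw [localChar_two_eight h', ZMod.χ₈_int_eq_if_mod_eight, Nat.cast_ofNat]
      split_ifs <;> simp <;> omega
    · rw [localChar_two_eight' h', ZMod.χ₈'_int_eq_if_mod_eight, Nat.cast_ofNat]
      split_ifs <;> simp <;> omega
  · rw [localChar_odd h2 h, legendreSym.eq_zero_iff, ZMod.intCast_zmod_eq_zero_iff_dvd]

theorem localChar_sq {p : ℕ} (hp : p.Prime) (h : (p : ℤ) ∣ D) (a : ℤ)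
    (ha : localChar D p (a : ZMod D.natAbs) ≠ 0) :
    localChar D p (a : ZMod D.natAbs) * localChar D p (a : ZMod D.natAbs) = 1 := by
  have := Fact.mk hp
  by_cases h2 : p = 2
  · subst h2
    rcases hD.two_dvd_cases h with ⟨h', -⟩ | h' | h'
    · rw [localChar_two_four h', ZMod.χ₄_int_eq_if_mod_four] at *; split_ifs at * <;> simp_all
    · rw [localChar_two_eight h', ZMod.χ₈_int_eq_if_mod_eight] at *; split_ifs at * <;> simp_all
    · rw [localChar_two_eight' h', ZMod.χ₈'_int_eq_if_mod_eight] at *; split_ifs at * <;> simp_all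
  · rw [localChar_odd h2 h] at *
    rw [← sq]
    refine legendreSym.sq_one p fun h0 => ha ?_
    rwa [legendreSym.eq_zero_iff]

/-- Norms are in the kernel of each component. -/
theorem localChar_norm {p : ℕ} (hp : p.Prime) (h : (p : ℤ) ∣ D) (m n : ℤ)
    (ha : localChar D p ((m ^ 2 + normOmega D * n ^ 2 : ℤ) : ZMod D.natAbs) ≠ 0) :
    localChar D p ((m ^ 2 + normOmega D * n ^ 2 : ℤ) : ZMod D.natAbs) = 1 := by
  have := Fact.mk hp
  by_cases h2 : p = 2
  · subst h2
    have h4 := hD.four_mul_normOmega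
    rcases hD.two_dvd_cases h with ⟨h', h''⟩ | h' | h'
    · rw [localChar_two_four h'] at *
      obtain ⟨k, hk⟩ : ∃ k, D = 16 * k + 12 := ⟨D / 16, by omega⟩
      obtain ⟨j, hj⟩ : ∃ j, normOmega D = 4 * j + 1 :=
        ⟨16 * k ^ 2 + 23 * k + 8, by rw [hk] at h4 ⊢; linarith⟩
      rw [hj] at ha ⊢
      push_cast at ha ⊢
      have : (4 : ZMod 4) = 0 := by decide
      rw [this, zero_mul, zero_add] at ha ⊢
      clear this
      clear h4 hj
      revert ha
      generalize (m : ZMod 4) = u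
      generalize (n : ZMod 4) = v
      revert u v; decide
    · rw [localChar_two_eight h'] at *
      obtain ⟨k, hk⟩ : ∃ k, D = 32 * k + 8 := ⟨D / 32, by omega⟩
      obtain ⟨j, hj⟩ : ∃ j, normOmega D = 8 * j + 6 :=
        ⟨32 * k ^ 2 + 15 * k + 1, by rw [hk] at h4 ⊢; linarith⟩
      rw [hj] at ha ⊢
      push_cast at ha ⊢
      have : (8 : ZMod 8) = 0 := by decide
      rw [this, zero_mul, zero_add] at ha ⊢
      clear this
      clear h4 hj
      revert ha
      generalize (m : ZMod 8) = u
      generalize (n : ZMod 8) = v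
      revert u v; decide
    · rw [localChar_two_eight' h'] at *
      obtain ⟨k, hk⟩ : ∃ k, D = 32 * k + 24 := ⟨D / 32, by omega⟩
      obtain ⟨j, hj⟩ : ∃ j, normOmega D = 8 * j + 2 :=
        ⟨32 * k ^ 2 + 47 * k + 17, by rw [hk] at h4 ⊢; linarith⟩
      rw [hj] at ha ⊢
      push_cast at ha ⊢
      have : (8 : ZMod 8) = 0 := by decide
      rw [this, zero_mul, zero_add] at ha ⊢
      clear this
      clear h4 hj
      revert ha
      generalize (m : ZMod 8) = u
      generalize (n : ZMod 8) = v
      revert u v; decide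
  · rw [localChar_odd h2 h] at *
    obtain ⟨k, hk⟩ := hD.dvd_normOmega hp h2 h
    have e : (((m ^ 2 + normOmega D * n ^ 2 : ℤ)) : ZMod p) = (m : ZMod p) ^ 2 := by
      rw [hk]; push_cast; simp
    rw [legendreSym, e] at ha ⊢
    refine quadraticChar_sq_one' fun h0 => ha ?_
    rw [h0]; simp

/-- Each component is -1 at some integer prime to `D` that is `1` modulo `D / p`. -/
theorem exists_twist {p : ℕ} (hp : p.Prime) (h : (p : ℤ) ∣ D) :
    ∃ w : ℤ, localChar D p (w : ZMod D.natAbs) = -1 ∧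
      (∀ q : ℕ, q.Prime → (q : ℤ) ∣ D → q ≠ p → localChar D q (w : ZMod D.natAbs) = 1) ∧
      ∀ u : ℤ, (p : ℤ) ∣ u → D ∣ w * u - u := by
  have := Fact.mk hp
  obtain ⟨k, hk⟩ := h
  by_cases h2 : p = 2
  · subst h2
    push_cast at hk
    refine ⟨1 + k, ?_, fun q hq hqD hq2 => ?_, fun u hu => ?_⟩
    · rcases hD.two_dvd_cases (by omega) with ⟨h', h''⟩ | h' | h'
      · rw [localChar_two_four h', ZMod.χ₄_int_eq_if_mod_four]; split_ifs <;> omega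
      · rw [localChar_two_eight h', ZMod.χ₈_int_eq_if_mod_eight]; split_ifs <;> omega
      · rw [localChar_two_eight' h', ZMod.χ₈'_int_eq_if_mod_eight]; split_ifs <;> omega
    · have := Fact.mk hq
      have hqk : (q : ℤ) ∣ k := by
        have hq' : Prime (q : ℤ) := Nat.prime_iff_prime_int.1 hq
        refine (hq'.dvd_or_dvd (hk ▸ hqD)).resolve_left fun h' => hq2 ?_
        exact (Nat.prime_dvd_prime_iff_eq hq Nat.prime_two).1 (by exact_mod_cast h')
      rw [localChar_odd hq2 hqD, legendreSym]
      have : ((1 + k : ℤ) : ZMod q) = 1 := by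
        rw [Int.cast_add, (ZMod.intCast_zmod_eq_zero_iff_dvd k q).2 hqk]; simp
      rw [this]; simp
    · obtain ⟨v, rfl⟩ := hu
      exact ⟨v, by rw [hk]; push_cast; ring⟩
  · have hpk : ¬ (p : ℤ) ∣ k := by
      rintro ⟨j, rfl⟩
      exact hD.not_sq_dvd hp h2 ⟨j, by rw [hk, mul_assoc]⟩
    have hk0 : (k : ZMod p) ≠ 0 := by rwa [Ne, ZMod.intCast_zmod_eq_zero_iff_dvd]
    obtain ⟨x, hx⟩ := quadraticChar_exists_neg_one (F := ZMod p) (by rwa [ZMod.ringChar_zmod_n])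
    obtain ⟨y, hy⟩ := ZMod.intCast_surjective ((k : ZMod p)⁻¹ * (x - 1))
    refine ⟨1 + k * y, ?_, fun q hq hqD hqp => ?_, fun u hu => ?_⟩
    · rw [localChar_odd h2 (hk ▸ dvd_mul_right _ _), legendreSym]
      have : ((1 + k * y : ℤ) : ZMod p) = x := by
        push_cast; rw [hy, mul_inv_cancel_left₀ hk0]; ring
      rw [this, hx]
    · have := Fact.mk hq
      have hq' : Prime (q : ℤ) := Nat.prime_iff_prime_int.1 hq
      by_cases hq2 : q = 2
      · subst hq2
        have hodd : (p : ℤ) % 2 = 1 := by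
          have := hp.eq_two_or_odd; omega
        have hc : ∀ e : ℕ, IsCoprime ((2 : ℤ) ^ e) (p : ℤ) := fun e => by
          refine IsCoprime.pow_left ?_
          rw [show (2 : ℤ) = ((2 : ℕ) : ℤ) by rfl, Nat.isCoprime_iff_coprime]
          exact (Nat.coprime_primes Nat.prime_two hp).2 (Ne.symm h2)
        have h8 : ∀ e : ℕ, (2 : ℤ) ^ e ∣ D → (2 : ℤ) ^ e ∣ k * y := fun e he =>
          ((hc e).dvd_of_dvd_mul_left (hk ▸ he)).mul_right y
        rcases hD.two_dvd_cases (by omega) with ⟨h', h''⟩ | h' | h'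
        · have := h8 2 (by norm_num; omega)
          norm_num at this
          rw [localChar_two_four h', ZMod.χ₄_int_eq_if_mod_four]; split_ifs <;> omega
        · have := h8 3 (by norm_num; omega)
          norm_num at this
          rw [localChar_two_eight h', ZMod.χ₈_int_eq_if_mod_eight]; split_ifs <;> omega
        · have := h8 3 (by norm_num; omega)
          norm_num at this
          rw [localChar_two_eight' h', ZMod.χ₈'_int_eq_if_mod_eight]; split_ifs <;> omega
      · have hqk : (q : ℤ) ∣ k := by
          refine (hq'.dvd_or_dvd (hk ▸ hqD)).resolve_left fun h' => hqp ?_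
          exact (Nat.prime_dvd_prime_iff_eq hq hp).1 (by exact_mod_cast h')
        rw [localChar_odd hq2 hqD, legendreSym]
        have : ((1 + k * y : ℤ) : ZMod q) = 1 := by
          rw [Int.cast_add, (ZMod.intCast_zmod_eq_zero_iff_dvd _ q).2 (hqk.mul_right y)]; simp
        rw [this]; simp
    · obtain ⟨v, rfl⟩ := hu
      exact ⟨y * v, by rw [hk]; ring⟩

/-- The local characters of a fundamental discriminant form a genus system modulo `D`. -/
theorem isGenusSystem : IsGenusSystem D.natAbs.primeFactors (localChar D)
    ((normOmega D : ℤ) : ZMod D.natAbs) := by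
  have hS : ∀ p ∈ D.natAbs.primeFactors, p.Prime ∧ (p : ℤ) ∣ D := fun p hp =>
    ⟨Nat.prime_of_mem_primeFactors hp, Int.natCast_dvd.2 (Nat.dvd_of_mem_primeFactors hp)⟩
  have lift := ZMod.intCast_surjective (n := D.natAbs)
  have hz : ∀ p ∈ D.natAbs.primeFactors, ∀ a : ℤ,
      localChar D p (a : ZMod D.natAbs) = 0 ↔ (p : ℤ) ∣ a := fun p hp a =>
    hD.localChar_eq_zero_iff (hS p hp).1 (hS p hp).2 a
  refine ⟨?_, ?_, ?_, ?_, ?_, ?_, ?_⟩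
  · intro p hp u
    obtain ⟨a, rfl⟩ := lift u
    exact hD.localChar_sq (hS p hp).1 (hS p hp).2 a
  · intro u hu
    obtain ⟨a, rfl⟩ := lift u
    rw [ZMod.coe_int_isUnit_iff_isCoprime, Int.isCoprime_iff_gcd_eq_one]
    refine Nat.coprime_of_dvd fun p hp h1 h2 => hu p ?_ ((hz p ?_ a).2 (Int.natCast_dvd.2 h2))
    all_goals
      rw [Int.natAbs_natCast] at h1
      exact Nat.mem_primeFactors.2 ⟨hp, h1, hD.natAbs_ne_zero⟩
  · intro p hp u v
    obtain ⟨m, rfl⟩ := lift u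
    obtain ⟨n, rfl⟩ := lift v
    exact_mod_cast hD.localChar_norm (hS p hp).1 (hS p hp).2 m n
  · intro p hp u v
    obtain ⟨m, rfl⟩ := lift u
    obtain ⟨n, rfl⟩ := lift v
    rw [← Int.cast_add, hz p hp, hz p hp, hz p hp]
    exact dvd_add
  · intro p hp u v
    obtain ⟨m, rfl⟩ := lift u
    obtain ⟨n, rfl⟩ := lift v
    intro h s r
    obtain ⟨s, rfl⟩ := lift s
    obtain ⟨r, rfl⟩ := lift r
    have h' : localChar D p ((m ^ 2 + normOmega D * n ^ 2 : ℤ) : ZMod D.natAbs) = 0 := by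
      exact_mod_cast h
    have : localChar D p ((2 * (m * s + normOmega D * n * r) : ℤ) : ZMod D.natAbs) = 0 := by
      rw [hz p hp] at h' ⊢
      by_cases h2 : p = 2
      · subst h2; exact dvd_mul_right _ _
      · have ht := hD.dvd_normOmega (hS p hp).1 h2 (hS p hp).2
        have hm : (p : ℤ) ∣ m ^ 2 := (dvd_add_left (ht.mul_right _)).1 h'
        have hm' := (Nat.prime_iff_prime_int.1 (hS p hp).1).dvd_of_dvd_pow hm
        exact (dvd_add (hm'.mul_right _) ((ht.mul_right _).mul_right _)).mul_left _
    exact_mod_cast this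
  · intro p hp
    refine ⟨((p : ℤ) : ZMod D.natAbs), (hz p hp p).2 dvd_rfl, fun q hq hqp h => hqp ?_⟩
    have := (hz q hq p).1 h
    exact (Nat.prime_dvd_prime_iff_eq (hS q hq).1 (hS p hp).1).1 (by exact_mod_cast this)
  · intro p hp
    obtain ⟨w, h1, h2, h3⟩ := hD.exists_twist (hS p hp).1 (hS p hp).2
    refine ⟨w, h1, fun q hq hqp => h2 q (hS q hq).1 (hS q hq).2 hqp, fun u hu => ?_⟩
    obtain ⟨a, rfl⟩ := lift u
    have := h3 a ((hz p hp a).1 hu)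
    rw [← Int.cast_mul, ← sub_eq_zero, ← Int.cast_sub, ZMod.intCast_zmod_eq_zero_iff_dvd]
    rwa [Int.natAbs_dvd]

end IsFundamentalDiscriminant

/-! ### Poisson summation in several variables -/

section Poisson

open MeasureTheory

variable {ι : Type} [Fintype ι]

/-- The function `∏ (1 + x_i²)⁻¹`, used as a majorant. -/
def prodDecay (x : ι → ℝ) : ℝ := ∏ i, (1 + x i ^ 2)⁻¹

theorem prodDecay_nonneg (x : ι → ℝ) : 0 ≤ prodDecay x :=
  Finset.prod_nonneg fun i _ => by positivity

theorem prodDecay_add_le (x y : ι → ℝ) :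
    prodDecay (x + y) ≤ (∏ i, (2 + 2 * x i ^ 2)) * prodDecay y := by
  rw [prodDecay, prodDecay, ← Finset.prod_mul_distrib]
  refine Finset.prod_le_prod (fun i _ => by positivity) fun i _ => ?_
  rw [← div_eq_mul_inv, inv_eq_one_div, div_le_div_iff₀ (by positivity) (by positivity), Pi.add_apply]
  nlinarith [sq_nonneg (2 * x i + y i), sq_nonneg (x i * (x i + y i)), sq_nonneg (x i)]

theorem integrable_prodDecay : Integrable (prodDecay : (ι → ℝ) → ℝ) :=
  Integrable.fintype_prod (f := fun _ (v : ℝ) => (1 + v ^ 2)⁻¹) fun _ => integrable_inv_one_add_sq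

theorem summable_prodDecay : Summable fun k : ι → ℤ => prodDecay fun i => (k i : ℝ) := by
  classical
  have h1 : Summable fun n : ℤ => (1 + (n : ℝ) ^ 2)⁻¹ := by
    have h2 : Summable fun n : ℤ => (1 : ℝ) / (n : ℝ) ^ 2 :=
      (Real.summable_one_div_int_pow (p := 2)).2 one_lt_two
    refine Summable.of_norm_bounded_eventually h2 ?_
    rw [Filter.eventually_cofinite]
    refine (Set.finite_singleton (0 : ℤ)).subset fun n hn => ?_
    by_contra h0
    refine hn ?_
    have : (0 : ℝ) < (n : ℝ) ^ 2 := by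
      have : (n : ℝ) ≠ 0 := by exact_mod_cast h0
      positivity
    rw [Real.norm_of_nonneg (by positivity), inv_eq_one_div]
    exact one_div_le_one_div_of_le this (by linarith)
  refine summable_of_sum_le (c := ∏ _i : ι, ∑' n : ℤ, (1 + (n : ℝ) ^ 2)⁻¹)
    (fun k => prodDecay_nonneg _) fun u => ?_
  calc ∑ k ∈ u, prodDecay (fun i => (k i : ℝ))
      ≤ ∑ k ∈ Fintype.piFinset (fun i : ι => u.image fun k : ι → ℤ => k i), prodDecay (fun i => (k i : ℝ)) := by
        refine Finset.sum_le_sum_of_subset_of_nonneg (fun k hk => ?_) fun _ _ _ => prodDecay_nonneg _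
        exact Fintype.mem_piFinset.2 fun i => Finset.mem_image_of_mem (fun k => k i) hk
    _ = ∏ i : ι, ∑ n ∈ u.image (fun k : ι → ℤ => k i), (1 + (n : ℝ) ^ 2)⁻¹ := by
        rw [Finset.prod_univ_sum]; rfl
    _ ≤ _ := by
        refine Finset.prod_le_prod (fun i _ => Finset.sum_nonneg fun n _ => by positivity) fun i _ => ?_
        exact h1.sum_le_tsum _ fun n _ => by positivity

/-- The character `x ↦ e(n · x)`. -/
def expDot (n x : ι → ℝ) : ℂ := Complex.exp (2 * Real.pi * Complex.I * ((∑ i, n i * x i : ℝ) : ℂ))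

theorem norm_expDot (n x : ι → ℝ) : ‖expDot n x‖ = 1 := by
  rw [expDot, show 2 * (Real.pi : ℂ) * Complex.I * ((∑ i, n i * x i : ℝ) : ℂ) =
    ((2 * Real.pi * ∑ i, n i * x i : ℝ) : ℂ) * Complex.I by push_cast; ring]
  exact Complex.norm_exp_ofReal_mul_I _

theorem expDot_add_int (n k : ι → ℤ) (x : ι → ℝ) :
    expDot (fun i => (n i : ℝ)) (x + fun i => (k i : ℝ)) = expDot (fun i => (n i : ℝ)) x := by
  have h : ∑ i, (n i : ℝ) * (x + fun i => (k i : ℝ)) i = ∑ i, (n i : ℝ) * x i +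
      ((∑ i, n i * k i : ℤ) : ℝ) := by
    push_cast
    rw [← Finset.sum_add_distrib]
    exact Finset.sum_congr rfl fun i _ => by rw [Pi.add_apply]; ring
  rw [expDot, expDot, h, Complex.ofReal_add, mul_add, Complex.exp_add]
  have : Complex.exp (2 * Real.pi * Complex.I * (((∑ i, n i * k i : ℤ) : ℝ) : ℂ)) = 1 := by
    rw [Complex.exp_eq_one_iff]
    exact ⟨∑ i, n i * k i, by push_cast; ring⟩
  rw [this, mul_one]

theorem mFourier_coe (n : ι → ℤ) (x : ι → ℝ) :
    UnitAddTorus.mFourier n (fun i => ((x i : ℝ) : UnitAddCircle)) =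
      expDot (fun i => (n i : ℝ)) x := by
  simp only [UnitAddTorus.mFourier, ContinuousMap.coe_mk, fourier_coe_apply, expDot]
  rw [← Complex.exp_sum]
  congr 1
  push_cast
  rw [Finset.mul_sum]
  exact Finset.sum_congr rfl fun i _ => by ring

theorem continuous_expDot (n : ι → ℝ) : Continuous (expDot n) := by
  unfold expDot; fun_prop

/-- The Fourier transform on `ι → ℝ`. -/
def fourierPi (f : (ι → ℝ) → ℂ) (n : ι → ℝ) : ℂ := ∫ v, expDot (-n) v * f v

variable {f : (ι → ℝ) → ℂ} {C : ℝ}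

theorem nonneg_of_le_prodDecay (hb : ∀ x, ‖f x‖ ≤ C * prodDecay x) : 0 ≤ C := by
  have h := (norm_nonneg _).trans (hb 0)
  have h1 : prodDecay (0 : ι → ℝ) = 1 := by simp [prodDecay]
  rwa [h1, mul_one] at h

theorem continuous_sum_translates (hf : Continuous f) (hb : ∀ x, ‖f x‖ ≤ C * prodDecay x) :
    Continuous fun x : ι → ℝ => ∑' k : ι → ℤ, f (x + fun i => (k i : ℝ)) := by
  have hC := nonneg_of_le_prodDecay hb
  rw [continuous_iff_continuousAt]
  intro x₀
  set B := ‖x₀‖ + 1 with hB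
  have h0 : Summable fun k : ι → ℤ => (C * ∏ _i : ι, (2 + 2 * B ^ 2)) *
    prodDecay fun i => (k i : ℝ) := summable_prodDecay.mul_left _
  refine ContinuousOn.continuousAt (s := Metric.ball 0 B)
    (continuousOn_tsum (fun k => ?_) h0 fun k x hx => ?_) (Metric.isOpen_ball.mem_nhds (by simp [hB]))
  · fun_prop
  · refine (hb _).trans ?_
    rw [mul_assoc]
    refine mul_le_mul_of_nonneg_left ((prodDecay_add_le x fun i => (k i : ℝ)).trans ?_) hC
    refine mul_le_mul_of_nonneg_right (Finset.prod_le_prod (fun i _ => by positivity) fun i _ => ?_)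
      (prodDecay_nonneg _)
    have h1 : |x i| ≤ B := (norm_le_pi_norm x i).trans (mem_ball_zero_iff.1 hx).le
    have h2 : x i ^ 2 ≤ B ^ 2 := sq_le_sq' (abs_le.1 h1).1 (abs_le.1 h1).2
    linarith

omit [Fintype ι] in
theorem unitCubes_iUnion :
    (⋃ k : ι → ℤ, {x : ι → ℝ | ∀ i, x i ∈ Set.Ioc (k i : ℝ) (k i + 1)}) = Set.univ := by
  refine Set.eq_univ_of_forall fun x => Set.mem_iUnion.2 ⟨fun i => ⌈x i⌉ - 1, fun i => ?_⟩
  push_cast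
  exact ⟨by linarith [Int.ceil_lt_add_one (x i)], by linarith [Int.le_ceil (x i)]⟩

omit [Fintype ι] in
theorem unitCubes_disjoint :
    Pairwise (Function.onFun Disjoint
      fun k : ι → ℤ => {x : ι → ℝ | ∀ i, x i ∈ Set.Ioc (k i : ℝ) (k i + 1)}) := by
  intro k l hkl
  refine Set.disjoint_left.2 fun x hx hy => hkl (funext fun i => ?_)
  have h1 := hx i
  have h2 := hy i
  have h3 : (k i : ℝ) < l i + 1 := h1.1.trans_le h2.2
  have h4 : (l i : ℝ) < k i + 1 := h2.1.trans_le h1.2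
  have h5 : k i < l i + 1 := by exact_mod_cast h3
  have h6 : l i < k i + 1 := by exact_mod_cast h4
  omega

theorem hasSum_integral_unitCube {E : Type} [NormedAddCommGroup E] [NormedSpace ℝ E]
    {g : (ι → ℝ) → E} (hg : Integrable g) :
    HasSum (fun k : ι → ℤ => ∫ x in {x : ι → ℝ | ∀ i, x i ∈ Set.Ioc (0 : ℝ) (0 + 1)},
      g (x + fun i => (k i : ℝ))) (∫ x, g x) := by
  have h := hasSum_integral_iUnion (μ := volume) (f := g)
    (s := fun k : ι → ℤ => {x : ι → ℝ | ∀ i, x i ∈ Set.Ioc (k i : ℝ) (k i + 1)})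
    (fun k => by
      have : {x : ι → ℝ | ∀ i, x i ∈ Set.Ioc (k i : ℝ) (k i + 1)} =
        Set.pi Set.univ fun i => Set.Ioc (k i : ℝ) (k i + 1) := by ext; simp
      rw [this]
      exact MeasurableSet.univ_pi fun i => measurableSet_Ioc)
    unitCubes_disjoint hg.integrableOn
  rw [unitCubes_iUnion, setIntegral_univ] at h
  convert h using 2 with k
  rw [← (measurePreserving_add_right volume (fun i => (k i : ℝ))).setIntegral_preimage_emb
    (MeasurableEquiv.addRight _).measurableEmbedding g]
  congr 2
  ext x
  simp only [Set.mem_ofPred_eq, Set.preimage_ofPred_eq, Pi.add_apply, Set.mem_Ioc]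
  refine forall_congr' fun i => ?_
  constructor <;> rintro ⟨h1, h2⟩ <;> constructor <;> linarith

/-- Poisson summation for a continuous function with integrable decay and summable Fourier
transform. -/
theorem hasSum_poisson (hf : Continuous f) (hb : ∀ x, ‖f x‖ ≤ C * prodDecay x)
    (hs : Summable fun n : ι → ℤ => fourierPi f fun i => (n i : ℝ)) (x : ι → ℝ) :
    HasSum (fun n : ι → ℤ => fourierPi f (fun i => (n i : ℝ)) * expDot (fun i => (n i : ℝ)) x)
      (∑' k : ι → ℤ, f (x + fun i => (k i : ℝ))) := by
  set G : (ι → ℝ) → ℂ := fun x => ∑' k : ι → ℤ, f (x + fun i => (k i : ℝ)) with hG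
  have hGp : ∀ (x : ι → ℝ) (n : ι → ℤ), G (x + fun i => (n i : ℝ)) = G x := fun x n => by
    rw [hG]
    simp only
    rw [← (Equiv.addLeft n).tsum_eq (fun k : ι → ℤ => f (x + fun i => (k i : ℝ)))]
    refine tsum_congr fun k => ?_
    congr 1
    ext i; simp [add_assoc]
  -- the descent of `G` to the torus
  set π : (ι → ℝ) → UnitAddTorus ι := Pi.map fun _ (x : ℝ) => (x : UnitAddCircle) with hπ
  have hπq : IsOpenQuotientMap π := IsOpenQuotientMap.piMap fun _ => QuotientAddGroup.isOpenQuotientMap_mk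
  set F : UnitAddTorus ι → ℂ := fun t => G (Function.surjInv hπq.surjective t) with hF
  have hFπ : ∀ x, F (π x) = G x := fun x => by
    have h1 : π (Function.surjInv hπq.surjective (π x)) = π x := Function.surjInv_eq _ _
    have h2 : ∀ i, ∃ n : ℤ, Function.surjInv hπq.surjective (π x) i = x i + n := fun i => by
      have h3 : ((Function.surjInv hπq.surjective (π x) i : ℝ) : UnitAddCircle) = (x i : ℝ) :=
        congrFun h1 i
      rw [← sub_eq_zero, ← AddCircle.coe_sub, AddCircle.coe_eq_zero_iff] at h3
      obtain ⟨n, hn⟩ := h3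
      exact ⟨n, by rw [zsmul_eq_mul, mul_one] at hn; linarith⟩
    choose n hn using h2
    have h4 : Function.surjInv hπq.surjective (π x) = x + fun i => (n i : ℝ) := funext hn
    rw [hF]
    simp only
    rw [h4, hGp]
  have hFc : Continuous F := by
    rw [hπq.isQuotientMap.continuous_iff]
    have : F ∘ π = G := funext hFπ
    rw [this]
    exact continuous_sum_translates hf hb
  have hfi : Integrable f := (integrable_prodDecay.const_mul C).mono' hf.aestronglyMeasurable
    (Filter.Eventually.of_forall hb)
  have hcoef : ∀ n : ι → ℤ, UnitAddTorus.mFourierCoeff F n = fourierPi f fun i => (n i : ℝ) := by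
    intro n
    set g : (ι → ℝ) → ℂ := fun v => expDot (-fun i => (n i : ℝ)) v * f v with hg
    have hneg : (-fun i => (n i : ℝ)) = fun i => (((-n) i : ℤ) : ℝ) := by ext i; simp
    have hgi : Integrable g := hfi.bdd_mul (c := 1) (continuous_expDot _).aestronglyMeasurable
      (Filter.Eventually.of_forall fun v => (norm_expDot _ _).le)
    have hgc : Continuous g := (continuous_expDot _).mul hf
    rw [UnitAddTorus.mFourierCoeff_eq_integral F n 0]
    have h1 := hasSum_integral_unitCube hgi
    have h2 := hasSum_integral_unitCube hgi.norm
    have h3 := hasSum_integral_of_summable_integral_norm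
      (μ := volume.restrict {x : ι → ℝ | ∀ i, x i ∈ Set.Ioc (0 : ℝ) (0 + 1)})
      (F := fun (k : ι → ℤ) x => g (x + fun i => (k i : ℝ)))
      (fun k => (hgi.comp_add_right _).integrableOn) h2.summable
    refine Eq.trans ?_ (h3.unique h1)
    refine integral_congr_ae (Filter.Eventually.of_forall fun x => ?_)
    simp only
    rw [mFourier_coe, ← hneg]
    change _ • F (π x) = _
    rw [hFπ, smul_eq_mul, hG]
    simp only
    rw [← tsum_mul_left]
    refine tsum_congr fun k => ?_
    rw [hg]
    simp only
    rw [hneg, expDot_add_int]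
  have hs' : Summable (UnitAddTorus.mFourierCoeff F) := by
    rwa [show UnitAddTorus.mFourierCoeff F = _ from funext hcoef]
  have := UnitAddTorus.hasSum_mFourier_series_apply_of_summable (f := ⟨F, hFc⟩) hs' (π x)
  simp only [ContinuousMap.coe_mk, hFπ, hcoef, smul_eq_mul] at this
  convert this using 3 with n
  exact (mFourier_coe n x).symm

end Poisson

/-! ### The Gaussian of signature (1,3) and its Fourier transform -/

section Gauss

open MeasureTheory
open scoped Real

theorem integral_exp_gauss {b : ℂ} (hb : 0 < b.re) (ξ : ℝ) :
    ∫ x : ℝ, Complex.exp (-(2 * π * Complex.I * (ξ * x))) * Complex.exp (-π * b * x ^ 2) =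
      1 / b ^ (1 / 2 : ℂ) * Complex.exp (-π / b * ξ ^ 2) := by
  have h := congrFun (fourier_gaussian_pi hb) ξ
  rw [Real.fourier_real_eq_integral_exp_smul] at h
  rw [← h]
  refine integral_congr_ae (Filter.Eventually.of_forall fun x => ?_)
  simp only [smul_eq_mul]
  congr 2
  push_cast; ring

theorem integral_exp_mul_gauss {b : ℂ} (hb : 0 < b.re) (ξ : ℝ) :
    ∫ x : ℝ, Complex.exp (-(2 * π * Complex.I * (ξ * x))) * (x * Complex.exp (-π * b * x ^ 2)) =
      -Complex.I * ξ / b * (1 / b ^ (1 / 2 : ℂ) * Complex.exp (-π / b * ξ ^ 2)) := by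
  have hb' : 0 < ((π : ℂ) * b).re := by
    rw [Complex.re_ofReal_mul]; exact mul_pos Real.pi_pos hb
  have hb0 : b ≠ 0 := fun h => by simp [h] at hb
  have i1 : Integrable fun x : ℝ => Complex.exp (-π * b * x ^ 2) := by
    simpa only [neg_mul] using integrable_cexp_neg_mul_sq hb'
  have i2 : Integrable fun x : ℝ => x • Complex.exp (-π * b * x ^ 2) := by
    simpa only [neg_mul, Complex.real_smul] using integrable_mul_cexp_neg_mul_sq hb'
  have h1 := Real.hasDerivAt_fourier i1 i2 ξ
  rw [fourier_gaussian_pi hb] at h1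
  have h2 : HasDerivAt (fun t : ℝ => 1 / b ^ (1 / 2 : ℂ) * Complex.exp (-π / b * t ^ 2))
      (1 / b ^ (1 / 2 : ℂ) * (Complex.exp (-π / b * ξ ^ 2) * (-π / b * (2 * ξ)))) ξ := by
    have h3 : HasDerivAt (fun t : ℝ => -π / b * (t : ℂ) ^ 2) (-π / b * (2 * ξ)) ξ := by
      have := ((hasDerivAt_id ξ).ofReal_comp.pow 2).const_mul (-π / b)
      simpa using this
    exact h3.cexp.const_mul _
  have h3 := h1.unique h2
  rw [Real.fourier_real_eq_integral_exp_smul] at h3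
  have h4 : ∫ v : ℝ, Complex.exp (↑(-2 * π * v * ξ) * Complex.I) •
      (-2 * ↑π * Complex.I * ↑v) • Complex.exp (-↑π * b * ↑v ^ 2) = (-2 * π * Complex.I) *
      ∫ x : ℝ, Complex.exp (-(2 * π * Complex.I * (ξ * x))) * (x * Complex.exp (-π * b * x ^ 2)) := by
    rw [← integral_const_mul]
    refine integral_congr_ae (Filter.Eventually.of_forall fun x => ?_)
    simp only [smul_eq_mul]
    rw [show (↑(-2 * π * x * ξ) : ℂ) * Complex.I = -(2 * π * Complex.I * (ξ * x)) by push_cast; ring]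
    ring
  rw [h4] at h3
  have hpi : (π : ℂ) ≠ 0 := Complex.ofReal_ne_zero.2 Real.pi_ne_zero
  have h5 : (-2 * π * Complex.I : ℂ) ≠ 0 := by simp [hpi]
  refine mul_left_cancel₀ h5 (h3.trans ?_)
  linear_combination (-(2 * π * ξ / b) * (1 / b ^ (1 / 2 : ℂ)) *
    Complex.exp (-π / b * ξ ^ 2)) * Complex.I_sq

/-- The function `w₀ e((s/2) (w₀² τ - (w₁² + w₂² + w₃²) τ̄))` on `ℝ^{1,3}`. -/
def minkGauss (s : ℝ) (τ : ℂ) (w : Fin 4 → ℝ) : ℂ :=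
  w 0 * Complex.exp (π * Complex.I * s * (τ * (w 0 : ℂ) ^ 2 -
    (starRingEnd ℂ) τ * ((w 1 : ℂ) ^ 2 + (w 2 : ℂ) ^ 2 + (w 3 : ℂ) ^ 2)))

/-- The form of signature (1,3) on `ℝ⁴`. -/
def mink (w w' : Fin 4 → ℝ) : ℝ := w 0 * w' 0 - w 1 * w' 1 - w 2 * w' 2 - w 3 * w' 3

/-- The reflection identifying the form of signature (1,3) with the dot product. -/
def minkFlip (w : Fin 4 → ℝ) : Fin 4 → ℝ := ![w 0, -w 1, -w 2, -w 3]

theorem continuous_minkGauss (s : ℝ) (τ : ℂ) : Continuous (minkGauss s τ) := by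
  unfold minkGauss; fun_prop

theorem norm_minkGauss (s : ℝ) (τ : ℂ) (w : Fin 4 → ℝ) :
    ‖minkGauss s τ w‖ = |w 0| * Real.exp (-(π * s * τ.im * ∑ i, w i ^ 2)) := by
  rw [minkGauss, norm_mul, Complex.norm_exp, Complex.norm_real, Real.norm_eq_abs]
  congr 2
  rw [Fin.sum_univ_four]
  have : (π * Complex.I * s * (τ * (w 0 : ℂ) ^ 2 -
    (starRingEnd ℂ) τ * ((w 1 : ℂ) ^ 2 + (w 2 : ℂ) ^ 2 + (w 3 : ℂ) ^ 2))) =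
    ((π * s : ℝ) : ℂ) * (Complex.I * (τ * ((w 0 ^ 2 : ℝ) : ℂ) -
    (starRingEnd ℂ) τ * ((w 1 ^ 2 + w 2 ^ 2 + w 3 ^ 2 : ℝ) : ℂ))) := by push_cast; ring
  have key : ∀ u v : ℝ, (Complex.I * (τ * (u : ℂ) - (starRingEnd ℂ) τ * (v : ℂ))).re =
      -(τ.im * (u + v)) := fun u v => by simp; ring
  rw [this, Complex.re_ofReal_mul, key]
  ring

/-- The Gaussian of signature `(1, 3)` times the linear polynomial `y₀` is, up to `τ ↦ -1 / τ` and a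
constant, its own Fourier transform. -/
theorem fourierPi_minkGauss {s : ℝ} (hs : 0 < s) {τ : ℂ} (hτ : 0 < τ.im) (y : Fin 4 → ℝ) :
    fourierPi (minkGauss s τ) (s • minkFlip y) =
      -Complex.I * ((s ^ 2)⁻¹ : ℝ) * ((‖τ‖ ^ 3)⁻¹ : ℝ) * minkGauss s (-1 / τ) y := by
  set b : ℂ := -Complex.I * τ * s with hb
  have hb1 : 0 < b.re := by
    have : b.re = τ.im * s := by simp [hb]
    rw [this]; exact mul_pos hτ hs
  have hb2 : 0 < ((starRingEnd ℂ) b).re := by rwa [Complex.conj_re]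
  have hτ0 : τ ≠ 0 := fun h => by simp [h] at hτ
  have hs0 : (s : ℂ) ≠ 0 := Complex.ofReal_ne_zero.2 hs.ne'
  have hcb : (starRingEnd ℂ) b = Complex.I * (starRingEnd ℂ) τ * s := by simp [hb]
  have hcτ0 : (starRingEnd ℂ) τ ≠ 0 := by simpa using hτ0
  -- the integral is a product of four one-dimensional integrals
  set f : Fin 4 → ℝ → ℂ := ![
    fun x => Complex.exp (-(2 * π * Complex.I * ((s * y 0 : ℝ) * x))) * (x * Complex.exp (-π * b * x ^ 2)),
    fun x => Complex.exp (-(2 * π * Complex.I * ((-(s * y 1) : ℝ) * x))) * Complex.exp (-π * (starRingEnd ℂ) b * x ^ 2),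
    fun x => Complex.exp (-(2 * π * Complex.I * ((-(s * y 2) : ℝ) * x))) * Complex.exp (-π * (starRingEnd ℂ) b * x ^ 2),
    fun x => Complex.exp (-(2 * π * Complex.I * ((-(s * y 3) : ℝ) * x))) * Complex.exp (-π * (starRingEnd ℂ) b * x ^ 2)]
    with hf
  have h1 : ∀ w : Fin 4 → ℝ, expDot (-(s • minkFlip y)) w * minkGauss s τ w = ∏ i, f i (w i) := by
    intro w
    rw [Fin.prod_univ_four]
    simp only [hf, Matrix.cons_val_zero, Matrix.cons_val_one, Matrix.cons_val]
    rw [expDot, minkGauss, Fin.sum_univ_four]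
    simp only [minkFlip, Pi.neg_apply, Pi.smul_apply, smul_eq_mul, Matrix.cons_val_zero,
      Matrix.cons_val_one, Matrix.cons_val, hcb]
    simp only [hb]
    rw [mul_left_comm, ← Complex.exp_add]
    rw [show ∀ A B C D E F G H : ℂ, A * (w 0 * B) * (C * D) * (E * F) * (G * H) =
      w 0 * ((A * B) * (C * D) * (E * F) * (G * H)) by intros; ring]
    simp only [← Complex.exp_add]
    congr 2
    push_cast
    ring
  rw [fourierPi]
  simp_rw [h1]
  rw [integral_fintype_prod_volume_eq_prod, Fin.prod_univ_four]
  simp only [hf, Matrix.cons_val_zero, Matrix.cons_val_one, Matrix.cons_val]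
  rw [integral_exp_mul_gauss hb1, integral_exp_gauss hb2, integral_exp_gauss hb2,
    integral_exp_gauss hb2, minkGauss]
  have hb0 : b ≠ 0 := fun h => by simp [h] at hb1
  -- the product of the four square roots
  set c : ℂ := b ^ (1 / 2 : ℂ) with hc
  have hc2 : c * c = b := by
    rw [hc, ← Complex.cpow_add _ _ hb0]; norm_num
  have hcc : (starRingEnd ℂ) b ^ (1 / 2 : ℂ) = (starRingEnd ℂ) c := by
    have harg : b.arg ≠ π := fun h => by
      rw [Complex.arg_eq_pi_iff] at h; linarith [h.1]
    have := Complex.cpow_conj b (1 / 2) harg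
    rw [hc, ← Complex.conj_conj ((starRingEnd ℂ) b ^ (1 / 2 : ℂ)), ← this, map_div₀, map_one,
      map_ofNat]
  rw [hcc]
  have hc0 : c ≠ 0 := fun h => hb0 (by rw [← hc2, h, mul_zero])
  have hcc0 : (starRingEnd ℂ) c ≠ 0 := by simpa using hc0
  have hnorm : c * (starRingEnd ℂ) c = (‖b‖ : ℂ) := by
    rw [Complex.mul_conj, Complex.normSq_eq_norm_sq, ← hc2, norm_mul, sq]
  have hnb : ‖b‖ = ‖τ‖ * s := by
    rw [hb]; simp [abs_of_pos hs]
  have hcc2 : (starRingEnd ℂ) c * (starRingEnd ℂ) c = (starRingEnd ℂ) b := by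
    rw [← map_mul, hc2]
  have hbb : b * (starRingEnd ℂ) b = (‖b‖ : ℂ) ^ 2 := by
    rw [Complex.mul_conj, Complex.normSq_eq_norm_sq]; push_cast; ring
  have hexp : Complex.exp (-π / b * ((s * y 0 : ℝ) : ℂ) ^ 2) *
      Complex.exp (-π / (starRingEnd ℂ) b * ((-(s * y 1) : ℝ) : ℂ) ^ 2) *
      Complex.exp (-π / (starRingEnd ℂ) b * ((-(s * y 2) : ℝ) : ℂ) ^ 2) *
      Complex.exp (-π / (starRingEnd ℂ) b * ((-(s * y 3) : ℝ) : ℂ) ^ 2) =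
      Complex.exp (π * Complex.I * s * (-1 / τ * (y 0 : ℂ) ^ 2 -
      (starRingEnd ℂ) (-1 / τ) * ((y 1 : ℂ) ^ 2 + (y 2 : ℂ) ^ 2 + (y 3 : ℂ) ^ 2))) := by
    simp only [← Complex.exp_add]
    congr 1
    rw [hcb, hb]
    simp only [map_div₀, map_neg, map_one]
    push_cast
    field_simp
    ring_nf
    simp only [Complex.I_sq]
    ring
  rw [← hexp]
  have hconst : (1 / b) * (1 / c) * (1 / (starRingEnd ℂ) c) ^ 3 =
      (((s ^ 3)⁻¹ : ℝ) : ℂ) * ((‖τ‖ ^ 3)⁻¹ : ℝ) := by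
    have e1 : b * c * (starRingEnd ℂ) c ^ 3 = (‖b‖ : ℂ) ^ 3 := by
      calc b * c * (starRingEnd ℂ) c ^ 3
          = b * ((starRingEnd ℂ) c * (starRingEnd ℂ) c) * (c * (starRingEnd ℂ) c) := by ring
        _ = _ := by rw [hcc2, hbb, hnorm]; ring
    have e2 : (1 / b) * (1 / c) * (1 / (starRingEnd ℂ) c) ^ 3 =
      (b * c * (starRingEnd ℂ) c ^ 3)⁻¹ := by field_simp
    rw [e2, e1, hnb]
    push_cast
    rw [mul_pow, mul_inv, mul_comm]
  have hs2 : (((s ^ 2)⁻¹ : ℝ) : ℂ) = s * (((s ^ 3)⁻¹ : ℝ) : ℂ) := by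
    push_cast; field_simp
  rw [hs2]
  generalize Complex.exp (-π / b * ((s * y 0 : ℝ) : ℂ) ^ 2) = E0
  generalize Complex.exp (-π / (starRingEnd ℂ) b * ((-(s * y 1) : ℝ) : ℂ) ^ 2) = E1
  generalize Complex.exp (-π / (starRingEnd ℂ) b * ((-(s * y 2) : ℝ) : ℂ) ^ 2) = E2
  generalize Complex.exp (-π / (starRingEnd ℂ) b * ((-(s * y 3) : ℝ) : ℂ) ^ 2) = E3
  push_cast at hconst ⊢
  linear_combination (-Complex.I * s * y 0 * E0 * E1 * E2 * E3) * hconst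

/-- The decay in lattice coordinates that makes the theta series and the Poisson summation converge. -/
theorem minkGauss_decay {s : ℝ} (hs : 0 < s) {τ : ℂ} (hτ : 0 < τ.im)
    {T : (Fin 4 → ℝ) →ₗ[ℝ] (Fin 4 → ℝ)} (hT : Function.Injective T) :
    ∃ C, ∀ t, ‖minkGauss s τ (T t)‖ ≤ C * prodDecay t := by
  obtain ⟨K, hK, hKT⟩ := T.exists_antilipschitzWith (LinearMap.ker_eq_bot.2 hT)
  set a : ℝ := π * s * τ.im with ha
  have ha0 : 0 < a := by positivity
  refine ⟨(1 + (K : ℝ) ^ 2) ^ 4 * (120 / a ^ 5 * Real.exp a), fun t => ?_⟩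
  rw [norm_minkGauss, ← ha]
  set S := ∑ i, T t i ^ 2 with hS
  have hS0 : 0 ≤ S := Finset.sum_nonneg fun i _ => sq_nonneg _
  have h1 : ∀ i, T t i ^ 2 ≤ S := fun i =>
    Finset.single_le_sum (f := fun i => T t i ^ 2) (fun i _ => sq_nonneg _) (Finset.mem_univ i)
  have h2 : |T t 0| ≤ 1 + S := by
    rw [abs_le]; constructor <;> nlinarith [h1 0, sq_nonneg (T t 0 - 1), sq_nonneg (T t 0 + 1)]
  have h3 : ‖t‖ ^ 2 ≤ K ^ 2 * S := by
    have h4 : ‖t‖ ≤ K * ‖T t‖ := by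
      have := hKT.le_mul_dist t 0
      simpa using this
    have h5 : ‖T t‖ ≤ √S := by
      refine (pi_norm_le_iff_of_nonneg (Real.sqrt_nonneg _)).2 fun i => ?_
      rw [Real.norm_eq_abs]
      exact Real.abs_le_sqrt (h1 i)
    calc ‖t‖ ^ 2 ≤ (K * √S) ^ 2 := by
          refine pow_le_pow_left₀ (norm_nonneg _) (h4.trans ?_) 2
          exact mul_le_mul_of_nonneg_left h5 K.2
      _ = _ := by rw [mul_pow, Real.sq_sqrt hS0]
  have h4 : ∀ i, t i ^ 2 ≤ K ^ 2 * S := fun i => by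
    refine le_trans ?_ h3
    rw [← sq_abs, ← Real.norm_eq_abs]
    exact pow_le_pow_left₀ (norm_nonneg _) (norm_le_pi_norm t i) 2
  have h5 : ((1 + (K : ℝ) ^ 2) * (1 + S)) ^ 4 * prodDecay t ≥ 1 := by
    have : ∏ i, (1 + t i ^ 2) ≤ ((1 + (K : ℝ) ^ 2) * (1 + S)) ^ 4 := by
      have h6 : ∏ i, (1 + t i ^ 2) ≤ ∏ _i : Fin 4, ((1 + (K : ℝ) ^ 2) * (1 + S)) :=
        Finset.prod_le_prod (fun i _ => by positivity) fun i _ => by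
          nlinarith [h4 i, sq_nonneg (K : ℝ)]
      simpa using h6
    have h7 : 0 < ∏ i, (1 + t i ^ 2) := Finset.prod_pos fun i _ => by positivity
    rw [prodDecay, Finset.prod_inv_distrib, ge_iff_le, ← div_eq_mul_inv, le_div_iff₀ h7, one_mul]
    exact this
  have h6 : (1 + S) ^ 5 * Real.exp (-(a * S)) ≤ 120 / a ^ 5 * Real.exp a := by
    have h7 := Real.pow_div_factorial_le_exp (a * (1 + S)) (by positivity) 5
    have h8 : Real.exp (a * (1 + S)) * Real.exp (-(a * S)) = Real.exp a := by
      rw [← Real.exp_add]; ring_nf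
    have h9 : ((Nat.factorial 5 : ℕ) : ℝ) = 120 := by norm_num [Nat.factorial]
    rw [h9, mul_pow] at h7
    calc (1 + S) ^ 5 * Real.exp (-(a * S))
        = 120 / a ^ 5 * ((a ^ 5 * (1 + S) ^ 5 / 120) * Real.exp (-(a * S))) := by
          field_simp
      _ ≤ 120 / a ^ 5 * (Real.exp (a * (1 + S)) * Real.exp (-(a * S))) := by gcongr
      _ = _ := by rw [h8]
  calc |T t 0| * Real.exp (-(a * S)) ≤ (1 + S) * Real.exp (-(a * S)) := by gcongr
    _ ≤ (1 + S) * Real.exp (-(a * S)) * (((1 + (K : ℝ) ^ 2) * (1 + S)) ^ 4 * prodDecay t) :=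
        le_mul_of_one_le_right (by positivity) h5
    _ = (1 + (K : ℝ) ^ 2) ^ 4 * ((1 + S) ^ 5 * Real.exp (-(a * S))) * prodDecay t := by ring
    _ ≤ _ := by
        have := prodDecay_nonneg t
        gcongr

end Gauss

/-! ### Coordinates adapted to a point of hyperbolic space -/

section Coordinates

variable {D : ℤ}

theorem bil_def {F : Type} [Field F] (X Y : V D F) :
    bil X Y = X.1 * Y.2.2 + Y.1 * X.2.2 - 2 * (X.2.1.re * Y.2.1.re - D * X.2.1.im * Y.2.1.im) := by
  rw [bil, QuadraticAlgebra.trace_def]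
  simp only [QuadraticAlgebra.re_mul, QuadraticAlgebra.im_mul, QuadraticAlgebra.re_star,
    QuadraticAlgebra.im_star]
  ring

theorem Q_def {F : Type} [Field F] (X : V D F) :
    Q X = X.1 * X.2.2 - (X.2.1.re ^ 2 - D * X.2.1.im ^ 2) := by
  simp [Q, QuadraticAlgebra.norm_def]
  ring

theorem Q_add {F : Type} [Field F] (X Y : V D F) : Q (X + Y) = Q X + Q Y + bil X Y := by
  simp only [Q_def, bil_def, Prod.fst_add, Prod.snd_add, QuadraticAlgebra.re_add,
    QuadraticAlgebra.im_add]
  ring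

theorem bil_comm {F : Type} [Field F] (X Y : V D F) : bil X Y = bil Y X := by
  simp only [bil_def]; ring

theorem bil_self {F : Type} [Field F] (X : V D F) : bil X X = 2 * Q X := by
  simp only [Q_def, bil_def]; ring

theorem bil_add_right {F : Type} [Field F] (X Y Z : V D F) :
    bil X (Y + Z) = bil X Y + bil X Z := by
  simp only [bil_def, Prod.fst_add, Prod.snd_add, QuadraticAlgebra.re_add,
    QuadraticAlgebra.im_add]
  ring

theorem bil_smul_right {F : Type} [Field F] (r : F) (X Y : V D F) :
    bil X (r • Y) = r * bil X Y := by
  simp only [bil_def, Prod.smul_fst, Prod.smul_snd, QuadraticAlgebra.re_smul,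
    QuadraticAlgebra.im_smul, smul_eq_mul]
  ring

/-- Extension of scalars as an additive map. -/
def baseChangeHom (D : ℤ) (F : Type) [Field F] [Algebra ℚ F] : V D ℚ →+ V D F where
  toFun := baseChange F
  map_zero' := by
    simp only [baseChange, Prod.fst_zero, Prod.snd_zero, QuadraticAlgebra.re_zero,
      QuadraticAlgebra.im_zero, map_zero]
    rfl
  map_add' X Y := by
    simp only [baseChange, Prod.fst_add, Prod.snd_add, QuadraticAlgebra.re_add,
      QuadraticAlgebra.im_add, map_add]
    rfl

theorem bil_baseChange {F : Type} [Field F] [Algebra ℚ F] (X Y : V D ℚ) :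
    bil (baseChange F X) (baseChange F Y) = algebraMap ℚ F (bil X Y) := by
  simp only [bil_def, baseChange, map_add, map_sub, map_mul, map_ofNat, map_intCast]

theorem Q_baseChange {F : Type} [Field F] [Algebra ℚ F] (X : V D ℚ) :
    Q (baseChange F X) = algebraMap ℚ F (Q X) := by
  simp only [Q_def, baseChange, map_sub, map_mul, map_pow, map_intCast]

/-- Coordinates on `V(ℝ)` in which the bilinear form is `mink` and `v(P)` is the first basis
vector. -/
def coords (D : ℤ) (P : H3) : V D ℝ →ₗ[ℝ] (Fin 4 → ℝ) where
  toFun X :=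
    ![(X.1 - 2 * (X.2.1.re * P.z.re + X.2.1.im * √((|D| : ℤ) : ℝ) * P.z.im) +
        X.2.2 * (P.z.re ^ 2 + P.z.im ^ 2) + X.2.2 * P.r ^ 2) / (√2 * P.r),
      (X.1 - 2 * (X.2.1.re * P.z.re + X.2.1.im * √((|D| : ℤ) : ℝ) * P.z.im) +
        X.2.2 * (P.z.re ^ 2 + P.z.im ^ 2) - X.2.2 * P.r ^ 2) / (√2 * P.r),
      √2 * (X.2.1.re - X.2.2 * P.z.re),
      √2 * (X.2.1.im * √((|D| : ℤ) : ℝ) - X.2.2 * P.z.im)]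
  map_add' X Y := by
    ext i; fin_cases i <;> simp <;> ring
  map_smul' r X := by
    ext i; fin_cases i <;> simp <;> ring

theorem mink_coords (hneg : D < 0) (P : H3) (X Y : V D ℝ) :
    mink (coords D P X) (coords D P Y) = bil X Y := by
  have h2 : √(2 : ℝ) * √2 = 2 := Real.mul_self_sqrt (by norm_num)
  have hD : √((|D| : ℤ) : ℝ) * √((|D| : ℤ) : ℝ) = -(D : ℝ) := by
    rw [Real.mul_self_sqrt (by positivity), abs_of_neg hneg]; push_cast; ring
  have hr := P.pos.ne'
  have h0 : √(2 : ℝ) ≠ 0 := by positivity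
  simp only [mink, coords, LinearMap.coe_mk, AddHom.coe_mk, Matrix.cons_val_zero,
    Matrix.cons_val_one, Matrix.cons_val, bil_def]
  generalize √((|D| : ℤ) : ℝ) = d at *
  rw [show (D : ℝ) * X.2.1.im * Y.2.1.im = -(d * d) * (X.2.1.im * Y.2.1.im) by rw [hD]; ring,
    div_mul_div_comm, div_mul_div_comm, ← sub_div,
    show √2 * P.r * (√2 * P.r) = 2 * P.r ^ 2 by linear_combination P.r ^ 2 * h2]
  rw [show ∀ x y z w w' : ℝ, x - √2 * y * (√2 * z) - √2 * w * (√2 * w') =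
    x - 2 * (y * z) - 2 * (w * w') from
    fun x y z w w' => by linear_combination (-(y * z) - w * w') * h2]
  field_simp
  ring

theorem coords_vec (hneg : D < 0) (P : H3) : coords D P (vec D P) = ![1, 0, 0, 0] := by
  have h2 : √(2 : ℝ) * √2 = 2 := Real.mul_self_sqrt (by norm_num)
  have hd : √|(D : ℝ)| ≠ 0 := by
    have : (D : ℝ) ≠ 0 := by exact_mod_cast hneg.ne
    positivity
  have hr := P.pos.ne'
  have h0 : √(2 : ℝ) ≠ 0 := by positivity
  have hz : ‖P.z‖ ^ 2 = P.z.re ^ 2 + P.z.im ^ 2 := by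
    rw [← Complex.normSq_eq_norm_sq, Complex.normSq_apply]; ring
  ext i
  fin_cases i <;> simp [coords, vec, ofComplexNumber, hz] <;> field_simp
  · linear_combination (-(P.r) ^ 2) * h2
  · left; ring
  · ring

/-- The coordinates of a rational vector. -/
def coordsQ (D : ℤ) (P : H3) (X : V D ℚ) : Fin 4 → ℝ := coords D P (baseChange ℝ X)

theorem coordsQ_add (P : H3) (X Y : V D ℚ) :
    coordsQ D P (X + Y) = coordsQ D P X + coordsQ D P Y := by
  rw [coordsQ, show baseChange ℝ (X + Y) = _ from (baseChangeHom D ℝ).map_add X Y, map_add]; rfl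

theorem coordsQ_sum_zsmul (P : H3) (n : Fin 4 → ℤ) (b : Fin 4 → V D ℚ) :
    coordsQ D P (∑ j, n j • b j) = ∑ j, (n j : ℝ) • coordsQ D P (b j) := by
  have : coordsQ D P = ⇑((coords D P).toAddMonoidHom.comp (baseChangeHom D ℝ)) := rfl
  rw [this, map_sum]
  refine Finset.sum_congr rfl fun j _ => ?_
  rw [map_zsmul, ← Int.cast_smul_eq_zsmul ℝ]

theorem mink_coordsQ (hneg : D < 0) (P : H3) (X Y : V D ℚ) :
    mink (coordsQ D P X) (coordsQ D P Y) = ((bil X Y : ℚ) : ℝ) := by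
  rw [coordsQ, coordsQ, mink_coords hneg, bil_baseChange]; rfl

theorem thetaTerm_eq (hneg : D < 0) (h : GAf D) (P : H3) (τ : ℍ) (X : V D ℚ) :
    thetaTerm D h P τ X =
      (chiAdelic D (fun p => (h.comp p).symm (baseChange ℚ_[p.1] X)) : ℂ) *
        ((((|D| : ℤ) : ℝ)⁻¹ : ℝ) : ℂ) * minkGauss (((|D| : ℤ) : ℝ)⁻¹) τ (coordsQ D P X) := by
  set w := coordsQ D P X with hw
  have e1 : bil (baseChange ℝ X) (vec D P) = w 0 := by
    rw [← mink_coords hneg P, coords_vec hneg P, hw, coordsQ]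
    simp [mink]
  have e2 : bil (vec D P) (vec D P) = 1 := by
    rw [← mink_coords hneg P, coords_vec hneg P]
    simp [mink]
  have e3 : proj P (baseChange ℝ X) = w 0 • vec D P := by
    rw [proj, e1, e2, div_one]
  have e4 : Q (proj P (baseChange ℝ X)) = w 0 ^ 2 / 2 := by
    have := bil_self (proj P (baseChange ℝ X))
    rw [← mink_coords hneg P, e3, map_smul, coords_vec hneg P] at this
    rw [e3]
    simp [mink] at this
    linarith
  have e5 : Q (baseChange ℝ X - proj P (baseChange ℝ X)) = -(w 1 ^ 2 + w 2 ^ 2 + w 3 ^ 2) / 2 := by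
    have := bil_self (baseChange ℝ X - proj P (baseChange ℝ X))
    rw [← mink_coords hneg P, e3, map_sub, map_smul, coords_vec hneg P,
      show coords D P (baseChange ℝ X) = w from rfl] at this
    rw [e3]
    simp [mink] at this
    linarith
  rw [thetaTerm, e1, e4, e5, minkGauss]
  rw [show ∀ N : ℝ, 2 * (Real.pi : ℂ) * Complex.I * (((w 0 ^ 2 / 2 / N : ℝ) : ℂ) * (τ : ℂ) +
      ((-(w 1 ^ 2 + w 2 ^ 2 + w 3 ^ 2) / 2 / N : ℝ) : ℂ) * (starRingEnd ℂ) (τ : ℂ)) =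
      Real.pi * Complex.I * ((N⁻¹ : ℝ) : ℂ) * (τ * (w 0 : ℂ) ^ 2 -
      (starRingEnd ℂ) (τ : ℂ) * ((w 1 : ℂ) ^ 2 + (w 2 : ℂ) ^ 2 + (w 3 : ℂ) ^ 2)) by
    intro N; push_cast; ring]
  push_cast
  ring

end Coordinates

/-! ### Inversion of theta series of lattices of signature (1,3) -/

section Inversion

open MeasureTheory

/-- The factor `1 / |D|`. -/
def scale (D : ℤ) : ℝ := (((|D| : ℤ) : ℝ))⁻¹

variable {D : ℤ}

theorem scale_pos (hneg : D < 0) : 0 < scale D := by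
  have : (0 : ℝ) < ((|D| : ℤ) : ℝ) := by exact_mod_cast abs_pos.2 hneg.ne
  exact inv_pos.2 this

theorem mink_comm (w x : Fin 4 → ℝ) : mink w x = mink x w := by
  simp only [mink]; ring

/-- `ℝ⁴ → ℝ^{1,3}` for a system of four rational vectors. -/
def frame (P : H3) (b : Fin 4 → V D ℚ) : (Fin 4 → ℝ) →ₗ[ℝ] (Fin 4 → ℝ) :=
  Fintype.linearCombination ℝ fun i => coordsQ D P (b i)

theorem frame_intCast (P : H3) (b : Fin 4 → V D ℚ) (n : Fin 4 → ℤ) :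
    frame P b (fun i => (n i : ℝ)) = coordsQ D P (∑ j, n j • b j) := by
  rw [coordsQ_sum_zsmul, frame, Fintype.linearCombination_apply]

/-- The two systems of vectors are dual with respect to the form scaled by `1 / |D|`. -/
def IsDualFrame (b b' : Fin 4 → V D ℚ) : Prop :=
  ∀ i j, bil (b i) (b' j) = if i = j then ((|D| : ℤ) : ℚ) else 0

theorem IsDualFrame.symm {b b' : Fin 4 → V D ℚ} (h : IsDualFrame b b') : IsDualFrame b' b :=
  fun i j => by rw [bil_comm, h j i]; simp only [eq_comm]

variable {b b' : Fin 4 → V D ℚ}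

theorem mink_frame (hneg : D < 0) (h : IsDualFrame b b') (P : H3) (t u : Fin 4 → ℝ) :
    mink (frame P b t) (frame P b' u) = ((|D| : ℤ) : ℝ) * ∑ i, t i * u i := by
  have h1 : ∀ w x : Fin 4 → ℝ, mink w x = ∑ k, minkFlip w k * x k := fun w x => by
    rw [Fin.sum_univ_four]
    simp only [mink, minkFlip, Matrix.cons_val_zero, Matrix.cons_val_one, Matrix.cons_val]; ring
  have hl : ∀ w, ∀ (c : Fin 4 → ℝ) (x : Fin 4 → Fin 4 → ℝ),
      mink w (∑ j, c j • x j) = ∑ j, c j * mink w (x j) := fun w c x => by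
    simp_rw [h1, Finset.sum_apply, Pi.smul_apply, smul_eq_mul, Finset.mul_sum]
    rw [Finset.sum_comm]
    exact Finset.sum_congr rfl fun _ _ => Finset.sum_congr rfl fun _ _ => by ring
  rw [frame, frame, Fintype.linearCombination_apply, Fintype.linearCombination_apply, hl,
    Finset.mul_sum]
  refine Finset.sum_congr rfl fun j _ => ?_
  rw [mink_comm, hl]
  have h2 : ∀ i, mink (coordsQ D P (b' j)) (coordsQ D P (b i)) =
      if i = j then ((|D| : ℤ) : ℝ) else 0 := fun i => by
    rw [mink_coordsQ hneg, bil_comm, h i j]; split_ifs <;> simp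
  simp_rw [h2]
  simp
  ring

theorem frame_injective (hneg : D < 0) (h : IsDualFrame b b') (P : H3) :
    Function.Injective (frame P b) := by
  rw [injective_iff_map_eq_zero]
  intro t ht
  ext i
  have h1 := mink_frame hneg h P t (Pi.single i 1)
  rw [ht] at h1
  have h2 : mink 0 (frame P b' (Pi.single i 1)) = 0 := by simp [mink]
  rw [h2] at h1
  have h3 : ((|D| : ℤ) : ℝ) ≠ 0 := by exact_mod_cast (abs_pos.2 hneg.ne).ne'
  simpa [h3, hneg.ne, Pi.single_apply] using h1.symm

theorem frame_det_ne_zero (hneg : D < 0) (h : IsDualFrame b b') (P : H3) :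
    LinearMap.det (frame P b) ≠ 0 := fun h0 =>
  (LinearMap.bot_lt_ker_of_det_eq_zero h0).ne'
    (LinearMap.ker_eq_bot.2 (frame_injective hneg h P))

theorem integral_comp_linearMap {T : (Fin 4 → ℝ) →ₗ[ℝ] (Fin 4 → ℝ)} (hT : LinearMap.det T ≠ 0)
    {g : (Fin 4 → ℝ) → ℂ} (hg : Continuous g) :
    ∫ t, g (T t) = ((|LinearMap.det T|⁻¹ : ℝ) : ℂ) * ∫ w, g w := by
  have hc : Continuous T := T.continuous_of_finiteDimensional
  have h1 := integral_map (μ := volume) (φ := T) (f := g) hc.aemeasurable hg.aestronglyMeasurable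
  rw [← h1, Real.map_linearMap_volume_pi_eq_smul_volume_pi hT, integral_smul_measure,
    ENNReal.toReal_ofReal (abs_nonneg _), abs_inv, Complex.real_smul]

theorem dot_minkFlip (s : ℝ) (y w : Fin 4 → ℝ) :
    ∑ i, (-(s • minkFlip y)) i * w i = -(s * mink w y) := by
  rw [Fin.sum_univ_four]
  simp only [mink, minkFlip, Pi.neg_apply, Pi.smul_apply, smul_eq_mul, Matrix.cons_val_zero,
    Matrix.cons_val_one, Matrix.cons_val]
  ring

/-- The constant in the inversion formula. -/
def inversionConst (P : H3) (b : Fin 4 → V D ℚ) : ℝ :=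
  |LinearMap.det (frame P b)|⁻¹ * (scale D ^ 2)⁻¹

theorem fourierPi_frame (hneg : D < 0) (h : IsDualFrame b b') (P : H3) {τ : ℂ} (hτ : 0 < τ.im)
    (n : Fin 4 → ℝ) :
    fourierPi (fun t => minkGauss (scale D) τ (frame P b t)) n =
      -Complex.I * (inversionConst P b : ℝ) * ((‖τ‖ ^ 3)⁻¹ : ℝ) *
        minkGauss (scale D) (-1 / τ) (frame P b' n) := by
  have hD : ((|D| : ℤ) : ℝ) ≠ 0 := by exact_mod_cast (abs_pos.2 hneg.ne).ne'
  have h1 : ∀ t, expDot (-n) t = expDot (-(scale D • minkFlip (frame P b' n))) (frame P b t) := by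
    intro t
    rw [expDot, expDot, dot_minkFlip, mink_frame hneg h, scale, inv_mul_cancel_left₀ hD,
      ← Finset.sum_neg_distrib]
    congr 3
    exact Finset.sum_congr rfl fun i _ => by rw [Pi.neg_apply]; ring
  rw [fourierPi]
  simp_rw [h1]
  rw [integral_comp_linearMap (g := fun w => expDot (-(scale D • minkFlip (frame P b' n))) w *
    minkGauss (scale D) τ w) (frame_det_ne_zero hneg h P)
    ((continuous_expDot _).mul (continuous_minkGauss _ _))]
  have := fourierPi_minkGauss (scale_pos hneg) hτ (frame P b' n)
  rw [fourierPi] at this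
  rw [this, inversionConst]
  push_cast
  ring

theorem im_neg_one_div_pos {τ : ℂ} (hτ : 0 < τ.im) : 0 < (-1 / τ).im := by
  have h0 : τ ≠ 0 := fun h => by simp [h] at hτ
  rw [neg_div, one_div, Complex.neg_im, Complex.inv_im, neg_div, neg_neg]
  exact div_pos hτ (Complex.normSq_pos.2 h0)

theorem summable_frame (hneg : D < 0) (h : IsDualFrame b b') (P : H3) {τ : ℂ} (hτ : 0 < τ.im) :
    Summable fun n : Fin 4 → ℤ => minkGauss (scale D) τ (frame P b fun i => (n i : ℝ)) := by
  obtain ⟨C, hC⟩ := minkGauss_decay (scale_pos hneg) hτ (frame_injective hneg h P)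
  refine Summable.of_norm_bounded (summable_prodDecay.mul_left C) fun n => hC _

/-- The Poisson summation formula for a coset of the lattice spanned by `b`; the dual lattice is
spanned by `b'`. -/
theorem hasSum_inversion (hneg : D < 0) (h : IsDualFrame b b') (P : H3) {τ : ℂ} (hτ : 0 < τ.im)
    (X : V D ℚ) :
    HasSum (fun n : Fin 4 → ℤ => -Complex.I * (inversionConst P b : ℝ) * ((‖τ‖ ^ 3)⁻¹ : ℝ) *
        minkGauss (scale D) (-1 / τ) (coordsQ D P (∑ j, n j • b' j)) *
        Complex.exp (2 * Real.pi * Complex.I *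
          ((scale D * ((bil X (∑ j, n j • b' j) : ℚ) : ℝ) : ℝ) : ℂ)))
      (∑' k : Fin 4 → ℤ, minkGauss (scale D) τ (coordsQ D P (X + ∑ i, k i • b i))) := by
  obtain ⟨x, hx⟩ := LinearMap.injective_iff_surjective.1 (frame_injective hneg h P) (coordsQ D P X)
  obtain ⟨C, hC⟩ := minkGauss_decay (scale_pos hneg) hτ (frame_injective hneg h P)
  have hc : Continuous fun t => minkGauss (scale D) τ (frame P b t) :=
    (continuous_minkGauss _ _).comp (frame P b).continuous_of_finiteDimensional
  have hs : Summable fun n : Fin 4 → ℤ =>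
      fourierPi (fun t => minkGauss (scale D) τ (frame P b t)) fun i => (n i : ℝ) := by
    simp_rw [fourierPi_frame hneg h P hτ]
    exact (summable_frame hneg h.symm P (im_neg_one_div_pos hτ)).mul_left _
  have key := hasSum_poisson hc hC hs x
  convert key using 1
  · ext n
    rw [fourierPi_frame hneg h P hτ, frame_intCast, expDot]
    congr 4
    have h1 := mink_frame hneg h P x (fun i => (n i : ℝ))
    rw [hx, frame_intCast, mink_coordsQ hneg] at h1
    have hD : ((|D| : ℤ) : ℝ) ≠ 0 := by exact_mod_cast (abs_pos.2 hneg.ne).ne'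
    rw [h1, scale, inv_mul_cancel_left₀ hD]
    exact Finset.sum_congr rfl fun i _ => mul_comm _ _
  · refine tsum_congr fun k => ?_
    rw [map_add, hx, frame_intCast, coordsQ_add]

end Inversion

/-! ### Theta series attached to functions on the discriminant group -/

section ThetaLattice

variable {D : ℤ}

theorem eC_coe (x : ℝ) : eC (x : UnitAddCircle) = Complex.exp (2 * Real.pi * Complex.I * x) := by
  rw [eC, AddCircle.toCircle_apply_mk, Circle.coe_exp]
  congr 1
  push_cast
  ring

theorem eC_zero : eC 0 = 1 := by simp [eC]

/-- The bilinear form on the discriminant group. -/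
def discPair (D : ℤ) (β γ : DiscGroup D) : UnitAddCircle :=
  discQ D (β + γ) - discQ D β - discQ D γ

theorem discPair_comm (β γ : DiscGroup D) : discPair D β γ = discPair D γ β := by
  rw [discPair, discPair, add_comm β γ]; abel

/-- A lattice `Λ` in `V(ℚ)` with a map onto the discriminant group that is compatible with the
quadratic forms and whose kernel is dual to `Λ` for the form scaled by `1 / |D|`. -/
structure IsThetaLattice (D : ℤ) (Λ : AddSubgroup (V D ℚ)) (φ : Λ →+ DiscGroup D) : Prop where
  surj : Function.Surjective φ
  quad : ∀ X : Λ, discQ D (φ X) = (((Q (X : V D ℚ) / ((|D| : ℤ) : ℚ) : ℚ) : ℝ) : UnitAddCircle)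
  frame : ∃ b b' : Fin 4 → V D ℚ, IsDualFrame b b' ∧
    (∀ X, X ∈ Λ ↔ ∃ n : Fin 4 → ℤ, ∑ j, n j • b' j = X) ∧
    ∀ X, (∃ h : X ∈ Λ, φ ⟨X, h⟩ = 0) ↔ ∃ n : Fin 4 → ℤ, ∑ j, n j • b j = X

/-- The theta series of the function `χ` on the discriminant group. -/
def latticeTheta {Λ : AddSubgroup (V D ℚ)} (φ : Λ →+ DiscGroup D) (χ : DiscGroup D → ℂ) (P : H3)
    (τ : ℍ) : ℂ :=
  ((τ.im ^ (3 / 2 : ℝ) : ℝ) : ℂ) *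
    ∑' X : Λ, χ (φ X) * minkGauss (scale D) τ (coordsQ D P X)

variable {Λ : AddSubgroup (V D ℚ)} {φ : Λ →+ DiscGroup D}

theorem IsDualFrame.sum_injective (hneg : D < 0) {b b' : Fin 4 → V D ℚ} (h : IsDualFrame b b')
    {k n : Fin 4 → ℤ} (hkn : ∑ j, k j • b j = ∑ j, n j • b j) : k = n := by
  have P : H3 := ⟨0, 1, one_pos⟩
  have h1 : frame P b (fun i => (k i : ℝ)) = frame P b fun i => (n i : ℝ) := by
    rw [frame_intCast, frame_intCast, hkn]
  ext i
  exact_mod_cast congrFun (frame_injective hneg h P h1) i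

namespace IsThetaLattice

variable (H : IsThetaLattice D Λ φ)
include H

theorem eC_discPair (X Y : Λ) :
    eC (discPair D (φ X) (φ Y)) = Complex.exp (2 * Real.pi * Complex.I *
      ((scale D * ((bil (X : V D ℚ) Y : ℚ) : ℝ) : ℝ) : ℂ)) := by
  rw [discPair, ← map_add, H.quad, H.quad, H.quad, ← AddCircle.coe_sub, ← AddCircle.coe_sub, eC_coe]
  congr 3
  rw [AddSubgroup.coe_add, Q_add, scale]
  push_cast
  ring

theorem summable (hneg : D < 0) {χ : DiscGroup D → ℂ} (P : H3) {τ : ℂ} (hτ : 0 < τ.im) :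
    Summable fun X : Λ => χ (φ X) * minkGauss (scale D) τ (coordsQ D P X) := by
  have : Finite (DiscGroup D) := finite_discGroup hneg.ne
  obtain ⟨b, b', hb, hΛ, -⟩ := H.frame
  obtain ⟨C, hC⟩ : ∃ C, ∀ δ, ‖χ δ‖ ≤ C :=
    ⟨(Set.finite_range fun δ => ‖χ δ‖).bddAbove.choose, fun δ =>
      (Set.finite_range fun δ => ‖χ δ‖).bddAbove.choose_spec ⟨δ, rfl⟩⟩
  let e : (Fin 4 → ℤ) ≃ Λ := Equiv.ofBijective
    (fun n => ⟨∑ j, n j • b' j, (hΛ _).2 ⟨n, rfl⟩⟩)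
    ⟨fun k n hkn => hb.symm.sum_injective hneg (Subtype.ext_iff.1 hkn),
      fun X => by obtain ⟨n, hn⟩ := (hΛ _).1 X.2; exact ⟨n, Subtype.ext hn⟩⟩
  rw [← e.summable_iff]
  have h1 := (summable_frame hneg hb.symm P hτ).norm.mul_left C
  refine Summable.of_norm_bounded h1 fun n => ?_
  rw [Function.comp_apply, norm_mul, frame_intCast]
  exact mul_le_mul_of_nonneg_right (hC _) (norm_nonneg _)

/-- Inversion of the theta series of an eigenfunction of the finite Fourier transform. -/
theorem exists_inversion (hneg : D < 0) {χ : DiscGroup D → ℂ} {κ : ℂ}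
    (hχ : ∀ β, ∑ᶠ δ, χ δ * eC (discPair D δ β) = κ * χ β) (P : H3) :
    ∃ r : ℝ, 0 < r ∧ ∀ τ : ℍ, latticeTheta φ χ P τ =
      -Complex.I * r * κ * latticeTheta φ χ P (ModularGroup.S • τ) := by
  have : Finite (DiscGroup D) := finite_discGroup hneg.ne
  let _ := Fintype.ofFinite (DiscGroup D)
  obtain ⟨b, b', hb, hΛ, hM⟩ := H.frame
  have hr : 0 < inversionConst P b :=
    mul_pos (inv_pos.2 (abs_pos.2 (frame_det_ne_zero hneg hb P)))
      (inv_pos.2 (pow_pos (scale_pos hneg) 2))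
  refine ⟨inversionConst P b, hr, fun τ => ?_⟩
  have hτ : 0 < (τ : ℂ).im := τ.im_pos
  have hS : ((ModularGroup.S • τ : ℍ) : ℂ) = -1 / τ := by
    rw [UpperHalfPlane.modular_S_smul]
    change (-(τ : ℂ))⁻¹ = _
    rw [neg_div, one_div, inv_neg]
  -- parametrizations of the lattice by cosets of the kernel and by the dual frame
  choose σ hσ using H.surj
  choose hMΛ hMφ using fun n : Fin 4 → ℤ => (hM (∑ j, n j • b j)).2 ⟨n, rfl⟩
  let e₀ : DiscGroup D × (Fin 4 → ℤ) → Λ := fun x => σ x.1 + ⟨∑ j, x.2 j • b j, hMΛ x.2⟩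
  have he : ∀ x, φ (e₀ x) = x.1 := fun x => by rw [map_add, hMφ, hσ, add_zero]
  let e : DiscGroup D × (Fin 4 → ℤ) ≃ Λ := Equiv.ofBijective e₀ ⟨by
      rintro ⟨δ, k⟩ ⟨δ', k'⟩ h
      have h1 : δ = δ' := by have := congrArg φ h; rwa [he, he] at this
      subst h1
      have h2 : k = k' := hb.sum_injective hneg (Subtype.ext_iff.1 (add_left_cancel h))
      rw [h2], fun X => by
      obtain ⟨n, hn⟩ := (hM (X - σ (φ X) : Λ)).1 ⟨Subtype.mem _, by
        rw [Subtype.coe_eta, map_sub, hσ, sub_self]⟩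
      refine ⟨(φ X, n), Subtype.ext ?_⟩
      change (σ (φ X) : V D ℚ) + ∑ j, n j • b j = X
      rw [hn, AddSubgroup.coe_sub]; abel⟩
  let e' : (Fin 4 → ℤ) ≃ Λ := Equiv.ofBijective
    (fun n => ⟨∑ j, n j • b' j, (hΛ _).2 ⟨n, rfl⟩⟩)
    ⟨fun k n hkn => hb.symm.sum_injective hneg (Subtype.ext_iff.1 hkn),
      fun X => by obtain ⟨n, hn⟩ := (hΛ _).1 X.2; exact ⟨n, Subtype.ext hn⟩⟩
  have h1 : ∑' X : Λ, χ (φ X) * minkGauss (scale D) τ (coordsQ D P X) =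
      ∑ δ, χ δ * ∑' k : Fin 4 → ℤ,
        minkGauss (scale D) τ (coordsQ D P ((σ δ : V D ℚ) + ∑ i, k i • b i)) := by
    have hs := H.summable hneg (χ := χ) P hτ
    rw [← e.summable_iff] at hs
    rw [← e.tsum_eq]
    refine (Summable.tsum_prod hs).trans ?_
    rw [tsum_fintype]
    refine Finset.sum_congr rfl fun δ _ => ?_
    rw [← tsum_mul_left]
    refine tsum_congr fun k => ?_
    rw [Function.comp_apply, show φ (e (δ, k)) = δ from he (δ, k)]
    rfl
  have h2 := hasSum_sum (s := Finset.univ) fun (δ : DiscGroup D) _ =>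
    (hasSum_inversion hneg hb P hτ (σ δ : V D ℚ)).mul_left (χ δ)
  rw [← h1] at h2
  have h3 : ∀ n : Fin 4 → ℤ, ∑ δ : DiscGroup D, χ δ *
      (-Complex.I * (inversionConst P b : ℝ) * ((‖(τ : ℂ)‖ ^ 3)⁻¹ : ℝ) *
        minkGauss (scale D) (-1 / τ) (coordsQ D P (∑ j, n j • b' j)) *
        Complex.exp (2 * Real.pi * Complex.I *
          ((scale D * ((bil (σ δ : V D ℚ) (∑ j, n j • b' j) : ℚ) : ℝ) : ℝ) : ℂ))) =
      -Complex.I * (inversionConst P b : ℝ) * κ * ((‖(τ : ℂ)‖ ^ 3)⁻¹ : ℝ) *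
        (χ (φ (e' n)) * minkGauss (scale D) (-1 / τ) (coordsQ D P (e' n))) := by
    intro n
    have h4 := hχ (φ (e' n))
    rw [finsum_eq_sum_of_fintype] at h4
    have h5 : ∀ δ, Complex.exp (2 * Real.pi * Complex.I *
          ((scale D * ((bil (σ δ : V D ℚ) (∑ j, n j • b' j) : ℚ) : ℝ) : ℝ) : ℂ)) =
        eC (discPair D δ (φ (e' n))) := fun δ => by
      rw [← hσ δ, H.eC_discPair, hσ]; rfl
    simp_rw [h5]
    rw [show ∀ A B C E : ℂ, A * κ * B * (C * E) = A * B * E * (κ * C) by intros; ring, ← h4,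
      Finset.mul_sum]
    refine Finset.sum_congr rfl fun δ _ => ?_
    rw [show ((e' n : Λ) : V D ℚ) = ∑ j, n j • b' j from rfl]
    ring
  simp_rw [h3] at h2
  rw [latticeTheta, latticeTheta, ← h2.tsum_eq, tsum_mul_left,
    e'.tsum_eq (fun X : Λ => χ (φ X) * minkGauss (scale D) (-1 / τ) (coordsQ D P X)), hS]
  have him : (ModularGroup.S • τ : ℍ).im ^ (3 / 2 : ℝ) =
      τ.im ^ (3 / 2 : ℝ) * (‖(τ : ℂ)‖ ^ 3)⁻¹ := by
    have h6 : (ModularGroup.S • τ : ℍ).im = τ.im / ‖(τ : ℂ)‖ ^ 2 := by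
      rw [← UpperHalfPlane.coe_im, hS, neg_div, one_div, Complex.neg_im, Complex.inv_im, neg_div,
        neg_neg, Complex.normSq_eq_norm_sq]
      rfl
    have h7 : (‖(τ : ℂ)‖ ^ 2) ^ (3 / 2 : ℝ) = ‖(τ : ℂ)‖ ^ 3 := by
      rw [← Real.rpow_natCast, ← Real.rpow_natCast, ← Real.rpow_mul (norm_nonneg _)]
      norm_num
    rw [h6, Real.div_rpow τ.im_pos.le (by positivity), h7, div_eq_mul_inv]
  rw [him]
  push_cast
  ring

theorem latticeTheta_T {χ : DiscGroup D → ℂ} (hneg : D < 0)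
    (hχ : ∀ δ, χ δ ≠ 0 → discQ D δ = 0) (P : H3) (τ : ℍ) :
    latticeTheta φ χ P (ModularGroup.T • τ) = latticeTheta φ χ P τ := by
  have hT : ((ModularGroup.T • τ : ℍ) : ℂ) = τ + 1 := by
    rw [UpperHalfPlane.modular_T_smul, UpperHalfPlane.coe_vadd, add_comm]; simp
  have him : (ModularGroup.T • τ : ℍ).im = τ.im := by
    rw [← UpperHalfPlane.coe_im, hT]; simp
  rw [latticeTheta, latticeTheta, him, hT]
  congr 1
  refine tsum_congr fun X => ?_
  by_cases h0 : χ (φ X) = 0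
  · rw [h0, zero_mul, zero_mul]
  congr 1
  have h1 := congrArg eC (hχ _ h0)
  rw [H.quad, eC_zero, eC_coe] at h1
  have h2 := mink_coordsQ hneg P (X : V D ℚ) X
  rw [bil_self] at h2
  set w := coordsQ D P (X : V D ℚ) with hw
  rw [minkGauss, minkGauss]
  congr 1
  have h3 : (Real.pi : ℂ) * Complex.I * scale D * (((τ : ℂ) + 1) * (w 0 : ℂ) ^ 2 -
      (starRingEnd ℂ) ((τ : ℂ) + 1) * ((w 1 : ℂ) ^ 2 + (w 2 : ℂ) ^ 2 + (w 3 : ℂ) ^ 2)) =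
      Real.pi * Complex.I * scale D * ((τ : ℂ) * (w 0 : ℂ) ^ 2 -
      (starRingEnd ℂ) (τ : ℂ) * ((w 1 : ℂ) ^ 2 + (w 2 : ℂ) ^ 2 + (w 3 : ℂ) ^ 2)) +
      2 * Real.pi * Complex.I *
        (((Q (X : V D ℚ) / ((|D| : ℤ) : ℚ) : ℚ) : ℝ) : ℂ) := by
    have h4 : ((2 * (Q (X : V D ℚ)) : ℚ) : ℂ) = (w 0 : ℂ) ^ 2 - (w 1 : ℂ) ^ 2 - (w 2 : ℂ) ^ 2 -
        (w 3 : ℂ) ^ 2 := by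
      have := congrArg (Complex.ofReal) h2
      rw [mink] at this
      push_cast at this ⊢
      rw [← this]; ring
    push_cast at h4
    have h5 : (((Q (X : V D ℚ) / ((|D| : ℤ) : ℚ) : ℚ) : ℝ) : ℂ) =
        scale D * ((Q (X : V D ℚ) : ℚ) : ℂ) := by
      rw [scale, div_eq_inv_mul]; push_cast; rfl
    rw [map_add, map_one, h5]
    linear_combination (-(Real.pi : ℂ) * Complex.I * scale D) * h4
  rw [h3, Complex.exp_add, h1, mul_one]

end IsThetaLattice

end ThetaLattice

/-! ### Invariance under the modular group -/

section Modular

variable {F : ℍ → ℂ} {C : ℂ}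

/-- The relations `S² = -1` and `(ST)³ = -1` leave only the trivial automorphy factor. -/
theorem inversion_const_eq_one (hT : ∀ τ : ℍ, F (ModularGroup.T • τ) = F τ)
    (hS : ∀ τ : ℍ, F τ = C * F (ModularGroup.S • τ)) {τ : ℍ} (hF : F τ ≠ 0) : C = 1 := by
  have h2 : ModularGroup.S • ModularGroup.S • τ = τ := by
    rw [← mul_smul, show ModularGroup.S * ModularGroup.S = -1 by decide,
      ModularGroup.SL_neg_smul, one_smul]
  have h3 : ModularGroup.S • ModularGroup.T • ModularGroup.S • ModularGroup.T •
      ModularGroup.S • ModularGroup.T • τ = τ := by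
    simp only [← mul_smul]
    rw [show ModularGroup.S * (ModularGroup.T * (ModularGroup.S * (ModularGroup.T *
      (ModularGroup.S * ModularGroup.T)))) = -1 by decide,
      ModularGroup.SL_neg_smul, one_smul]
  have e2 : F τ = C ^ 2 * F τ := by
    conv_lhs => rw [hS τ, hS (ModularGroup.S • τ), h2]
    ring
  have e3 : F τ = C ^ 3 * F τ := by
    conv_lhs => rw [← hT τ, hS (ModularGroup.T • τ), ← hT, hS (ModularGroup.T • _), ← hT,
      hS (ModularGroup.T • _), h3]
    ring
  have f2 : C ^ 2 = 1 := mul_right_cancel₀ hF (by rw [← e2, one_mul])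
  have f3 : C ^ 3 = 1 := mul_right_cancel₀ hF (by rw [← e3, one_mul])
  calc C = C * C ^ 2 := by rw [f2, mul_one]
    _ = C ^ 3 := by ring
    _ = 1 := f3

/-- Invariance under `T` and inversion under `S` up to an unspecified constant already give weight
`0` for the full modular group. -/
theorem slash_eq_of_inversion (hT : ∀ τ : ℍ, F (ModularGroup.T • τ) = F τ)
    (hS : ∀ τ : ℍ, F τ = C * F (ModularGroup.S • τ)) (γ : SL(2, ℤ)) :
    F ∣[(0 : ℤ)] γ = F := by
  have hS' : ∀ τ : ℍ, F (ModularGroup.S • τ) = F τ := by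
    by_cases h : ∃ τ, F τ ≠ 0
    · obtain ⟨τ, hτ⟩ := h
      have := inversion_const_eq_one hT hS hτ
      intro τ; rw [hS τ, this, one_mul]
    · push Not at h
      intro τ; rw [h, h]
  have key : ∀ γ : SL(2, ℤ), γ ∈ Subgroup.closure {ModularGroup.S, ModularGroup.T} →
      ∀ τ : ℍ, F (γ • τ) = F τ := by
    intro γ hγ
    induction hγ using Subgroup.closure_induction with
    | mem x hx =>
      rcases hx with rfl | rfl
      · exact hS'
      · exact hT
    | one => intro τ; rw [one_smul]
    | mul x y _ _ hx hy => intro τ; rw [mul_smul, hx, hy]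
    | inv x _ hx => intro τ; rw [← hx (x⁻¹ • τ), smul_inv_smul]
  have hgen : γ ∈ Subgroup.closure {ModularGroup.S, ModularGroup.T} := by
    rw [SpecialLinearGroup.SL2Z_generators]; trivial
  ext τ
  rw [ModularForm.SL_slash_apply, key γ hgen]
  simp

end Modular

/-! ### Coordinates on the lattice and its dual -/

section LatticeCoordinates

/-- The element `(a, m + n ω; *, c)` of the lattice. -/
def latVec (D : ℤ) (R F : Type) [CommRing R] [Field F] [Algebra R F] :
    (R × R × R × R) →ₗ[R] V D F where
  toFun x := (algebraMap R F x.1, ⟨algebraMap R F x.2.1 + algebraMap R F x.2.2.1 * (D / 2),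
    algebraMap R F x.2.2.1 / 2⟩, algebraMap R F x.2.2.2)
  map_add' x y := by
    ext <;> simp <;> ring
  map_smul' r x := by
    ext <;> simp [Algebra.smul_def (A := F)] <;> ring

/-- The element `(a, (m + n ω) / √D; *, c)` of the dual lattice. -/
def dualVec (D : ℤ) (R F : Type) [CommRing R] [Field F] [Algebra R F] :
    (R × R × R × R) →ₗ[R] V D F where
  toFun x := (algebraMap R F x.1, ⟨algebraMap R F x.2.2.1 / 2,
    (algebraMap R F x.2.1 + algebraMap R F x.2.2.1 * (D / 2)) / D⟩, algebraMap R F x.2.2.2)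
  map_add' x y := by
    ext <;> simp <;> ring
  map_smul' r x := by
    ext <;> simp [Algebra.smul_def (A := F)] <;> ring

variable {D : ℤ} {R F : Type} [CommRing R] [Field F] [Algebra R F]

theorem latVec_apply (x : R × R × R × R) : latVec D R F x =
    (algebraMap R F x.1, ⟨algebraMap R F x.2.1 + algebraMap R F x.2.2.1 * (D / 2),
    algebraMap R F x.2.2.1 / 2⟩, algebraMap R F x.2.2.2) := rfl

theorem dualVec_apply (x : R × R × R × R) : dualVec D R F x =
    (algebraMap R F x.1, ⟨algebraMap R F x.2.2.1 / 2,
    (algebraMap R F x.2.1 + algebraMap R F x.2.2.1 * (D / 2)) / D⟩, algebraMap R F x.2.2.2) := rfl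

theorem mem_lattice_iff {X : V D F} : X ∈ lattice D R F ↔ ∃ x, latVec D R F x = X := by
  constructor
  · rintro ⟨h1, h2, h3⟩
    obtain ⟨a, ha⟩ := Submodule.mem_one.1 h1
    obtain ⟨c, hc⟩ := Submodule.mem_one.1 h3
    obtain ⟨m, n, hb⟩ := Submodule.mem_span_pair.1 h2
    refine ⟨(a, m, n, c), ?_⟩
    refine Prod.ext ha (Prod.ext ?_ hc)
    rw [← hb]
    ext <;> simp [latVec_apply, omegaD, show QuadraticAlgebra.re (1 : QuadExt D F) = 1 from rfl,
      show QuadraticAlgebra.im (1 : QuadExt D F) = 0 from rfl, Algebra.smul_def (A := F), div_eq_mul_inv]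
  · rintro ⟨x, rfl⟩
    refine ⟨Submodule.mem_one.2 ⟨_, rfl⟩, Submodule.mem_span_pair.2 ⟨x.2.1, x.2.2.1, ?_⟩,
      Submodule.mem_one.2 ⟨_, rfl⟩⟩
    ext <;> simp [latVec_apply, omegaD, show QuadraticAlgebra.re (1 : QuadExt D F) = 1 from rfl,
      show QuadraticAlgebra.im (1 : QuadExt D F) = 0 from rfl, Algebra.smul_def (A := F), div_eq_mul_inv]

theorem mem_dualLattice_iff (hD : (D : F) ≠ 0) {X : V D F} :
    X ∈ dualLattice D R F ↔ ∃ x, dualVec D R F x = X := by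
  constructor
  · rintro ⟨h1, h2, h3⟩
    obtain ⟨a, ha⟩ := Submodule.mem_one.1 h1
    obtain ⟨c, hc⟩ := Submodule.mem_one.1 h3
    obtain ⟨w, hw, hb⟩ := Submodule.mem_map.1 h2
    obtain ⟨m, n, rfl⟩ := Submodule.mem_span_pair.1 hw
    refine ⟨(a, m, n, c), ?_⟩
    refine Prod.ext ha (Prod.ext ?_ hc)
    rw [← hb]
    ext <;> simp [dualVec_apply, omegaD, show QuadraticAlgebra.re (1 : QuadExt D F) = 1 from rfl,
      show QuadraticAlgebra.im (1 : QuadExt D F) = 0 from rfl, sqrtD, Algebra.smul_def (A := F)] <;> field_simp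
  · rintro ⟨x, rfl⟩
    refine ⟨Submodule.mem_one.2 ⟨_, rfl⟩, Submodule.mem_map.2 ⟨_, Submodule.mem_span_pair.2
      ⟨x.2.1, x.2.2.1, rfl⟩, ?_⟩, Submodule.mem_one.2 ⟨_, rfl⟩⟩
    ext <;> simp [dualVec_apply, omegaD, show QuadraticAlgebra.re (1 : QuadExt D F) = 1 from rfl,
      show QuadraticAlgebra.im (1 : QuadExt D F) = 0 from rfl, sqrtD, Algebra.smul_def (A := F)] <;> field_simp

variable [CharZero F]

theorem latVec_injective (hR : Function.Injective (algebraMap R F)) :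
    Function.Injective (latVec D R F) := by
  rintro ⟨a, m, n, c⟩ ⟨a', m', n', c'⟩ h
  have h1 : algebraMap R F a = algebraMap R F a' := congrArg (fun X : V D F => X.1) h
  have h2 : algebraMap R F n / 2 = algebraMap R F n' / 2 :=
    congrArg (fun X : V D F => X.2.1.im) h
  have h3 : algebraMap R F m + algebraMap R F n * (D / 2) =
    algebraMap R F m' + algebraMap R F n' * (D / 2) := congrArg (fun X : V D F => X.2.1.re) h
  have h4 : algebraMap R F c = algebraMap R F c' := congrArg (fun X : V D F => X.2.2) h
  have h5 : algebraMap R F n = algebraMap R F n' := (div_left_inj' two_ne_zero).1 h2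
  rw [h5, add_left_inj] at h3
  rw [hR h1, hR h3, hR h4, hR h5]

theorem dualVec_injective (hD : (D : F) ≠ 0) (hR : Function.Injective (algebraMap R F)) :
    Function.Injective (dualVec D R F) := by
  rintro ⟨a, m, n, c⟩ ⟨a', m', n', c'⟩ h
  have h1 : algebraMap R F a = algebraMap R F a' := congrArg (fun X : V D F => X.1) h
  have h2 : algebraMap R F n / 2 = algebraMap R F n' / 2 :=
    congrArg (fun X : V D F => X.2.1.re) h
  have h3 : (algebraMap R F m + algebraMap R F n * (D / 2)) / D =
    (algebraMap R F m' + algebraMap R F n' * (D / 2)) / D :=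
      congrArg (fun X : V D F => X.2.1.im) h
  have h4 : algebraMap R F c = algebraMap R F c' := congrArg (fun X : V D F => X.2.2) h
  have h5 : algebraMap R F n = algebraMap R F n' := (div_left_inj' two_ne_zero).1 h2
  rw [h5, div_left_inj' hD, add_left_inj] at h3
  rw [hR h1, hR h3, hR h4, hR h5]

theorem bil_latVec_dualVec (hD : (D : F) ≠ 0) (x y : R × R × R × R) :
    bil (latVec D R F x) (dualVec D R F y) = algebraMap R F
      (x.1 * y.2.2.2 + y.1 * x.2.2.2 - x.2.1 * y.2.2.1 + x.2.2.1 * y.2.1) := by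
  rw [bil_def, latVec_apply, dualVec_apply]
  simp only [map_add, map_sub, map_mul]
  field_simp
  ring

variable (ht : 4 * normOmega D = D * D - D)
include ht

theorem cast_normOmega : ((normOmega D : ℤ) : F) = (D * D - D) / 4 := by
  have : (4 : F) * (normOmega D : ℤ) = D * D - D := by exact_mod_cast ht
  rw [← this]; field_simp

theorem bil_latVec (x y : R × R × R × R) :
    bil (latVec D R F x) (latVec D R F y) = algebraMap R F
      (genusBil ((normOmega D : ℤ) : R) x y - D * (x.2.1 * y.2.2.1 + x.2.2.1 * y.2.1)) := by
  rw [bil_def, latVec_apply, latVec_apply]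
  simp only [genusBil, map_add, map_sub, map_mul, map_intCast, map_ofNat, cast_normOmega ht]
  field_simp
  ring

theorem Q_latVec (x : R × R × R × R) :
    Q (latVec D R F x) = algebraMap R F
      (genusForm ((normOmega D : ℤ) : R) x - D * (x.2.1 * x.2.2.1)) := by
  rw [Q_def, latVec_apply]
  simp only [genusForm, map_add, map_sub, map_mul, map_pow, map_intCast, cast_normOmega ht]
  field_simp
  ring

theorem Q_dualVec (hD : (D : F) ≠ 0) (x : R × R × R × R) :
    D * Q (dualVec D R F x) = algebraMap R F
      (D * (x.1 * x.2.2.2 + x.2.1 * x.2.2.1) + x.2.1 ^ 2 + (normOmega D : ℤ) * x.2.2.1 ^ 2) := by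
  rw [Q_def, dualVec_apply]
  simp only [map_add, map_mul, map_pow, map_intCast, cast_normOmega ht]
  field_simp
  ring

theorem latVec_eq_dualVec (hD : (D : F) ≠ 0) (x : R × R × R × R) :
    latVec D R F x = dualVec D R F (x.1, -D * x.2.1 - 2 * (normOmega D : ℤ) * x.2.2.1,
      2 * x.2.1 + D * x.2.2.1, x.2.2.2) := by
  rw [latVec_apply, dualVec_apply]
  ext <;> simp [cast_normOmega ht, map_ofNat (algebraMap R F)] <;> field_simp
  ring

theorem lattice_le_dualLattice (hD : (D : F) ≠ 0) : lattice D R F ≤ dualLattice D R F := by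
  intro X hX
  obtain ⟨x, rfl⟩ := mem_lattice_iff.1 hX
  exact (mem_dualLattice_iff hD).2 ⟨_, (latVec_eq_dualVec ht hD x).symm⟩

omit ht in
theorem dualVec_mem_lattice (hD : (D : F) ≠ 0) {x : R × R × R × R} (h1 : (D : R) ∣ 2 * x.2.1)
    (h2 : (2 : R) ∣ x.2.2.1 * (1 - D)) : dualVec D R F x ∈ lattice D R F := by
  obtain ⟨u, hu⟩ := h1
  obtain ⟨v, hv⟩ := h2
  refine mem_lattice_iff.2 ⟨(x.1, v - x.2.1, x.2.2.1 + u, x.2.2.2), ?_⟩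
  have hu' : (2 : F) * algebraMap R F x.2.1 = D * algebraMap R F u := by
    simpa [map_ofNat (algebraMap R F)] using congrArg (algebraMap R F) hu
  have hv' : algebraMap R F x.2.2.1 * (1 - D) = 2 * algebraMap R F v := by
    simpa [map_ofNat (algebraMap R F)] using congrArg (algebraMap R F) hv
  have h2 : (2 : F) ≠ 0 := two_ne_zero
  rw [latVec_apply, dualVec_apply]
  ext
  · rfl
  · simp
    field_simp
    linear_combination -hv' - hu'
  · simp
    field_simp
    linear_combination -hu'
  · rfl

end LatticeCoordinates

namespace IsFundamentalDiscriminant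

variable {D : ℤ} (hD : IsFundamentalDiscriminant D)
include hD

theorem cast_ne_zero (F : Type) [Field F] [CharZero F] : (D : F) ≠ 0 :=
  Int.cast_ne_zero.2 hD.ne_zero

/-- Vectors of the dual lattice whose norm is divisible by `D` lie in the lattice. -/
theorem dvd_of_dvd_norm {m n : ℤ} (h : D ∣ m ^ 2 + normOmega D * n ^ 2) :
    D ∣ 2 * m ∧ 2 ∣ n * (1 - D) := by
  have ht := hD.four_mul_normOmega
  rcases hD with ⟨-, ⟨h1, hs⟩ | ⟨k, hk, h1, hs⟩⟩
  · obtain ⟨r, hr⟩ : ∃ r, D = 4 * r + 1 := ⟨D / 4, by omega⟩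
    have h2 : normOmega D = D * r := by
      have : 4 * normOmega D = 4 * (D * r) := by rw [ht]; nth_rw 2 [hr]; rw [hr]; ring
      linarith
    have h3 : D ∣ m ^ 2 := (dvd_add_left ⟨r * n ^ 2, by rw [h2]; ring⟩).1 h
    exact ⟨((hs.dvd_pow_iff_dvd two_ne_zero).1 h3).mul_left 2, Dvd.dvd.mul_left (by omega) _⟩
  · have h2 : normOmega D = k * (4 * k - 1) := by
      have : 4 * normOmega D = 4 * (k * (4 * k - 1)) := by rw [ht, hk]; ring
      linarith
    have h3 : k ∣ m ^ 2 := by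
      refine (dvd_add_left ⟨(4 * k - 1) * n ^ 2, ?_⟩).1 ((Dvd.intro_left 4 hk.symm).trans h)
      rw [h2]; ring
    obtain ⟨j, hj⟩ := (hs.dvd_pow_iff_dvd two_ne_zero).1 h3
    have hk0 : k ≠ 0 := by rintro rfl; omega
    have h4 : 4 ∣ k * j ^ 2 + (4 * k - 1) * n ^ 2 := by
      refine (mul_dvd_mul_iff_left hk0).1 ?_
      rw [mul_comm k 4]
      have e : m ^ 2 + normOmega D * n ^ 2 = k * (k * j ^ 2 + (4 * k - 1) * n ^ 2) := by
        rw [h2, hj]; ring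
      rwa [e, hk] at h
    have h5 : (k * j ^ 2 - n ^ 2) % 4 = 0 := by
      have : k * j ^ 2 + (4 * k - 1) * n ^ 2 = k * j ^ 2 - n ^ 2 + 4 * (k * n ^ 2) := by ring
      omega
    have h6 : j % 2 = 0 ∧ n % 2 = 0 := by
      have hj4 : j ^ 2 % 4 = 0 ∧ j % 2 = 0 ∨ j ^ 2 % 4 = 1 ∧ j % 2 = 1 := by
        rcases Int.emod_two_eq_zero_or_one j with h | h
        · obtain ⟨i, rfl⟩ : ∃ i, j = 2 * i := ⟨j / 2, by omega⟩
          left; exact ⟨by rw [mul_pow]; omega, h⟩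
        · exact Or.inr ⟨Int.sq_mod_four_eq_one_of_odd (Int.odd_iff.2 h), h⟩
      have hn4 : n ^ 2 % 4 = 0 ∧ n % 2 = 0 ∨ n ^ 2 % 4 = 1 ∧ n % 2 = 1 := by
        rcases Int.emod_two_eq_zero_or_one n with h | h
        · obtain ⟨i, rfl⟩ : ∃ i, n = 2 * i := ⟨n / 2, by omega⟩
          left; exact ⟨by rw [mul_pow]; omega, h⟩
        · exact Or.inr ⟨Int.sq_mod_four_eq_one_of_odd (Int.odd_iff.2 h), h⟩
      have h7 := Int.mul_emod k (j ^ 2) 4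
      rcases hj4 with ⟨e1, e2⟩ | ⟨e1, e2⟩ <;> rcases hn4 with ⟨e3, e4⟩ | ⟨e3, e4⟩ <;>
        rcases h1 with e5 | e5 <;> rw [e1, e5] at h7 <;> omega
    constructor
    · obtain ⟨i, hi⟩ : ∃ i, j = 2 * i := ⟨j / 2, by omega⟩
      exact ⟨i, by rw [hj, hi, hk]; ring⟩
    · exact Dvd.dvd.mul_right (by omega) _

theorem mem_lattice_of_mem_dualLattice {X : V D ℚ} (hX : X ∈ dualLattice D ℤ ℚ) {k : ℤ}
    (hQ : Q X = D * k) : X ∈ lattice D ℤ ℚ := by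
  have hD0 := hD.cast_ne_zero ℚ
  obtain ⟨x, rfl⟩ := (mem_dualLattice_iff hD0).1 hX
  have h1 := Q_dualVec (R := ℤ) hD.four_mul_normOmega hD0 x
  rw [hQ] at h1
  have h2 : D * (D * k) = D * (x.1 * x.2.2.2 + x.2.1 * x.2.2.1) + x.2.1 ^ 2 +
      normOmega D * x.2.2.1 ^ 2 := by
    simp only [eq_intCast, Int.cast_id] at h1
    exact_mod_cast h1
  obtain ⟨h3, h4⟩ := hD.dvd_of_dvd_norm (m := x.2.1) (n := x.2.2.1)
    ⟨D * k - (x.1 * x.2.2.2 + x.2.1 * x.2.2.1), by linear_combination -h2⟩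
  exact dualVec_mem_lattice hD0 (by simpa using h3) (by simpa using h4)

end IsFundamentalDiscriminant

/-! ### Prime discriminants and the Kronecker symbol -/

theorem oddPrimeDisc_natAbs {p : ℕ} (hp : p % 2 = 1) : (oddPrimeDisc p).natAbs = p := by
  rw [oddPrimeDisc, ZMod.χ₄_nat_eq_if_mod_four]
  split_ifs <;> omega

theorem oddPrimeDisc_emod_four {p : ℕ} (hp : p % 2 = 1) : oddPrimeDisc p % 4 = 1 := by
  rw [oddPrimeDisc, ZMod.χ₄_nat_eq_if_mod_four]
  split_ifs <;> omega

theorem prod_oddPrimeDisc_emod_four {s : Finset ℕ} (hs : ∀ p ∈ s, p % 2 = 1) :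
    (∏ p ∈ s, oddPrimeDisc p) % 4 = 1 := by
  refine Finset.prod_induction _ (fun x : ℤ => x % 4 = 1) (fun a b ha hb => ?_) rfl fun p hp =>
    oddPrimeDisc_emod_four (hs p hp)
  rw [Int.mul_emod, ha, hb]; rfl

/-- Quadratic reciprocity for prime discriminants. -/
theorem kronecker_oddPrimeDisc {p : ℕ} [hp : Fact p.Prime] (h2 : p ≠ 2) {a : ℤ} (ha : a ≠ 0) :
    kronecker (oddPrimeDisc p) a = legendreSym p a := by
  have hodd : p % 2 = 1 := hp.1.eq_two_or_odd.resolve_left h2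
  set v := padicValNat 2 a.natAbs
  set u := a.natAbs / 2 ^ v with hu
  have hu0 : a.natAbs = 2 ^ v * u := (Nat.mul_div_cancel' pow_padicValNat_dvd).symm
  have huodd : Odd u := by
    rw [← Nat.not_even_iff_odd, even_iff_two_dvd]
    rintro ⟨k, hk⟩
    refine pow_succ_padicValNat_not_dvd (p := 2) (Int.natAbs_ne_zero.2 ha) ⟨k, ?_⟩
    rw [pow_succ, mul_assoc, ← hk]; exact hu0
  have h8 : ZMod.χ₈ ((oddPrimeDisc p : ℤ) : ZMod 8) = legendreSym p 2 := by
    rw [legendreSym.at_two h2, oddPrimeDisc, ZMod.χ₄_nat_eq_if_mod_four]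
    split_ifs
    · omega
    · simp
    · push_cast
      rw [neg_one_mul, ← neg_one_mul, map_mul]
      simp [show ZMod.χ₈ (-1) = 1 by decide]
  have hJ : jacobiSym (oddPrimeDisc p) u = legendreSym p (u : ℤ) := by
    rw [jacobiSym.legendreSym.to_jacobiSym, jacobiSym.quadratic_reciprocity' huodd (Nat.odd_iff.2 hodd),
      qrSign, ← jacobiSym.mul_left]
    rfl
  have hsign : (if a < 0 ∧ oddPrimeDisc p < 0 then -1 else 1 : ℤ) = legendreSym p (a.sign) := by
    rcases lt_or_gt_of_ne ha with h | h
    · rw [Int.sign_eq_neg_one_of_neg h, legendreSym.at_neg_one h2, oddPrimeDisc,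
        ZMod.χ₄_nat_eq_if_mod_four]
      have := hp.1.pos
      split_ifs <;> omega
    · rw [Int.sign_eq_one_of_pos h, legendreSym.at_one, if_neg (by omega)]
  rw [kronecker, if_neg ha, h8, hJ, hsign]
  simp only [jacobiSym.legendreSym.to_jacobiSym]
  rw [← jacobiSym.pow_left, ← jacobiSym.mul_left, ← jacobiSym.mul_left]
  congr 1
  conv_rhs => rw [← Int.sign_mul_natAbs a, hu0]
  push_cast
  rw [mul_assoc]

theorem kronecker_of_odd {n a : ℤ} (ha : a % 2 = 1) :
    kronecker n a = (if a < 0 ∧ n < 0 then -1 else 1) * jacobiSym n a.natAbs := by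
  have h0 : padicValNat 2 a.natAbs = 0 := padicValNat.eq_zero_of_not_dvd (by omega)
  rw [kronecker, if_neg (by omega), h0]
  simp

theorem kronecker_neg_four {a : ℤ} (ha : a % 2 = 1) : kronecker (-4) a = ZMod.χ₄ a := by
  have hu : Odd a.natAbs := Nat.odd_iff.2 (by omega)
  rw [kronecker_of_odd ha, show (-4 : ℤ) = -1 * 4 by norm_num, jacobiSym.mul_left,
    jacobiSym.at_four hu, jacobiSym.at_neg_one hu, ZMod.χ₄_nat_eq_if_mod_four,
    ZMod.χ₄_int_eq_if_mod_four]
  split_ifs <;> omega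

theorem kronecker_eight {a : ℤ} (ha : a % 2 = 1) : kronecker 8 a = ZMod.χ₈ a := by
  have hu : Odd a.natAbs := Nat.odd_iff.2 (by omega)
  rw [kronecker_of_odd ha, show (8 : ℤ) = 2 * 4 by norm_num, jacobiSym.mul_left,
    jacobiSym.at_four hu, jacobiSym.at_two hu, ZMod.χ₈_nat_eq_if_mod_eight,
    ZMod.χ₈_int_eq_if_mod_eight]
  split_ifs <;> omega

theorem kronecker_neg_eight {a : ℤ} (ha : a % 2 = 1) : kronecker (-8) a = ZMod.χ₈' a := by
  have hu : Odd a.natAbs := Nat.odd_iff.2 (by omega)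
  rw [kronecker_of_odd ha, show (-8 : ℤ) = -2 * 4 by norm_num, jacobiSym.mul_left,
    jacobiSym.at_four hu, jacobiSym.at_neg_two hu, ZMod.χ₈'_nat_eq_if_mod_eight,
    ZMod.χ₈'_int_eq_if_mod_eight]
  split_ifs <;> omega

namespace IsFundamentalDiscriminant

variable {D : ℤ} (hD : IsFundamentalDiscriminant D)
include hD

/-- Up to sign, the part of a fundamental discriminant prime to `2` is the product of its odd prime
discriminants. -/
theorem exists_eq_mul_prod : ∃ e : ℤ,
    (¬ 2 ∣ D ∧ e = 1 ∨ D % 8 = 4 ∧ e = -4 ∨ D % 32 = 8 ∧ e = 8 ∨ D % 32 = 24 ∧ e = -8) ∧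
    D = e * ∏ q ∈ D.natAbs.primeFactors.erase 2, oddPrimeDisc q := by
  have hodd : ∀ q ∈ D.natAbs.primeFactors.erase 2, q % 2 = 1 := fun q hq =>
    (Nat.prime_of_mem_primeFactors (Finset.mem_of_mem_erase hq)).eq_two_or_odd.resolve_left
      (Finset.ne_of_mem_erase hq)
  have h4 := prod_oddPrimeDisc_emod_four hodd
  have hkey : ∀ k : ℕ, ∀ m : ℤ, D = 2 ^ k * m → m % 2 = 1 → Squarefree m →
      (∏ q ∈ D.natAbs.primeFactors.erase 2, oddPrimeDisc q).natAbs = m.natAbs := by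
    intro k m hm hm2 hs
    have h1 : D.natAbs.primeFactors.erase 2 = m.natAbs.primeFactors := by
      ext q
      rw [Finset.mem_erase, Nat.mem_primeFactors, Nat.mem_primeFactors, hm, Int.natAbs_mul,
        Int.natAbs_pow]
      constructor
      · rintro ⟨hq2, hq, hd, -⟩
        refine ⟨hq, (hq.dvd_mul.1 hd).resolve_left fun h => hq2 ?_, by omega⟩
        exact (Nat.prime_dvd_prime_iff_eq hq Nat.prime_two).1 (hq.dvd_of_dvd_pow h)
      · rintro ⟨hq, hd, h0⟩
        refine ⟨?_, hq, hd.mul_left _, mul_ne_zero (by simp) h0⟩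
        rintro rfl; omega
    rw [show ∀ x : ℤ, x.natAbs = Int.natAbsHom x from fun _ => rfl, map_prod, h1]
    rw [Finset.prod_congr rfl fun q hq =>
        show Int.natAbsHom (oddPrimeDisc q) = q from oddPrimeDisc_natAbs (hodd q (h1 ▸ hq)),
      Nat.prod_primeFactors_of_squarefree (Int.squarefree_natAbs.2 hs)]
  rcases id hD with ⟨-, ⟨h1, hs⟩ | ⟨m, hm, h1 | h1, hs⟩⟩
  · have := hkey 0 D (by simp) (by omega) hs
    exact ⟨1, by omega, by omega⟩
  · obtain ⟨j, hj⟩ : ∃ j, m = 2 * j := ⟨m / 2, by omega⟩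
    have := hkey 3 j (by rw [hm, hj]; ring) (by omega)
      (hs.squarefree_of_dvd (hj ▸ dvd_mul_left _ _))
    rcases hD.two_dvd_cases (by omega) with ⟨h', -⟩ | h' | h'
    · omega
    · exact ⟨8, by omega, by omega⟩
    · exact ⟨-8, by omega, by omega⟩
  · have := hkey 2 m (by rw [hm]; ring) (by omega) hs
    rcases hD.two_dvd_cases (by omega) with ⟨h', -⟩ | h' | h'
    · exact ⟨-4, by omega, by omega⟩
    · omega
    · omega

theorem primeDisc_two : (D % 8 = 4 ∧ primeDisc D 2 = -4) ∨ (D % 32 = 8 ∧ primeDisc D 2 = 8) ∨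
    (D % 32 = 24 ∧ primeDisc D 2 = -8) ∨ (¬ 2 ∣ D ∧ primeDisc D 2 = 1) := by
  obtain ⟨e, he, h⟩ := hD.exists_eq_mul_prod
  have : primeDisc D 2 = e := by
    rw [primeDisc, if_pos rfl]
    exact Int.ediv_eq_of_eq_mul_left (fun h0 => hD.ne_zero (by rw [h, h0, mul_zero])) h
  rw [this]
  omega

theorem prod_primeDisc : ∏ p ∈ D.natAbs.primeFactors, primeDisc D p = D := by
  obtain ⟨e, he, h⟩ := hD.exists_eq_mul_prod
  have h1 : ∏ p ∈ D.natAbs.primeFactors.erase 2, primeDisc D p =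
      ∏ q ∈ D.natAbs.primeFactors.erase 2, oddPrimeDisc q :=
    Finset.prod_congr rfl fun p hp => by rw [primeDisc, if_neg (Finset.ne_of_mem_erase hp)]
  by_cases h2 : 2 ∣ D
  · have : 2 ∈ D.natAbs.primeFactors :=
      Nat.mem_primeFactors.2 ⟨Nat.prime_two, Int.natCast_dvd.1 (by exact_mod_cast h2),
        hD.natAbs_ne_zero⟩
    rw [← Finset.mul_prod_erase _ _ this, h1]
    conv_rhs => rw [h]
    congr 1
    have := hD.primeDisc_two
    omega
  · have h3 : 2 ∉ D.natAbs.primeFactors := fun h' =>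
      h2 (by exact_mod_cast Int.natCast_dvd.2 (Nat.dvd_of_mem_primeFactors h'))
    have he1 : e = 1 := by omega
    rw [he1, one_mul] at h
    rw [Finset.erase_eq_of_notMem h3] at h h1
    rw [h1, ← h]

theorem kronecker_primeDisc {p : ℕ} (hp : p.Prime) (h : (p : ℤ) ∣ D) {a : ℤ}
    (ha : ¬ (p : ℤ) ∣ a) : kronecker (primeDisc D p) a = localChar D p (a : ZMod D.natAbs) := by
  have := Fact.mk hp
  by_cases h2 : p = 2
  · subst h2
    have ha' : a % 2 = 1 := by omega
    rcases hD.primeDisc_two with ⟨h', e⟩ | ⟨h', e⟩ | ⟨h', e⟩ | ⟨h', e⟩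
    · rw [e, localChar_two_four h', kronecker_neg_four ha']
    · rw [e, localChar_two_eight h', kronecker_eight ha']
    · rw [e, localChar_two_eight' h', kronecker_neg_eight ha']
    · exact absurd h h'
  · rw [localChar_odd h2 h, primeDisc, if_neg h2, kronecker_oddPrimeDisc h2]
    rintro rfl; simp at ha

theorem localChar_neg_one {p : ℕ} (hp : p.Prime) (h : (p : ℤ) ∣ D) :
    localChar D p ((-1 : ℤ) : ZMod D.natAbs) = (primeDisc D p).sign := by
  have := Fact.mk hp
  by_cases h2 : p = 2
  · subst h2
    rcases hD.primeDisc_two with ⟨h', e⟩ | ⟨h', e⟩ | ⟨h', e⟩ | ⟨h', e⟩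
    · rw [e, localChar_two_four h']; rfl
    · rw [e, localChar_two_eight h']; rfl
    · rw [e, localChar_two_eight' h']; rfl
    · exact absurd h h'
  · have hodd : p % 2 = 1 := hp.eq_two_or_odd.resolve_left h2
    rw [localChar_odd h2 h, legendreSym.at_neg_one h2, primeDisc, if_neg h2, oddPrimeDisc,
      Int.sign_mul, Int.sign_natCast_of_ne_zero hp.ne_zero, mul_one, ZMod.χ₄_nat_eq_if_mod_four]
    split_ifs <;> rfl

theorem genusChar_neg_one (hneg : D < 0) :
    genusChar D.natAbs.primeFactors (localChar D) (-1) = -1 := by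
  have hsign : ∀ s : Finset ℕ, (∏ p ∈ s, primeDisc D p).sign = ∏ p ∈ s, (primeDisc D p).sign := by
    intro s
    induction s using Finset.cons_induction with
    | empty => rfl
    | cons p s hp ih => rw [Finset.prod_cons, Finset.prod_cons, Int.sign_mul, ih]
  have h1 := hsign D.natAbs.primeFactors
  rw [hD.prod_primeDisc, Int.sign_eq_neg_one_of_neg hneg] at h1
  rw [h1, genusChar]
  refine Finset.prod_congr rfl fun p hp => ?_
  rw [← hD.localChar_neg_one (Nat.prime_of_mem_primeFactors hp)
        (Int.natCast_dvd.2 (Nat.dvd_of_mem_primeFactors hp))]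
  simp

end IsFundamentalDiscriminant

/-! ### The twisting function in coordinates -/

section Chi

/-- Reduction of coordinates modulo `D`. -/
def redMod (D : ℤ) (x : ℤ × ℤ × ℤ × ℤ) :
    ZMod D.natAbs × ZMod D.natAbs × ZMod D.natAbs × ZMod D.natAbs :=
  (x.1, x.2.1, x.2.2.1, x.2.2.2)

/-- The genus character of `D` on isotropic matrices modulo `D`. -/
def genusFunMod (D : ℤ) (x : ℤ × ℤ × ℤ × ℤ) : ℤ :=
  genusFun D.natAbs.primeFactors (localChar D) ((normOmega D : ℤ) : ZMod D.natAbs) (redMod D x)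

variable {D : ℤ}

theorem genusForm_redMod (x : ℤ × ℤ × ℤ × ℤ) :
    genusForm ((normOmega D : ℤ) : ZMod D.natAbs) (redMod D x) =
      ((genusForm (normOmega D) x : ℤ) : ZMod D.natAbs) := by
  simp [genusForm, redMod]

theorem redMod_eq_iff {x y : ℤ × ℤ × ℤ × ℤ} :
    redMod D x = redMod D y ↔ ∃ z, x - y = D • z := by
  have h : ∀ u v : ℤ, (u : ZMod D.natAbs) = v ↔ ∃ w, u - v = D * w := fun u v => by
    rw [← sub_eq_zero, ← Int.cast_sub, ZMod.intCast_zmod_eq_zero_iff_dvd, Int.natAbs_dvd]; rfl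
  simp only [redMod, Prod.mk.injEq, h]
  constructor
  · rintro ⟨⟨a, ha⟩, ⟨m, hm⟩, ⟨n, hn⟩, ⟨c, hc⟩⟩
    exact ⟨(a, m, n, c), Prod.ext ha (Prod.ext hm (Prod.ext hn hc))⟩
  · rintro ⟨z, hz⟩
    exact ⟨⟨z.1, congrArg (fun w => w.1) hz⟩, ⟨z.2.1, congrArg (fun w => w.2.1) hz⟩,
      ⟨z.2.2.1, congrArg (fun w => w.2.2.1) hz⟩, ⟨z.2.2.2, congrArg (fun w => w.2.2.2) hz⟩⟩

theorem mem_rescaledLattice_iff {X : V D ℚ} :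
    X ∈ rescaledLattice D ↔ ∃ z, latVec D ℤ ℚ (D • z) = X := by
  rw [rescaledLattice, Submodule.mem_map]
  constructor
  · rintro ⟨Y, hY, rfl⟩
    obtain ⟨z, rfl⟩ := mem_lattice_iff.1 hY
    exact ⟨z, by rw [map_smul]; rfl⟩
  · rintro ⟨z, rfl⟩
    exact ⟨_, mem_lattice_iff.2 ⟨z, rfl⟩, by rw [map_smul]; rfl⟩

theorem rescaledLattice_le_lattice : rescaledLattice D ≤ lattice D ℤ ℚ := fun X hX => by
  obtain ⟨z, rfl⟩ := mem_rescaledLattice_iff.1 hX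
  exact mem_lattice_iff.2 ⟨_, rfl⟩

variable (hD : IsFundamentalDiscriminant D)
include hD

theorem chiPrime_latVec {p : ℕ} (hp : p.Prime) (h : (p : ℤ) ∣ D) (x : ℤ × ℤ × ℤ × ℤ) :
    chiPrime D p (latVec D ℤ ℚ x) =
      firstNonzero (localChar D p (x.1 : ZMod D.natAbs))
        (localChar D p (x.2.2.2 : ZMod D.natAbs)) := by
  have e1 : (latVec D ℤ ℚ x).1.num = x.1 := Rat.num_intCast _
  have e2 : (latVec D ℤ ℚ x).2.2.num = x.2.2.2 := Rat.num_intCast _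
  have hz := hD.localChar_eq_zero_iff hp h
  rw [chiPrime, e1, e2, firstNonzero]
  simp only [hz]
  by_cases h1 : (p : ℤ) ∣ x.1
  · by_cases h2 : (p : ℤ) ∣ x.2.2.2
    · simp [h1, h2, (hz _).2 h2]
    · simp [h1, h2, hD.kronecker_primeDisc hp h h2]
  · simp [h1, hD.kronecker_primeDisc hp h h1]

theorem chi_latVec (x : ℤ × ℤ × ℤ × ℤ) : chi D (latVec D ℤ ℚ x) = genusFunMod D x := by
  have hD0 := hD.cast_ne_zero ℚ
  have hmem : latVec D ℤ ℚ x ∈ LD D ↔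
      genusForm ((normOmega D : ℤ) : ZMod D.natAbs) (redMod D x) = 0 := by
    rw [genusForm_redMod, ZMod.intCast_zmod_eq_zero_iff_dvd, Int.natAbs_dvd]
    have h1 : latVec D ℤ ℚ x ∈ dualLattice D ℤ ℚ :=
      lattice_le_dualLattice hD.four_mul_normOmega hD0 (mem_lattice_iff.2 ⟨x, rfl⟩)
    have h2 := Q_latVec (R := ℤ) (F := ℚ) hD.four_mul_normOmega x
    simp only [eq_intCast, Int.cast_id] at h2
    constructor
    · rintro ⟨-, k, hk⟩
      rw [h2] at hk
      have hk' : genusForm (normOmega D) x - D * (x.2.1 * x.2.2.1) = D * k := by exact_mod_cast hk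
      exact ⟨k + x.2.1 * x.2.2.1, by linear_combination hk'⟩
    · rintro ⟨k, hk⟩
      refine ⟨h1, k - x.2.1 * x.2.2.1, ?_⟩
      rw [h2, hk]; push_cast; ring
  rw [chi, genusFunMod, genusFun]
  by_cases h0 : latVec D ℤ ℚ x ∈ LD D
  swap
  · rw [if_neg h0, if_neg fun h => h0 (hmem.2 h)]
  rw [if_pos h0, if_pos (hmem.1 h0)]
  refine Finset.prod_congr rfl fun p hp => ?_
  exact chiPrime_latVec hD (Nat.prime_of_mem_primeFactors hp)
    (Int.natCast_dvd.2 (Nat.dvd_of_mem_primeFactors hp)) x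

theorem chi_of_notMem_lattice {X : V D ℚ} (hX : X ∉ lattice D ℤ ℚ) : chi D X = 0 := by
  rw [chi, if_neg]
  rintro ⟨h, k, hk⟩
  exact hX (hD.mem_lattice_of_mem_dualLattice h hk)

theorem chi_congr {X Y : V D ℚ} (h : X - Y ∈ rescaledLattice D) : chi D X = chi D Y := by
  by_cases hY : Y ∈ lattice D ℤ ℚ
  · obtain ⟨y, rfl⟩ := mem_lattice_iff.1 hY
    obtain ⟨z, hz⟩ := mem_rescaledLattice_iff.1 h
    obtain rfl : latVec D ℤ ℚ (D • z + y) = X := by rw [map_add, hz, sub_add_cancel]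
    rw [chi_latVec hD, chi_latVec hD, genusFunMod, genusFunMod]
    congr 1
    exact redMod_eq_iff.2 ⟨z, by rw [add_sub_cancel_right]⟩
  · have hX : X ∉ lattice D ℤ ℚ := fun hX => hY <| by
      have := sub_mem hX (rescaledLattice_le_lattice h)
      rwa [sub_sub_cancel] at this
    rw [chi_of_notMem_lattice hD hX, chi_of_notMem_lattice hD hY]

/-- The twisting function on the discriminant group. -/
def chiDisc (D : ℤ) (δ : DiscGroup D) : ℂ := ((chi D (δ.out : V D ℚ) : ℤ) : ℂ)

theorem chiDisc_mk (X : dualLattice D ℤ ℚ) :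
    chiDisc D (Submodule.Quotient.mk X) = (chi D X : ℂ) := by
  have h : (Submodule.Quotient.mk X : DiscGroup D).out - X ∈
      (rescaledLattice D).submoduleOf (dualLattice D ℤ ℚ) :=
    (Submodule.Quotient.eq _).1 (Quotient.out_eq _)
  rw [chiDisc, chi_congr hD h]

omit hD in
theorem psi_apply [Finite (DiscGroup D)] (δ : DiscGroup D) : psi D δ = chiDisc D δ := by
  classical
  have := Fintype.ofFinite (DiscGroup D)
  rw [psi, finsum_eq_sum_of_fintype, Finsupp.finsetSum_apply]
  simp [Finsupp.single_apply, chiDisc]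

theorem psi_mk (X : dualLattice D ℤ ℚ) : psi D (Submodule.Quotient.mk X) = (chi D X : ℂ) := by
  have := finite_discGroup hD.ne_zero
  rw [psi_apply, chiDisc_mk hD]

/-- The twisting function is supported on isotropic elements. -/
theorem discQ_of_chiDisc_ne_zero {δ : DiscGroup D} (h : chiDisc D δ ≠ 0) : discQ D δ = 0 := by
  obtain ⟨X, rfl⟩ := Submodule.Quotient.mk_surjective _ δ
  rw [chiDisc_mk hD, Int.cast_ne_zero, chi] at h
  have hX : (X : V D ℚ) ∈ LD D := by_contra fun h' => h (if_neg h')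
  obtain ⟨-, k, hk⟩ := hX
  rw [discQ_mk hD, AddCircle.coe_eq_zero_iff, hk]
  have hD0 := hD.cast_ne_zero ℝ
  rcases abs_choice D with h | h
  · refine ⟨k, ?_⟩
    rw [h]; push_cast; field_simp; simp
  · refine ⟨-k, ?_⟩
    rw [h]; push_cast; field_simp; simp

end Chi

/-! ### The finite Fourier transform of the twisting function -/

section Parseval

variable {A : Type} [AddCommGroup A] [Fintype A] {E : A → AddChar A ℂ}

/-- Parseval's identity for a nondegenerate pairing `E`. -/
theorem parseval_pairing (hadd : ∀ a b c, E (a + b) c = E a c * E b c)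
    (hnd : ∀ a, E a = 0 → a = 0) (f : A → ℂ) :
    ∑ c, ‖∑ a, f a * E a c‖ ^ 2 = Fintype.card A * ∑ a, ‖f a‖ ^ 2 := by
  classical
  have hE0 : ∀ a c, E a c ≠ 0 := fun a c => norm_ne_zero_iff.1 (by rw [AddChar.norm_apply]; simp)
  have hconj : ∀ a c, (starRingEnd ℂ) (E a c) = E (-a) c := fun a c => by
    have h1 : E a c * E (-a) c = 1 := by
      rw [← hadd, add_neg_cancel]
      have := hadd 0 0 c
      rw [add_zero] at this
      exact (mul_eq_left₀ (hE0 0 c)).1 this.symm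
    rw [← AddChar.map_neg_eq_conj, AddChar.map_neg_eq_inv]
    exact inv_eq_of_mul_eq_one_right h1
  have h0 : E 0 = 0 := by
    ext c
    have := hadd 0 0 c
    rw [add_zero] at this
    exact (mul_eq_left₀ (hE0 0 c)).1 this.symm
  have hsum : ∀ a b, ∑ c, E (a + -b) c = if a = b then (Fintype.card A : ℂ) else 0 := fun a b => by
    rw [AddChar.sum_eq_ite]
    refine if_congr ⟨fun h => ?_, fun h => ?_⟩ rfl rfl
    · rw [← sub_eq_zero, sub_eq_add_neg]; exact hnd _ h
    · rw [h, add_neg_cancel, h0]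
  have key : ∑ c, ((‖∑ a, f a * E a c‖ ^ 2 : ℝ) : ℂ) =
      ((Fintype.card A * ∑ a, ‖f a‖ ^ 2 : ℝ) : ℂ) := by
    have h1 : ∀ c, ((‖∑ a, f a * E a c‖ ^ 2 : ℝ) : ℂ) =
        ∑ a, ∑ b, f a * (starRingEnd ℂ) (f b) * E (a + -b) c := fun c => by
      rw [Complex.ofReal_pow, ← Complex.mul_conj', map_sum, Finset.sum_mul_sum]
      refine Finset.sum_congr rfl fun a _ => Finset.sum_congr rfl fun b _ => ?_
      rw [map_mul, hconj, hadd]; ring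
    simp_rw [h1]
    rw [Finset.sum_comm]
    have h2 : ∀ a, ∑ c, ∑ b, f a * (starRingEnd ℂ) (f b) * E (a + -b) c =
        Fintype.card A * ((‖f a‖ ^ 2 : ℝ) : ℂ) := fun a => by
      rw [Finset.sum_comm]
      simp_rw [← Finset.mul_sum, hsum]
      simp [Complex.mul_conj']
      ring
    simp_rw [h2]
    rw [← Finset.mul_sum]
    push_cast
    rfl
  exact_mod_cast key

/-- A function that is an eigenfunction of the Fourier transform on its support, with an eigenvalue of
the maximal absolute value, is an eigenfunction. -/
theorem fourier_eq_of_support (hadd : ∀ a b c, E (a + b) c = E a c * E b c)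
    (hnd : ∀ a, E a = 0 → a = 0) {f : A → ℂ} {κ : ℂ} (hκ : ‖κ‖ ^ 2 = Fintype.card A)
    (hf : ∀ c, f c ≠ 0 → ∑ a, f a * E a c = κ * f c) (c : A) :
    ∑ a, f a * E a c = κ * f c := by
  classical
  by_cases hc : f c ≠ 0
  · exact hf c hc
  have h1 := parseval_pairing hadd hnd f
  rw [← hκ, Finset.mul_sum] at h1
  have h2 : ∀ c ∈ Finset.univ, ‖κ‖ ^ 2 * ‖f c‖ ^ 2 ≤ ‖∑ a, f a * E a c‖ ^ 2 := fun c _ => by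
    by_cases hc : f c = 0
    · rw [hc]; simp
    · rw [hf c hc, norm_mul, mul_pow]
  have h3 := (Finset.sum_eq_sum_iff_of_le h2).1 h1.symm c (Finset.mem_univ c)
  push Not at hc
  rw [hc] at h3 ⊢
  rw [norm_zero, zero_pow two_ne_zero, mul_zero, eq_comm, sq_eq_zero_iff, norm_eq_zero] at h3
  rw [h3, mul_zero]

end Parseval

section DualLattice

variable {D : ℤ}

/-- The additive group of the dual lattice. -/
def dualGroup (D : ℤ) : AddSubgroup (V D ℚ) := (dualLattice D ℤ ℚ).toAddSubgroup

/-- The projection to the discriminant group. -/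
def discMk (D : ℤ) : dualGroup D →+ DiscGroup D :=
  ((rescaledLattice D).submoduleOf (dualLattice D ℤ ℚ)).mkQ.toAddMonoidHom

variable (hD : IsFundamentalDiscriminant D)
include hD

omit hD in
theorem discMk_eq_zero {X : dualGroup D} :
    discMk D X = 0 ↔ (X : V D ℚ) ∈ rescaledLattice D :=
  Submodule.Quotient.mk_eq_zero _

omit hD in
theorem discMk_surjective : Function.Surjective (discMk D) := fun δ => by
  obtain ⟨X, rfl⟩ := Submodule.Quotient.mk_surjective _ δ
  exact ⟨X, rfl⟩

theorem rescaledLattice_le_dualLattice : rescaledLattice D ≤ dualLattice D ℤ ℚ :=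
  rescaledLattice_le_lattice.trans
    (lattice_le_dualLattice hD.four_mul_normOmega (hD.cast_ne_zero ℚ))

/-- The lattice `L'` with its projection to `L' / D L`; the frames are the coordinate basis of `L'`
and `|D|` times the basis of `L` dual to it. -/
theorem isThetaLattice_dualGroup : IsThetaLattice D (dualGroup D) (discMk D) := by
  have hD0 := hD.cast_ne_zero ℚ
  refine ⟨discMk_surjective, fun X => discQ_mk hD X,
    fun j => |D| • latVec D ℤ ℚ (![(0, 0, 0, 1), (0, 0, 1, 0), (0, -1, 0, 0), (1, 0, 0, 0)] j),
    fun j => dualVec D ℤ ℚ (![(1, 0, 0, 0), (0, 1, 0, 0), (0, 0, 1, 0), (0, 0, 0, 1)] j),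
    fun i j => ?_, fun X => ?_, fun X => ?_⟩
  · beta_reduce
    rw [← Int.cast_smul_eq_zsmul ℚ, bil_comm, bil_smul_right, bil_comm, bil_latVec_dualVec hD0]
    fin_cases i <;> fin_cases j <;> simp
  · refine (mem_dualLattice_iff hD0).trans ⟨?_, ?_⟩
    · rintro ⟨x, rfl⟩
      refine ⟨![x.1, x.2.1, x.2.2.1, x.2.2.2], ?_⟩
      simp_rw [← map_smul, ← map_sum]
      congr 1
      simp [Fin.sum_univ_four, -zsmul_eq_mul]
    · rintro ⟨n, rfl⟩
      refine ⟨∑ j, n j • ![(1, 0, 0, 0), (0, 1, 0, 0), (0, 0, 1, 0), (0, 0, 0, 1)] j, ?_⟩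
      rw [map_sum]; simp_rw [map_smul]
  · have h1 : (∃ h : X ∈ dualGroup D, discMk D ⟨X, h⟩ = 0) ↔ X ∈ rescaledLattice D :=
      ⟨fun ⟨_, h'⟩ => discMk_eq_zero.1 h', fun h =>
        ⟨rescaledLattice_le_dualLattice hD h, discMk_eq_zero.2 h⟩⟩
    rw [h1, mem_rescaledLattice_iff]
    have h2 : ∃ e : ℤ, e * e = 1 ∧ |D| = e * D := by
      rcases abs_choice D with h | h
      · exact ⟨1, rfl, by rw [h, one_mul]⟩
      · exact ⟨-1, rfl, by rw [h, neg_one_mul]⟩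
    obtain ⟨e, he, habs⟩ := h2
    simp_rw [habs, mul_comm e D, mul_smul]
    constructor
    · rintro ⟨z, rfl⟩
      refine ⟨![e * z.2.2.2, e * z.2.2.1, -(e * z.2.1), e * z.1], ?_⟩
      simp_rw [← map_smul, ← map_sum]
      congr 1
      have he' : ∀ x, e * x * (D * e) = D * x := fun x => by linear_combination D * x * he
      simp [Fin.sum_univ_four, -zsmul_eq_mul, he']
      rfl
    · rintro ⟨n, rfl⟩
      refine ⟨∑ j, n j • e • ![(0, 0, 0, 1), (0, 0, 1, 0), (0, -1, 0, 0), (1, 0, 0, 0)] j, ?_⟩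
      simp_rw [← map_smul, ← map_sum, Finset.smul_sum]
      congr 1
      refine Finset.sum_congr rfl fun j _ => ?_
      rw [smul_comm D (n j)]

end DualLattice

section FourierChi

variable {D : ℤ}

/-- Coordinates as a linear equivalence. -/
def quadEquiv : (Fin 4 → ℤ) ≃ₗ[ℤ] ℤ × ℤ × ℤ × ℤ where
  toFun n := (n 0, n 1, n 2, n 3)
  invFun x := ![x.1, x.2.1, x.2.2.1, x.2.2.2]
  map_add' _ _ := rfl
  map_smul' _ _ := rfl
  left_inv n := by ext i; fin_cases i <;> rfl
  right_inv _ := rfl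

theorem quadEquiv_apply (n : Fin 4 → ℤ) : quadEquiv n = (n 0, n 1, n 2, n 3) := rfl

theorem quadEquiv_symm_apply (x : ℤ × ℤ × ℤ × ℤ) :
    quadEquiv.symm x = ![x.1, x.2.1, x.2.2.1, x.2.2.2] := rfl

variable (hD : IsFundamentalDiscriminant D)
include hD

/-- The coordinates on the dual lattice. -/
def dualMap : (Fin 4 → ℤ) →ₗ[ℤ] dualLattice D ℤ ℚ :=
  ((dualVec D ℤ ℚ).codRestrict (dualLattice D ℤ ℚ) fun x =>
      (mem_dualLattice_iff (hD.cast_ne_zero ℚ)).2 ⟨x, rfl⟩) ∘ₗ quadEquiv.toLinearMap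

theorem dualMap_bijective : Function.Bijective (dualMap hD) :=
  ⟨fun x y h => quadEquiv.injective (dualVec_injective (hD.cast_ne_zero ℚ)
        (RingHom.injective_int _) (Subtype.ext_iff.1 h)), fun X => by
      obtain ⟨x, hx⟩ := (mem_dualLattice_iff (hD.cast_ne_zero ℚ)).1 X.2
      exact ⟨quadEquiv.symm x, Subtype.ext hx⟩⟩

/-- The basis of the dual lattice given by its coordinates. -/
def dualBasis : Module.Basis (Fin 4) ℤ (dualLattice D ℤ ℚ) :=
  Module.Basis.ofEquivFun (LinearEquiv.ofBijective (dualMap hD) (dualMap_bijective hD)).symm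

theorem dualBasis_repr {X : dualLattice D ℤ ℚ} {x : ℤ × ℤ × ℤ × ℤ}
    (h : dualVec D ℤ ℚ x = X) (i : Fin 4) :
    (dualBasis hD).repr X i = quadEquiv.symm x i := by
  rw [← Module.Basis.equivFun_apply, dualBasis, Module.Basis.equivFun_ofEquivFun]
  refine congrFun ?_ i
  rw [LinearEquiv.symm_apply_eq]
  exact Subtype.ext h.symm

/-- The coordinates on the rescaled lattice. -/
def rescaledMap : (Fin 4 → ℤ) →ₗ[ℤ] (rescaledLattice D).submoduleOf (dualLattice D ℤ ℚ) :=
  (((latVec D ℤ ℚ ∘ₗ LinearMap.lsmul ℤ _ D).codRestrict (dualLattice D ℤ ℚ) fun x =>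
      rescaledLattice_le_dualLattice hD (mem_rescaledLattice_iff.2 ⟨x, rfl⟩)).codRestrict
        ((rescaledLattice D).submoduleOf (dualLattice D ℤ ℚ)) fun x =>
          mem_rescaledLattice_iff.2 ⟨x, rfl⟩) ∘ₗ quadEquiv.toLinearMap

theorem rescaledMap_bijective : Function.Bijective (rescaledMap hD) :=
  ⟨fun x y h => quadEquiv.injective (smul_right_injective _ hD.ne_zero
        (latVec_injective (RingHom.injective_int _) (Subtype.ext_iff.1 (Subtype.ext_iff.1 h)))),
      fun X => by
      obtain ⟨x, hx⟩ := mem_rescaledLattice_iff.1 X.2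
      exact ⟨quadEquiv.symm x, Subtype.ext (Subtype.ext hx)⟩⟩

/-- The basis of the rescaled lattice given by the coordinates on the lattice. -/
def rescaledBasis : Module.Basis (Fin 4) ℤ
    ((rescaledLattice D).submoduleOf (dualLattice D ℤ ℚ)) :=
  Module.Basis.ofEquivFun
    (LinearEquiv.ofBijective (rescaledMap hD) (rescaledMap_bijective hD)).symm

/-- The order of the discriminant group. -/
theorem card_discGroup : Nat.card (DiscGroup D) = D.natAbs ^ 5 := by
  have := Module.Free.of_basis (dualBasis hD)
  have := Module.Finite.of_basis (dualBasis hD)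
  rw [← Submodule.natAbs_det_basis_change (dualBasis hD) _ (rescaledBasis hD),
    Module.Basis.det_apply]
  have h : ∀ i j, (dualBasis hD).toMatrix ((↑) ∘ rescaledBasis hD) i j =
      (!![D, 0, 0, 0; 0, -D * D, -(2 * normOmega D * D), 0; 0, 2 * D, D * D, 0; 0, 0, 0, D] :
        Matrix (Fin 4) (Fin 4) ℤ) i j := fun i j => by
    have h1 : ((rescaledBasis hD j : dualLattice D ℤ ℚ) : V D ℚ) =
        latVec D ℤ ℚ (D • quadEquiv (Pi.single j 1)) := by
      rw [rescaledBasis, Module.Basis.coe_ofEquivFun]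
      rfl
    rw [latVec_eq_dualVec hD.four_mul_normOmega (hD.cast_ne_zero ℚ)] at h1
    rw [Module.Basis.toMatrix_apply, Function.comp_apply, dualBasis_repr hD h1.symm,
      quadEquiv_apply, quadEquiv_symm_apply]
    fin_cases i <;> fin_cases j <;> simp
  rw [Matrix.ext h]
  have h2 : Matrix.det (!![D, 0, 0, 0; 0, -D * D, -(2 * normOmega D * D), 0; 0, 2 * D, D * D, 0;
      0, 0, 0, D] : Matrix (Fin 4) (Fin 4) ℤ) = -D ^ 5 := by
    rw [Matrix.det_succ_row_zero]
    simp [Fin.sum_univ_succ, Matrix.det_fin_three, Fin.succAbove]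
    linear_combination D ^ 4 * hD.four_mul_normOmega
  rw [h2, Int.natAbs_neg, Int.natAbs_pow]

theorem eC_discPair_mk (X Y : dualGroup D) :
    eC (discPair D (discMk D X) (discMk D Y)) = Complex.exp (2 * Real.pi * Complex.I *
      ((scale D * ((bil (X : V D ℚ) Y : ℚ) : ℝ) : ℝ) : ℂ)) :=
  (isThetaLattice_dualGroup hD).eC_discPair X Y

/-- The bilinear form of the discriminant group as a pairing. -/
def pairing (δ : DiscGroup D) : AddChar (DiscGroup D) ℂ where
  toFun β := eC (discPair D δ β)
  map_zero_eq_one' := by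
    obtain ⟨X, rfl⟩ := discMk_surjective δ
    rw [← map_zero (discMk D), eC_discPair_mk hD]
    simp [bil_def]
  map_add_eq_mul' β γ := by
    obtain ⟨X, rfl⟩ := discMk_surjective δ
    obtain ⟨Y, rfl⟩ := discMk_surjective β
    obtain ⟨Z, rfl⟩ := discMk_surjective γ
    rw [← map_add (discMk D), eC_discPair_mk hD, eC_discPair_mk hD, eC_discPair_mk hD,
      ← Complex.exp_add, AddSubgroup.coe_add, bil_add_right]
    congr 1; push_cast; ring

theorem pairing_apply (δ β : DiscGroup D) : pairing hD δ β = eC (discPair D δ β) := rfl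

theorem pairing_add (a b c : DiscGroup D) :
    pairing hD (a + b) c = pairing hD a c * pairing hD b c := by
  simp only [pairing_apply, discPair_comm _ c]
  exact AddChar.map_add_eq_mul (pairing hD c) a b

/-- The dual lattice is dual to the lattice. -/
theorem mem_rescaledLattice_of_bil {X : V D ℚ}
    (h : ∀ Y ∈ dualLattice D ℤ ℚ, ∃ k : ℤ, bil X Y = D * k) : X ∈ rescaledLattice D := by
  have hD0 := hD.cast_ne_zero ℚ
  set x : ℚ × ℚ × ℚ × ℚ :=
    (X.1, X.2.1.re - D * X.2.1.im, 2 * X.2.1.im, X.2.2) with hx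
  have hX : X = latVec D ℚ ℚ x := by
    rw [latVec_apply, hx]
    refine Prod.ext rfl (Prod.ext (QuadraticAlgebra.ext ?_ ?_) rfl) <;> simp
    ring
  have hY : ∀ y : ℤ × ℤ × ℤ × ℤ, dualVec D ℤ ℚ y =
      dualVec D ℚ ℚ ((y.1, y.2.1, y.2.2.1, y.2.2.2) : ℚ × ℚ × ℚ × ℚ) := fun y => rfl
  have key : ∀ y : ℤ × ℤ × ℤ × ℤ, ∃ k : ℤ,
      x.1 * y.2.2.2 + y.1 * x.2.2.2 - x.2.1 * y.2.2.1 + x.2.2.1 * y.2.1 = D * k := fun y => by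
    obtain ⟨k, hk⟩ := h (dualVec D ℤ ℚ y) ((mem_dualLattice_iff hD0).2 ⟨y, rfl⟩)
    rw [hX, hY, bil_latVec_dualVec hD0] at hk
    exact ⟨k, hk⟩
  obtain ⟨a, ha⟩ := key (0, 0, 0, 1)
  obtain ⟨m, hm⟩ := key (0, 0, -1, 0)
  obtain ⟨n, hn⟩ := key (0, 1, 0, 0)
  obtain ⟨c, hc⟩ := key (1, 0, 0, 0)
  refine mem_rescaledLattice_iff.2 ⟨(a, m, n, c), ?_⟩
  simp at ha hm hn hc
  rw [hX, latVec_apply, latVec_apply, ha, hm, hn, hc]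
  simp

theorem pairing_nondegenerate (δ : DiscGroup D) (h : pairing hD δ = 0) : δ = 0 := by
  obtain ⟨X, rfl⟩ := discMk_surjective δ
  refine discMk_eq_zero.2 (mem_rescaledLattice_of_bil hD fun Y hY => ?_)
  have h1 : pairing hD (discMk D X) (discMk D ⟨Y, hY⟩) = 1 := by rw [h]; rfl
  rw [pairing_apply, eC_discPair_mk hD, Complex.exp_eq_one_iff] at h1
  obtain ⟨k, hk⟩ := h1
  have hN : ((|D| : ℤ) : ℝ) ≠ 0 := by exact_mod_cast (abs_pos.2 hD.ne_zero).ne'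
  have h2 : ((scale D * ((bil (X : V D ℚ) Y : ℚ) : ℝ) : ℝ) : ℂ) = ((k : ℝ) : ℂ) := by
    have h3 : (2 * Real.pi * Complex.I : ℂ) ≠ 0 := Complex.two_pi_I_ne_zero
    refine mul_left_cancel₀ h3 ?_
    rw [hk]; push_cast; ring
  have h3 := Complex.ofReal_injective h2
  rw [scale, inv_mul_eq_iff_eq_mul₀ hN] at h3
  have h4 : bil (X : V D ℚ) Y = ((|D| : ℤ) : ℚ) * k := by exact_mod_cast h3
  rcases abs_choice D with h | h
  · exact ⟨k, by rw [h4, h]⟩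
  · exact ⟨-k, by rw [h4, h]; push_cast; ring⟩

/-- The Gauss sum of the genus character. -/
def gaussSum (D : ℤ) : ℂ :=
  if h : D.natAbs ≠ 0 then
    haveI : NeZero D.natAbs := ⟨h⟩
    ∑ u : ZMod D.natAbs, (genusChar D.natAbs.primeFactors (localChar D) u : ℂ) *
      ZMod.stdAddChar u
  else 0

theorem norm_gaussSum : ‖gaussSum D‖ ^ 2 = D.natAbs := by
  have : NeZero D.natAbs := ⟨hD.natAbs_ne_zero⟩
  rw [gaussSum, dif_pos hD.natAbs_ne_zero, ← Complex.normSq_eq_norm_sq,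
    hD.isGenusSystem.normSq_gauss _ (ZMod.isPrimitive_stdAddChar _), ZMod.card]

/-- On its support, the twisting function is an eigenfunction of the Fourier transform. -/
theorem fourier_chiDisc_of_ne_zero {β : DiscGroup D} (hβ : chiDisc D β ≠ 0) :
    ∑ᶠ δ, chiDisc D δ * pairing hD δ β = (D.natAbs : ℂ) ^ 2 * gaussSum D * chiDisc D β := by
  have : NeZero D.natAbs := ⟨hD.natAbs_ne_zero⟩
  have := finite_discGroup hD.ne_zero
  have := Fintype.ofFinite (DiscGroup D)
  have hL : ∀ x, latVec D ℤ ℚ x ∈ dualLattice D ℤ ℚ := fun x =>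
    lattice_le_dualLattice hD.four_mul_normOmega (hD.cast_ne_zero ℚ) (mem_lattice_iff.2 ⟨x, rfl⟩)
  have hsupp : ∀ δ, chiDisc D δ ≠ 0 → ∃ x, discMk D ⟨latVec D ℤ ℚ x, hL x⟩ = δ := fun δ hδ => by
    obtain ⟨X, rfl⟩ := Submodule.Quotient.mk_surjective _ δ
    rw [chiDisc_mk hD, Int.cast_ne_zero] at hδ
    obtain ⟨x, hx⟩ := mem_lattice_iff.1 (by_contra fun h => hδ (chi_of_notMem_lattice hD h))
    exact ⟨x, congrArg (discMk D) (Subtype.ext hx)⟩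
  have hchi : ∀ x, chiDisc D (discMk D ⟨latVec D ℤ ℚ x, hL x⟩) = (genusFunMod D x : ℂ) := fun x => by
    rw [← chi_latVec hD]; exact chiDisc_mk hD _
  obtain ⟨y, rfl⟩ := hsupp β hβ
  let s : ZMod D.natAbs → ℤ := Function.surjInv ZMod.intCast_surjective
  have hs : ∀ u, ((s u : ℤ) : ZMod D.natAbs) = u := Function.surjInv_eq _
  let S : ZMod D.natAbs × ZMod D.natAbs × ZMod D.natAbs × ZMod D.natAbs → ℤ × ℤ × ℤ × ℤ :=
    fun u => (s u.1, s u.2.1, s u.2.2.1, s u.2.2.2)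
  have hS : ∀ u, redMod D (S u) = u := fun u => by simp [redMod, S, hs]
  rw [hchi, genusFunMod, Int.cast_ne_zero] at hβ
  have key := hD.isGenusSystem.fourier_genusFun (ZMod.stdAddChar (N := D.natAbs)) hβ
  rw [hchi, genusFunMod, gaussSum, dif_pos hD.natAbs_ne_zero, finsum_eq_sum_of_fintype]
  rw [ZMod.card] at key
  rw [← key, eq_comm]
  refine Finset.sum_of_injOn (fun u => discMk D ⟨latVec D ℤ ℚ (S u), hL _⟩) ?_ (fun _ _ => by simp)
    ?_ ?_
  · intro u _ v _ huv
    have h1 := sub_eq_zero.2 huv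
    rw [← map_sub] at h1
    have h2 := discMk_eq_zero.1 h1
    rw [AddSubgroup.coe_sub] at h2
    obtain ⟨z, hz⟩ := mem_rescaledLattice_iff.1 h2
    rw [← map_sub] at hz
    have h3 := redMod_eq_iff.2 ⟨z, (latVec_injective (RingHom.injective_int _) hz).symm⟩
    rwa [hS, hS] at h3
  · intro δ _ hδ
    by_cases h0 : chiDisc D δ = 0
    · rw [h0, zero_mul]
    obtain ⟨x, rfl⟩ := hsupp δ h0
    refine absurd ⟨redMod D x, by simp, ?_⟩ hδ
    obtain ⟨z, hz⟩ := redMod_eq_iff.1 (hS (redMod D x))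
    refine sub_eq_zero.1 ?_
    rw [← map_sub]
    refine discMk_eq_zero.2 (mem_rescaledLattice_iff.2 ⟨z, ?_⟩)
    rw [← hz, map_sub]; rfl
  · intro u _
    rw [hchi, genusFunMod, hS]
    congr 1
    rw [pairing_apply, eC_discPair_mk hD]
    have h1 := bil_latVec (R := ℤ) (F := ℚ) hD.four_mul_normOmega (S u) y
    set k := genusBil ((normOmega D : ℤ) : ℤ) (S u) y -
      D * ((S u).2.1 * y.2.2.1 + (S u).2.2.1 * y.2.1) with hk
    simp only [Int.cast_id, eq_intCast] at h1
    rw [← hk] at h1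
    have h2 : genusBil ((normOmega D : ℤ) : ZMod D.natAbs) u (redMod D y) =
        ((k : ℤ) : ZMod D.natAbs) := by
      have hDz : ((D : ℤ) : ZMod D.natAbs) = 0 := by
        rw [ZMod.intCast_zmod_eq_zero_iff_dvd, Int.natAbs_dvd]
      rw [hk]
      nth_rw 1 [← hS u]
      simp [genusBil, redMod, hDz]
    rw [h2, ZMod.stdAddChar_coe]
    change Complex.exp _ = Complex.exp (2 * Real.pi * Complex.I *
      ((scale D * ((bil (latVec D ℤ ℚ (S u)) (latVec D ℤ ℚ y) : ℚ) : ℝ) : ℝ) : ℂ))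
    rw [h1, scale, ← Int.natCast_natAbs]
    generalize D.natAbs = N
    congr 1
    push_cast
    ring

/-- The twisting function is an eigenfunction of the Fourier transform. -/
theorem fourier_chiDisc (β : DiscGroup D) :
    ∑ᶠ δ, chiDisc D δ * eC (discPair D δ β) =
      (D.natAbs : ℂ) ^ 2 * gaussSum D * chiDisc D β := by
  have := finite_discGroup hD.ne_zero
  have := Fintype.ofFinite (DiscGroup D)
  rw [finsum_eq_sum_of_fintype]
  refine fourier_eq_of_support (E := pairing hD) (pairing_add hD) (pairing_nondegenerate hD) ?_
    (fun c hc => ?_) β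
  · rw [norm_mul, mul_pow, norm_gaussSum hD, ← Nat.card_eq_fintype_card, card_discGroup hD,
      norm_pow, Complex.norm_natCast]
    push_cast
    ring
  · rw [← fourier_chiDisc_of_ne_zero hD hc, finsum_eq_sum_of_fintype]

end FourierChi

/-! ### The sign of the Gauss sum -/

section Sign

variable {D : ℤ} (hD : IsFundamentalDiscriminant D)
include hD

theorem chiDisc_support {X : dualGroup D} (h : chiDisc D (discMk D X) ≠ 0) :
    ∃ x, latVec D ℤ ℚ x = X := by
  have h1 : chiDisc D (discMk D X) = (chi D X : ℂ) := chiDisc_mk hD X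
  rw [h1, Int.cast_ne_zero] at h
  exact mem_lattice_iff.1 (by_contra fun h' => h (chi_of_notMem_lattice hD h'))

/-- The base point `j`. -/
def pointJ : H3 := ⟨0, 1, one_pos⟩

omit hD in
theorem coordsQ_pointJ_zero (X : V D ℚ) :
    coordsQ D pointJ X 0 = (((X.1 + X.2.2 : ℚ) : ℝ)) / √2 := by
  simp [coordsQ, coords, pointJ, baseChange]

/-- The majorant of the quadratic form at the base point `j`, on the lattice. -/
theorem majorant_latVec (hneg : D < 0) (x : ℤ × ℤ × ℤ × ℤ) :
    ∃ k : ℕ, ∑ i, coordsQ D pointJ (latVec D ℤ ℚ x) i ^ 2 =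
      ((x.1 ^ 2 + x.2.2.2 ^ 2 + 2 * k : ℤ) : ℝ) := by
  have ht := hD.four_mul_normOmega
  have h1 := mink_coordsQ hneg pointJ (latVec D ℤ ℚ x) (latVec D ℤ ℚ x)
  have h2 := coordsQ_pointJ_zero (latVec D ℤ ℚ x)
  rw [bil_self, Q_latVec (R := ℤ) ht] at h1
  have h3 : coordsQ D pointJ (latVec D ℤ ℚ x) 0 ^ 2 = ((x.1 : ℝ) + x.2.2.2) ^ 2 / 2 := by
    rw [h2, div_pow, Real.sq_sqrt (by norm_num), latVec_apply]
    simp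
  have hk : 0 ≤ x.2.1 ^ 2 + D * x.2.1 * x.2.2.1 + normOmega D * x.2.2.1 ^ 2 := by
    have : 4 * (x.2.1 ^ 2 + D * x.2.1 * x.2.2.1 + normOmega D * x.2.2.1 ^ 2) =
        (2 * x.2.1 + D * x.2.2.1) ^ 2 + -D * x.2.2.1 ^ 2 := by
      linear_combination x.2.2.1 ^ 2 * ht
    have h5 : 0 ≤ -D * x.2.2.1 ^ 2 := mul_nonneg (by omega) (sq_nonneg _)
    have h6 := sq_nonneg (2 * x.2.1 + D * x.2.2.1)
    omega
  obtain ⟨k, hk⟩ := Int.eq_ofNat_of_zero_le hk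
  refine ⟨k, ?_⟩
  rw [← hk, Fin.sum_univ_four]
  simp only [mink, genusForm, eq_intCast, Int.cast_id] at h1
  push_cast at h1 ⊢
  linear_combination 2 * h3 - h1

/-- At the base point `j` the vectors of majorant `1` contribute to the theta series with the same
sign: as `D < 0`, both `χ_D(X)` and `(X, v)` change sign under `X ↦ -X`. -/
theorem chi_mul_nonneg (hneg : D < 0) {X : dualGroup D}
    (hX : ∑ i, coordsQ D pointJ (X : V D ℚ) i ^ 2 = 1) :
    ∃ r : ℝ, 0 ≤ r ∧ chiDisc D (discMk D X) * coordsQ D pointJ (X : V D ℚ) 0 = r := by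
  by_cases h0 : chiDisc D (discMk D X) = 0
  · exact ⟨0, le_rfl, by rw [h0, zero_mul]; simp⟩
  obtain ⟨x, hx⟩ := chiDisc_support hD h0
  have h1 : chiDisc D (discMk D X) = (chi D X : ℂ) := chiDisc_mk hD X
  rw [h1] at h0
  replace h0 := Int.cast_ne_zero.1 h0
  rw [h1, coordsQ_pointJ_zero]
  rw [← hx] at hX h0 ⊢
  obtain ⟨k, hk⟩ := majorant_latVec hD hneg x
  rw [hk] at hX
  have hX' : x.1 ^ 2 + x.2.2.2 ^ 2 + 2 * (k : ℤ) = 1 := by exact_mod_cast hX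
  rw [chi_latVec hD] at h0 ⊢
  have hg : genusFunMod D x = ∏ p ∈ D.natAbs.primeFactors,
      firstNonzero (localChar D p (x.1 : ZMod D.natAbs))
        (localChar D p (x.2.2.2 : ZMod D.natAbs)) := by
    rw [genusFunMod, genusFun] at h0 ⊢
    exact if_pos (by_contra fun h => h0 (if_neg h))
  have hz : ∀ p ∈ D.natAbs.primeFactors, localChar D p ((0 : ℤ) : ZMod D.natAbs) = 0 :=
    fun p hp => (hD.localChar_eq_zero_iff (Nat.prime_of_mem_primeFactors hp)
      (Int.natCast_dvd.2 (Nat.dvd_of_mem_primeFactors hp)) 0).2 (dvd_zero _)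
  have hgen : ∀ e : ℤ, (e = 1 ∨ e = -1) → ∏ p ∈ D.natAbs.primeFactors,
      localChar D p (e : ZMod D.natAbs) = e := fun e he => by
    rcases he with rfl | rfl
    · simp
    · have := hD.genusChar_neg_one hneg
      rw [genusChar] at this
      simpa using this
  have hval : ∃ e : ℤ, (e = 1 ∨ e = -1) ∧ genusFunMod D x = e ∧ x.1 + x.2.2.2 = e := by
    have ha : x.1 = 0 ∨ x.1 = 1 ∨ x.1 = -1 := by
      have : x.1 ^ 2 ≤ 1 := by nlinarith [sq_nonneg x.2.2.2]
      have := abs_le.1 ((sq_le_one_iff_abs_le_one _).1 this)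
      omega
    have hc : x.2.2.2 = 0 ∨ x.2.2.2 = 1 ∨ x.2.2.2 = -1 := by
      have : x.2.2.2 ^ 2 ≤ 1 := by nlinarith [sq_nonneg x.1]
      have := abs_le.1 ((sq_le_one_iff_abs_le_one _).1 this)
      omega
    by_cases ha0 : x.1 = 0
    · have hc' : x.2.2.2 = 1 ∨ x.2.2.2 = -1 := by
        refine hc.resolve_left fun h => ?_
        rw [ha0, h] at hX'; omega
      refine ⟨x.2.2.2, hc', ?_, by omega⟩
      rw [hg, ha0]
      refine Eq.trans ?_ (hgen _ hc')
      refine Finset.prod_congr rfl fun p hp => ?_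
      rw [hz p hp, firstNonzero_zero]
    · have ha' := ha.resolve_left ha0
      have hc' : x.2.2.2 = 0 := by
        rcases ha' with h | h <;> rw [h] at hX' <;> rcases hc with h' | h' | h' <;>
          rw [h'] at hX' ⊢ <;> omega
      refine ⟨x.1, ha', ?_, by omega⟩
      rw [hg]
      refine Eq.trans ?_ (hgen _ ha')
      refine Finset.prod_congr rfl fun p hp => ?_
      refine firstNonzero_of_ne ?_ _
      rw [Ne, hD.localChar_eq_zero_iff (Nat.prime_of_mem_primeFactors hp)
        (Int.natCast_dvd.2 (Nat.dvd_of_mem_primeFactors hp))]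
      have := (Nat.prime_of_mem_primeFactors hp).two_le
      rcases ha' with h | h <;> rw [h] <;> intro h' <;> have := Int.le_of_dvd one_pos (by simpa using h') <;> omega
  obtain ⟨e, he, h2, h3⟩ := hval
  refine ⟨1 / √2, by positivity, ?_⟩
  rw [h2, latVec_apply]
  have he2 : ((e : ℤ) : ℝ) * e = 1 := by rcases he with rfl | rfl <;> norm_num
  have h4 : (((algebraMap ℤ ℚ x.1 + algebraMap ℤ ℚ x.2.2.2 : ℚ)) : ℝ) = e := by
    rw [← map_add, h3]; simp
  rw [h4]
  have h5 : ((e : ℤ) : ℂ) = ((e : ℝ) : ℂ) := by simp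
  rw [h5, ← Complex.ofReal_mul, ← mul_div_assoc, he2]

/-- The theta series of the dual lattice at `j` does not vanish identically: high up on the imaginary
axis it is dominated by the shortest vectors, whose contributions have the same sign. -/
theorem exists_latticeTheta_ne_zero (hneg : D < 0) :
    ∃ τ : ℍ, latticeTheta (discMk D) (chiDisc D) pointJ τ ≠ 0 := by
  set s := scale D with hs
  have hs0 : 0 < s := scale_pos hneg
  set w : dualGroup D → Fin 4 → ℝ := fun X => coordsQ D pointJ (X : V D ℚ) with hw
  set E : dualGroup D → ℝ := fun X => ∑ i, w X i ^ 2 with hE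
  set A : dualGroup D → ℂ := fun X => chiDisc D (discMk D X) * w X 0 with hA
  have hI : ∀ y : ℝ, 0 < y → 0 < (y * Complex.I).im := fun y hy => by simpa using hy
  -- on the imaginary axis
  have hterm : ∀ (y : ℝ) (X : dualGroup D), chiDisc D (discMk D X) *
      minkGauss s (y * Complex.I) (w X) = A X * (Real.exp (-(Real.pi * s * y * E X)) : ℝ) := by
    intro y X
    rw [minkGauss, hA, hE]
    simp only [Fin.sum_univ_four]
    rw [← mul_assoc, Complex.ofReal_exp]
    congr 2
    push_cast
    rw [map_mul, Complex.conj_ofReal, Complex.conj_I]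
    linear_combination (Real.pi * s * y * (w X 0 ^ 2 + w X 1 ^ 2 + w X 2 ^ 2 + w X 3 ^ 2) : ℂ) *
      Complex.I_sq
  have hEA : ∀ X, A X ≠ 0 → E X = 1 ∨ 2 ≤ E X := by
    intro X hX
    obtain ⟨x, hx⟩ := chiDisc_support hD (left_ne_zero_of_mul hX)
    obtain ⟨k, hk⟩ := majorant_latVec hD hneg x
    rw [hx] at hk
    change E X = _ at hk
    set q : ℤ := x.1 ^ 2 + x.2.2.2 ^ 2 + 2 * k with hq
    have hq0 : 0 ≤ q := by positivity
    have hq1 : q ≠ 0 := by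
      intro h0
      rw [h0, Int.cast_zero] at hk
      have : w X 0 ^ 2 ≤ E X :=
        Finset.single_le_sum (f := fun i => w X i ^ 2) (fun i _ => sq_nonneg _) (Finset.mem_univ 0)
      have h1 : w X 0 = 0 := by
        rw [hk] at this
        exact pow_eq_zero_iff two_ne_zero |>.1 (le_antisymm this (sq_nonneg _))
      exact right_ne_zero_of_mul hX (by rw [h1]; rfl)
    have : q = 1 ∨ 2 ≤ q := by omega
    rcases this with h | h
    · left; rw [hk, h]; simp
    · right; rw [hk]; exact_mod_cast h
  let g : ℝ → dualGroup D → ℂ := fun y X => A X * (Real.exp (-(Real.pi * s * y * (E X - 1))) : ℝ)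
  let g' : dualGroup D → ℂ := fun X => if E X = 1 then A X else 0
  have hg : ∀ y X, g y X = (Real.exp (Real.pi * s * y) : ℝ) *
      (chiDisc D (discMk D X) * minkGauss s (y * Complex.I) (w X)) := fun y X => by
    rw [hterm, mul_left_comm, ← Complex.ofReal_mul, ← Real.exp_add]
    simp only [g]
    congr 3; ring
  have hsum : Summable fun X => ‖g 1 X‖ := by
    simp_rw [hg]
    exact (((isThetaLattice_dualGroup hD).summable hneg pointJ (hI 1 one_pos)).mul_left _).norm
  have hbound : ∀ᶠ y : ℝ in Filter.atTop, ∀ X, ‖g y X‖ ≤ ‖g 1 X‖ := by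
    filter_upwards [Filter.eventually_ge_atTop (1 : ℝ)] with y hy X
    by_cases h0 : A X = 0
    · simp only [g]; rw [h0, zero_mul, zero_mul]
    have hE1 : 0 ≤ E X - 1 := by rcases hEA X h0 with h | h <;> linarith
    simp only [g]
    rw [norm_mul (A X), norm_mul (A X)]
    refine mul_le_mul_of_nonneg_left ?_ (norm_nonneg _)
    rw [Complex.norm_real, Complex.norm_real, Real.norm_of_nonneg (Real.exp_pos _).le,
      Real.norm_of_nonneg (Real.exp_pos _).le, Real.exp_le_exp, neg_le_neg_iff]
    refine mul_le_mul_of_nonneg_right ?_ hE1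
    exact mul_le_mul_of_nonneg_left hy (by positivity)
  have hlim : ∀ X, Filter.Tendsto (fun y => g y X) Filter.atTop (nhds (g' X)) := by
    intro X
    by_cases h0 : A X = 0
    · simp only [g, g', h0, zero_mul, ite_self]; exact tendsto_const_nhds
    rcases hEA X h0 with h | h
    · simp only [g, g', h, if_true, sub_self, mul_zero, neg_zero, Real.exp_zero, Complex.ofReal_one,
        mul_one]
      exact tendsto_const_nhds
    · have h1 : g' X = A X * ((0 : ℝ) : ℂ) := by
        simp only [g']; rw [if_neg (by linarith)]; simp
      rw [h1]
      refine Filter.Tendsto.const_mul _ ((Complex.continuous_ofReal.tendsto _).comp ?_)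
      refine Real.tendsto_exp_neg_atTop_nhds_zero.comp ?_
      have h2 : (fun y => Real.pi * s * y * (E X - 1)) = fun y => Real.pi * s * (E X - 1) * y := by
        ext y; ring
      rw [h2]
      exact Filter.tendsto_id.const_mul_atTop (mul_pos (by positivity) (by linarith))
  have key := tendsto_tsum_of_dominated_convergence hsum hlim hbound
  -- the limit is positive
  have hg's : Summable g' := by
    refine Summable.of_norm_bounded hsum fun X => ?_
    simp only [g, g']
    split_ifs with h
    · rw [h]; simp
    · simp
  choose! r hr0 hr using fun X (h : E X = 1) => chi_mul_nonneg hD hneg (X := X) h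
  have hr' : ∀ X, g' X = ((if E X = 1 then r X else 0 : ℝ) : ℂ) := fun X => by
    simp only [g']
    split_ifs with h
    · exact hr X h
    · simp
  have hlimpos : ∑' X, g' X ≠ 0 := by
    have hr'0 : ∀ X, 0 ≤ (if E X = 1 then r X else 0 : ℝ) := fun X => by
      split_ifs with h
      · exact hr0 X h
      · exact le_rfl
    simp_rw [hr']
    rw [← Complex.ofReal_tsum, Complex.ofReal_ne_zero]
    have hsr : Summable fun X => (if E X = 1 then r X else 0 : ℝ) := by
      rw [← Complex.summable_ofReal]
      simp_rw [← hr']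
      exact hg's
    obtain ⟨X, hX⟩ : ∃ X : dualGroup D, (X : V D ℚ) = latVec D ℤ ℚ (1, 0, 0, 0) :=
      ⟨⟨_, lattice_le_dualLattice hD.four_mul_normOmega (hD.cast_ne_zero ℚ)
        (mem_lattice_iff.2 ⟨_, rfl⟩)⟩, rfl⟩
    have hw2 : √(2 : ℝ) * √2 = 2 := Real.mul_self_sqrt (by norm_num)
    have hEX : E X = 1 := by
      simp only [E, w]
      rw [hX, Fin.sum_univ_four]
      simp [coordsQ, coords, pointJ, baseChange, latVec_apply]
      norm_num
    refine (hsr.tsum_pos hr'0 X ?_).ne'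
    refine lt_of_le_of_ne (hr'0 X) fun h0 => ?_
    have h1 := hr' X
    rw [← h0, Complex.ofReal_zero] at h1
    simp only [g'] at h1
    rw [if_pos hEX] at h1
    have h2 : chiDisc D (discMk D X) = (chi D X : ℂ) := chiDisc_mk hD X
    have h3 : w X 0 ≠ 0 := by
      simp only [w]
      rw [coordsQ_pointJ_zero, hX, latVec_apply]
      simp
    have h4 : chi D X = 1 := by
      rw [hX, chi_latVec hD, genusFunMod, genusFun, if_pos (by simp [genusForm, redMod])]
      refine Finset.prod_eq_one fun p _ => ?_
      simp [redMod, firstNonzero]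
    refine h3 ?_
    simpa only [A, h2, h4, Int.cast_one, one_mul, Complex.ofReal_eq_zero] using h1
  obtain ⟨y, hy, hy0⟩ := ((key.eventually_ne hlimpos).and (Filter.eventually_gt_atTop 0)).exists
  refine ⟨⟨y * Complex.I, hI y hy0⟩, fun h => hy ?_⟩
  rw [latticeTheta, mul_eq_zero] at h
  have h1 : ((Complex.im (y * Complex.I) ^ (3 / 2 : ℝ) : ℝ) : ℂ) ≠ 0 := by
    rw [Complex.ofReal_ne_zero]
    exact (Real.rpow_pos_of_pos (hI y hy0) _).ne'
  have h2 := h.resolve_left h1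
  simp_rw [hg, tsum_mul_left]
  rw [mul_eq_zero]
  exact Or.inr h2

end Sign

/-! ### Invariance under the Weil representation -/

section WeilInvariance

variable {D : ℤ} (hD : IsFundamentalDiscriminant D)
include hD

/-- The eigenvalue of the Fourier transform at the twisting function, that is, the value of the Gauss
sum. Its sign is read off from the transformation behaviour of a non-vanishing theta series. -/
theorem eigenvalue_eq (hneg : D < 0) :
    (D.natAbs : ℂ) ^ 2 * gaussSum D = Complex.I * (√(Nat.card (DiscGroup D) : ℝ) : ℝ) := by
  set κ := (D.natAbs : ℂ) ^ 2 * gaussSum D with hκ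
  have H := isThetaLattice_dualGroup hD
  obtain ⟨r, hr, hS⟩ := H.exists_inversion hneg (χ := chiDisc D) (fourier_chiDisc hD) pointJ
  obtain ⟨τ, hτ⟩ := exists_latticeTheta_ne_zero hD hneg
  have h1 := inversion_const_eq_one
    (H.latticeTheta_T hneg (fun δ => discQ_of_chiDisc_ne_zero hD) pointJ) hS hτ
  rw [← hκ] at h1
  have hr' : (r : ℂ) ≠ 0 := Complex.ofReal_ne_zero.2 hr.ne'
  have h2 : κ = Complex.I * (r⁻¹ : ℝ) := by
    refine mul_left_cancel₀ (mul_ne_zero (neg_ne_zero.2 Complex.I_ne_zero) hr') ?_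
    rw [h1]
    push_cast
    field_simp
    rw [Complex.I_sq, neg_neg]
  have h3 : ‖κ‖ ^ 2 = Nat.card (DiscGroup D) := by
    rw [hκ, norm_mul, mul_pow, norm_gaussSum hD, card_discGroup hD, norm_pow, Complex.norm_natCast]
    push_cast
    ring
  have h4 : ‖κ‖ = r⁻¹ := by
    rw [h2, norm_mul, Complex.norm_I, one_mul, Complex.norm_real, Real.norm_of_nonneg
      (inv_pos.2 hr).le]
  rw [← h3, Real.sqrt_sq (norm_nonneg _), h4, h2]

/-- Invariance under `S`, the dual Weil representation being that of the form `-Q / |D|`. -/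
theorem weilS_psi (hneg : D < 0) : weilS (fun δ => -discQ D δ) 3 1 (psi D) = psi D := by
  classical
  have := finite_discGroup hD.ne_zero
  have := Fintype.ofFinite (DiscGroup D)
  have hc : (0 : ℝ) < Nat.card (DiscGroup D) := by exact_mod_cast Nat.card_pos
  have h8 : Complex.exp (2 * Real.pi * Complex.I * ((((1 : ℕ) : ℂ) - (3 : ℕ)) / 8)) =
      -Complex.I := by
    rw [← Complex.exp_neg_pi_div_two_mul_I]
    congr 1; push_cast; ring
  ext β
  have h1 := fourier_chiDisc hD β
  rw [eigenvalue_eq hD hneg, finsum_eq_sum_of_fintype] at h1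
  rw [weilS, Finsupp.linearCombination_apply, Finsupp.sum_fintype _ _ (by simp),
    Finsupp.finsetSum_apply, psi_apply]
  have h2 : ∀ γ : DiscGroup D, (psi D γ •
      ((Complex.exp (2 * Real.pi * Complex.I * ((((1 : ℕ) : ℂ) - (3 : ℕ)) / 8)) /
        (√(Nat.card (DiscGroup D) : ℝ) : ℂ)) •
      ∑ᶠ β : DiscGroup D, eC (-(-discQ D (β + γ) - -discQ D β - -discQ D γ)) •
        Finsupp.single β (1 : ℂ))) β =
      -Complex.I / (√(Nat.card (DiscGroup D) : ℝ) : ℂ) *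
        (chiDisc D γ * eC (discPair D γ β)) := fun γ => by
    rw [h8, finsum_eq_sum_of_fintype, Finsupp.smul_apply, Finsupp.smul_apply,
      Finsupp.finsetSum_apply, psi_apply]
    have h3 : ∀ δ : DiscGroup D, -(-discQ D (δ + γ) - -discQ D δ - -discQ D γ) =
        discPair D γ δ := fun δ => by
      rw [discPair_comm, discPair]; abel
    simp_rw [h3]
    simp [Finsupp.single_apply]
    ring
  simp_rw [h2]
  rw [← Finset.mul_sum, h1]
  have h4 : ((√(Nat.card (DiscGroup D) : ℝ) : ℝ) : ℂ) ≠ 0 :=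
    Complex.ofReal_ne_zero.2 (Real.sqrt_pos.2 hc).ne'
  field_simp
  rw [Complex.I_sq]
  ring

theorem weilT_psi : weilT (fun δ => -discQ D δ) (psi D) = psi D := by
  classical
  have := finite_discGroup hD.ne_zero
  have := Fintype.ofFinite (DiscGroup D)
  ext β
  rw [weilT, Finsupp.linearCombination_apply, Finsupp.sum_fintype _ _ (by simp),
    Finsupp.finsetSum_apply]
  simp only [Finsupp.smul_apply, Finsupp.single_apply, psi_apply, smul_eq_mul]
  rw [Finset.sum_eq_single β (fun γ _ h => by rw [if_neg h]; simp) (by simp)]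
  by_cases h0 : chiDisc D β = 0
  · rw [h0, zero_mul]
  · rw [discQ_of_chiDisc_ne_zero hD h0, neg_zero, eC_zero]; simp

theorem weil_invariant (hneg : D < 0) {g : Mp2Z} {B : Module.End ℂ (DiscGroup D →₀ ℂ)}
    (h : IsDualWeilOperator D g B) : B (psi D) = psi D := by
  induction h with
  | gen_T => exact weilT_psi hD
  | gen_S => exact weilS_psi hD hneg
  | one => rfl
  | mul _ _ h1 h2 => rw [Module.End.mul_apply, h2, h1]
  | @inv g B C _ _ h2 h3 =>
    calc C (psi D) = (C * B) (psi D) := by rw [Module.End.mul_apply, h3]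
      _ = psi D := by rw [h2]; rfl

end WeilInvariance

/-! ### Generation of the metaplectic group -/

namespace Mp2Z

/-- The non-trivial element `(1, -1)` over the identity. -/
def Z : Mp2Z where
  M := 1
  φ := fun _ => -1
  holo := mdifferentiable_const
  sq := fun τ => by simp

theorem eq_one_or_eq_Z {g : Mp2Z} (h : g.M = 1) : g = 1 ∨ g = Z := by
  have hc : Continuous g.φ := g.holo.continuous
  have hsq : Set.EqOn (g.φ ^ 2) 1 Set.univ := fun τ _ => by
    rw [Pi.pow_apply, g.sq, h]; simp
  rcases isPreconnected_univ.eq_one_or_eq_neg_one_of_sq_eq hc.continuousOn hsq with h1 | h1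
  · left; ext τ
    · rw [h]; rfl
    · exact h1 (Set.mem_univ τ)
  · right; ext τ
    · rw [h]; rfl
    · exact h1 (Set.mem_univ τ)

theorem Z_mul_Z : Z * Z = 1 := by
  ext τ
  · simp [mul_M, Z, one_M]
  · simp [mul_φ, Z, one_φ]

theorem S_pow_four : S ^ 4 = Z := by
  have hM : (S ^ 4).M = 1 := by
    change ((1 * ModularGroup.S * ModularGroup.S * ModularGroup.S) * ModularGroup.S) = 1
    decide
  refine (eq_one_or_eq_Z hM).resolve_left fun h => ?_
  have hI : ModularGroup.S • UpperHalfPlane.I = UpperHalfPlane.I := by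
    ext
    rw [UpperHalfPlane.modular_S_smul]
    simp
  have h2 : (Complex.I : ℂ) ^ (1 / 2 : ℂ) * Complex.I ^ (1 / 2 : ℂ) = Complex.I := by
    rw [← Complex.cpow_add _ _ Complex.I_ne_zero]; norm_num
  have h1 := congrFun (congrArg Mp2Z.φ h) UpperHalfPlane.I
  rw [one_φ, pow_succ, pow_succ, pow_succ, pow_one, mul_φ, mul_φ, mul_φ] at h1
  change S.φ (ModularGroup.S • ModularGroup.S • ModularGroup.S • UpperHalfPlane.I) *
    S.φ (ModularGroup.S • ModularGroup.S • UpperHalfPlane.I) *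
    S.φ (ModularGroup.S • UpperHalfPlane.I) * S.φ UpperHalfPlane.I = 1 at h1
  rw [hI, hI, hI] at h1
  have h3 : S.φ UpperHalfPlane.I = Complex.I ^ (1 / 2 : ℂ) := rfl
  rw [h3, mul_assoc, h2, Complex.I_mul_I] at h1
  norm_num at h1

/-- A submonoid of `Mp₂(ℤ)` containing `S` and `T` is everything. -/
theorem mem_of_generators {G : Submonoid Mp2Z} (hS : S ∈ G) (hT : T ∈ G) (g : Mp2Z) : g ∈ G := by
  have hZ : Z ∈ G := S_pow_four ▸ G.pow_mem hS 4
  have h1 : ∀ g : Mp2Z, g.M = 1 → g ∈ G ∧ g⁻¹ ∈ G := fun g hg => by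
    rcases eq_one_or_eq_Z hg with rfl | rfl
    · rw [inv_one]; exact ⟨G.one_mem, G.one_mem⟩
    · rw [inv_eq_of_mul_eq_one_right Z_mul_Z]; exact ⟨hZ, hZ⟩
  have hS' : S⁻¹ ∈ G := by
    have : S⁻¹ = S ^ 7 := by
      refine inv_eq_of_mul_eq_one_right ?_
      rw [← pow_succ', show 7 + 1 = 4 + 4 from rfl, pow_add, S_pow_four, Z_mul_Z]
    rw [this]; exact G.pow_mem hS 7
  have hT' : T⁻¹ ∈ G := by
    have hM : (S * T * S * T * S * T * (S⁻¹ * S⁻¹)).M = 1 := by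
      change ModularGroup.S * ModularGroup.T * ModularGroup.S * ModularGroup.T * ModularGroup.S *
        ModularGroup.T * (ModularGroup.S⁻¹ * ModularGroup.S⁻¹) = 1
      decide
    have h2 : T⁻¹ = S⁻¹ * S⁻¹ * (S * T * S * T * S * T * (S⁻¹ * S⁻¹))⁻¹ *
        (S * T * S * T * S) := by group
    rw [h2]
    have h3 := (h1 _ hM).2
    exact G.mul_mem (G.mul_mem (G.mul_mem hS' hS') h3)
      (G.mul_mem (G.mul_mem (G.mul_mem (G.mul_mem hS hT) hS) hT) hS)
  have key : ∀ M : SL(2, ℤ), M ∈ Subgroup.closure {ModularGroup.S, ModularGroup.T} →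
      ∃ g : Mp2Z, g ∈ G ∧ g⁻¹ ∈ G ∧ g.M = M := by
    intro M hM
    induction hM using Subgroup.closure_induction with
    | mem x hx =>
      rcases hx with rfl | rfl
      · exact ⟨S, hS, hS', rfl⟩
      · exact ⟨T, hT, hT', rfl⟩
    | one => exact ⟨1, G.one_mem, by rw [inv_one]; exact G.one_mem, rfl⟩
    | mul x y _ _ hx hy =>
      obtain ⟨a, ha, ha', rfl⟩ := hx
      obtain ⟨b, hb, hb', rfl⟩ := hy
      exact ⟨a * b, G.mul_mem ha hb, by rw [mul_inv_rev]; exact G.mul_mem hb' ha', rfl⟩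
    | inv x _ hx =>
      obtain ⟨a, ha, ha', rfl⟩ := hx
      exact ⟨a⁻¹, ha', by rwa [inv_inv], rfl⟩
  obtain ⟨a, ha, -, haM⟩ := key g.M (by rw [SpecialLinearGroup.SL2Z_generators]; trivial)
  have h4 := (h1 (g * a⁻¹) (by rw [mul_M, inv_M, haM, mul_inv_cancel])).1
  have h5 := G.mul_mem h4 ha
  rwa [inv_mul_cancel_right] at h5

end Mp2Z

theorem exists_isWeilOperator {A : Type} [AddCommGroup A] (q : A → UnitAddCircle) (bp bm : ℕ)
    (g : Mp2Z) : ∃ B, IsWeilOperator q bp bm g B := by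
  let G : Submonoid Mp2Z :=
    { carrier := {g | ∃ B, IsWeilOperator q bp bm g B}
      one_mem' := ⟨1, .one⟩
      mul_mem' := fun ⟨_, h⟩ ⟨_, h'⟩ => ⟨_, .mul h h'⟩ }
  exact Mp2Z.mem_of_generators (G := G) ⟨_, .gen_S⟩ ⟨_, .gen_T⟩ g

/-! ### Hilbert symbols at the ramified primes -/

section Hilbert

variable {p : ℕ} [hp : Fact p.Prime]

theorem hilbertSym_eq_one {F : Type} [Field F] {a b : F} {x y z : F}
    (h0 : (x, y, z) ≠ (0, 0, 0)) (h : z ^ 2 = a * x ^ 2 + b * y ^ 2) : hilbertSym a b = 1 :=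
  if_pos ⟨x, y, z, h0, h⟩

/-- A solution over `ℚ_p` can be scaled to a primitive one over `ℤ_p`. -/
theorem exists_primitive_solution {a b : ℤ_[p]} {x y z : ℚ_[p]} (h0 : (x, y, z) ≠ (0, 0, 0))
    (h : z ^ 2 = a * x ^ 2 + b * y ^ 2) :
    ∃ x y z : ℤ_[p], ¬ ((p : ℤ_[p]) ∣ x ∧ (p : ℤ_[p]) ∣ y ∧ (p : ℤ_[p]) ∣ z) ∧
      z ^ 2 = a * x ^ 2 + b * y ^ 2 := by
  obtain ⟨t, ht, ht0, hx, hy, hz⟩ : ∃ t : ℚ_[p], (t = x ∨ t = y ∨ t = z) ∧ t ≠ 0 ∧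
      ‖x‖ ≤ ‖t‖ ∧ ‖y‖ ≤ ‖t‖ ∧ ‖z‖ ≤ ‖t‖ := by
    have hne : ∀ t : ℚ_[p], ‖x‖ ≤ ‖t‖ → ‖y‖ ≤ ‖t‖ → ‖z‖ ≤ ‖t‖ → t ≠ 0 := by
      rintro t hx hy hz rfl
      rw [norm_zero, norm_le_zero_iff] at hx hy hz
      exact h0 (by rw [hx, hy, hz])
    rcases le_total ‖x‖ ‖y‖ with h1 | h1
    · rcases le_total ‖y‖ ‖z‖ with h2 | h2
      · exact ⟨z, by simp, hne z (h1.trans h2) h2 le_rfl, h1.trans h2, h2, le_rfl⟩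
      · exact ⟨y, by simp, hne y h1 le_rfl h2, h1, le_rfl, h2⟩
    · rcases le_total ‖x‖ ‖z‖ with h2 | h2
      · exact ⟨z, by simp, hne z h2 (h1.trans h2) le_rfl, h2, h1.trans h2, le_rfl⟩
      · exact ⟨x, by simp, hne x le_rfl h1 h2, le_rfl, h1, h2⟩
  have hle : ∀ u : ℚ_[p], ‖u‖ ≤ ‖t‖ → ‖u / t‖ ≤ 1 := fun u hu => by
    rw [norm_div]; exact div_le_one_of_le₀ hu (norm_nonneg _)
  obtain ⟨x', hx'⟩ : ∃ u : ℤ_[p], (u : ℚ_[p]) = x / t := ⟨⟨_, hle x hx⟩, rfl⟩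
  obtain ⟨y', hy'⟩ : ∃ u : ℤ_[p], (u : ℚ_[p]) = y / t := ⟨⟨_, hle y hy⟩, rfl⟩
  obtain ⟨z', hz'⟩ : ∃ u : ℤ_[p], (u : ℚ_[p]) = z / t := ⟨⟨_, hle z hz⟩, rfl⟩
  refine ⟨x', y', z', ?_, ?_⟩
  · rintro ⟨h1, h2, h3⟩
    rw [← PadicInt.norm_lt_one_iff_dvd, PadicInt.norm_def] at h1 h2 h3
    rw [hx'] at h1
    rw [hy'] at h2
    rw [hz'] at h3
    have h4 : ‖t / t‖ = 1 := by rw [div_self ht0, norm_one]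
    rcases ht with rfl | rfl | rfl <;> linarith
  · apply Subtype.ext
    push_cast
    rw [hx', hy', hz']
    field_simp
    exact h

/-- Hensel's lemma for square roots of `x ≡ 1` modulo `8` in `ℤ₂`, and of `x ≡ y²` modulo `p` with
`y` a unit for odd `p`. -/
theorem exists_sq_of_norm_lt {x y : ℤ_[p]} (h : ‖y ^ 2 - x‖ < ‖2 * y‖ ^ 2) :
    ∃ z : ℤ_[p], z ^ 2 = x := by
  have e1 : (Polynomial.X ^ 2 - Polynomial.C x).aeval y = y ^ 2 - x := by simp
  have e2 : (Polynomial.derivative (Polynomial.X ^ 2 - Polynomial.C x)).aeval y = 2 * y := by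
    simp only [Polynomial.derivative_sub, Polynomial.derivative_X_pow, Polynomial.derivative_C]
    simp [Polynomial.aeval_def]
  obtain ⟨z, hz, -⟩ := hensels_lemma (p := p) (F := Polynomial.X ^ 2 - Polynomial.C x) (a := y)
    (by rw [e1, e2]; exact h)
  refine ⟨z, ?_⟩
  simpa [sub_eq_zero] using hz

theorem dvd_intCast_iff {a : ℤ} : (p : ℤ_[p]) ∣ (a : ℤ_[p]) ↔ (p : ℤ) ∣ a := by
  rw [← PadicInt.norm_lt_one_iff_dvd, PadicInt.norm_int_lt_one_iff_dvd]

theorem toZMod_eq_zero_iff {x : ℤ_[p]} : PadicInt.toZMod x = 0 ↔ (p : ℤ_[p]) ∣ x := by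
  rw [← RingHom.mem_ker, PadicInt.ker_toZMod, PadicInt.maximalIdeal_eq_span_p,
    Ideal.mem_span_singleton]

namespace IsFundamentalDiscriminant

variable {D : ℤ} (hD : IsFundamentalDiscriminant D)
include hD

theorem hilbertSym_odd (h2 : p ≠ 2) (hpD : (p : ℤ) ∣ D) {x : ℤ_[p]} {a : ℤ}
    (ha : ¬ (p : ℤ) ∣ a) (hx : (D : ℤ_[p]) ∣ x - a) :
    hilbertSym (x : ℚ_[p]) (D : ℚ_[p]) = localChar D p (a : ZMod D.natAbs) := by
  have hprime : Prime (p : ℤ_[p]) := PadicInt.prime_p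
  have hpx : (p : ℤ_[p]) ∣ x - a := ((dvd_intCast_iff (p := p)).2 hpD).trans hx
  have hxa : PadicInt.toZMod x = (a : ZMod p) := by
    have := toZMod_eq_zero_iff.2 hpx
    rwa [map_sub, map_intCast, sub_eq_zero] at this
  have ha0 : (a : ZMod p) ≠ 0 := by rwa [Ne, ZMod.intCast_zmod_eq_zero_iff_dvd]
  rw [localChar_odd h2 hpD]
  rcases legendreSym.eq_one_or_neg_one p ha0 with h | h
  · rw [h]
    rw [legendreSym.eq_one_iff p ha0] at h
    obtain ⟨s, hs⟩ := h
    obtain ⟨m, rfl⟩ := ZMod.intCast_surjective s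
    have hm : ¬ (p : ℤ) ∣ m := by
      rw [← ZMod.intCast_zmod_eq_zero_iff_dvd]
      intro h0; rw [h0] at hs; exact ha0 (by rw [hs, zero_mul])
    have hnorm : ∀ k : ℤ, ¬ (p : ℤ) ∣ k → ‖(k : ℤ_[p])‖ = 1 := fun k hk =>
      le_antisymm (PadicInt.norm_le_one _) (not_lt.1 fun h' =>
        hk ((PadicInt.norm_int_lt_one_iff_dvd k).1 h'))
    have h2m : ¬ (p : ℤ) ∣ 2 * m := by
      intro h'
      rcases (Nat.prime_iff_prime_int.1 hp.1).dvd_or_dvd h' with h3 | h3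
      · exact h2 ((Nat.prime_dvd_prime_iff_eq hp.1 Nat.prime_two).1 (by exact_mod_cast h3))
      · exact hm h3
    obtain ⟨z, hz⟩ := exists_sq_of_norm_lt (x := x) (y := (m : ℤ_[p])) (by
      have h3 : ‖2 * (m : ℤ_[p])‖ = 1 := by
        have := hnorm _ h2m
        push_cast at this
        exact this
      rw [h3, one_pow, PadicInt.norm_lt_one_iff_dvd, ← toZMod_eq_zero_iff, map_sub, map_pow,
        map_intCast, hxa, hs]
      ring)
    refine hilbertSym_eq_one (x := 1) (y := 0) (z := (z : ℚ_[p])) (by simp) ?_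
    rw [← hz]; push_cast; ring
  · rw [h]
    refine if_neg ?_
    rintro ⟨u, v, z, h0, heq⟩
    obtain ⟨u, v, z, h0, heq⟩ := exists_primitive_solution (a := x) (b := (D : ℤ_[p])) h0
      (by simpa using heq)
    have h3 := congrArg (PadicInt.toZMod (p := p)) heq
    have hD0 : ((D : ℤ) : ZMod p) = 0 := (ZMod.intCast_zmod_eq_zero_iff_dvd D p).2 hpD
    rw [map_add, map_mul, map_mul, map_pow, map_pow, map_pow, map_intCast, hD0, zero_mul, add_zero,
      hxa] at h3
    have hu : PadicInt.toZMod u = 0 := by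
      by_contra hu
      rw [legendreSym.eq_neg_one_iff] at h
      refine h ⟨PadicInt.toZMod z / PadicInt.toZMod u, ?_⟩
      field_simp
      linear_combination -h3
    have hz : PadicInt.toZMod z = 0 := by
      rw [hu] at h3
      exact (pow_eq_zero_iff two_ne_zero).1 (by rw [h3]; ring)
    rw [toZMod_eq_zero_iff] at hu hz
    refine h0 ⟨hu, ?_, hz⟩
    obtain ⟨k, hk⟩ := hpD
    have hpk : ¬ (p : ℤ_[p]) ∣ (k : ℤ_[p]) := by
      rw [dvd_intCast_iff]
      rintro ⟨j, rfl⟩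
      exact hD.not_sq_dvd hp.1 h2 ⟨j, by rw [hk, mul_assoc]⟩
    obtain ⟨u, rfl⟩ := hu
    obtain ⟨z, rfl⟩ := hz
    have h4 : (k : ℤ_[p]) * v ^ 2 = p * (z ^ 2 - x * u ^ 2) := by
      refine mul_left_cancel₀ hprime.ne_zero ?_
      have : (D : ℤ_[p]) = p * k := by rw [hk]; push_cast; rfl
      rw [this] at heq
      linear_combination -heq
    exact hprime.dvd_of_dvd_pow ((hprime.dvd_or_dvd ⟨_, h4⟩).resolve_left hpk)

end IsFundamentalDiscriminant

/-! The Hilbert symbol over `ℚ₂` against `D = 4 e` is decided modulo `8`: a solution of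
`x + e w² ≡ 1` lifts by Hensel's lemma, and if every solution of `z² ≡ x u² + e w²` has even entries
then there is no primitive solution. -/

section TwoAdic

variable {x : ℤ_[2]} {b e : ℤ}

theorem hilbertSym_two_eq_one (hb : (8 : ℤ_[2]) ∣ x - b) (w : ℤ) (h : (8 : ℤ) ∣ b + e * w ^ 2 - 1) :
    hilbertSym (x : ℚ_[2]) (((4 * e : ℤ)) : ℚ_[2]) = 1 := by
  obtain ⟨k, hk⟩ := hb
  obtain ⟨l, hl⟩ := h
  have hl' : (b : ℤ_[2]) + e * w ^ 2 - 1 = 8 * l := by exact_mod_cast congrArg (Int.cast : ℤ → ℤ_[2]) hl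
  have h2 : ‖(2 : ℤ_[2])‖ < 1 := by
    have := PadicInt.norm_int_lt_one_iff_dvd (p := 2) 2
    push_cast at this
    exact this.2 (by norm_num)
  have h20 : 0 < ‖(2 : ℤ_[2])‖ := norm_pos_iff.2 two_ne_zero
  obtain ⟨z, hz⟩ := exists_sq_of_norm_lt (p := 2) (x := x + (e : ℤ_[2]) * (w : ℤ_[2]) ^ 2)
      (y := 1) (by
    have e1 : (1 : ℤ_[2]) ^ 2 - (x + e * w ^ 2) = 2 ^ 3 * (-(k + l)) := by
      linear_combination -hk - hl'
    rw [e1, mul_one, norm_mul, norm_pow]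
    calc ‖(2 : ℤ_[2])‖ ^ 3 * ‖-(k + (l : ℤ_[2]))‖ ≤ ‖(2 : ℤ_[2])‖ ^ 3 * 1 := by
          gcongr; exact PadicInt.norm_le_one _
      _ < ‖(2 : ℤ_[2])‖ ^ 2 := by
          rw [mul_one]; exact pow_lt_pow_right_of_lt_one₀ h20 h2 (by norm_num))
  refine hilbertSym_eq_one (x := 1) (y := (w : ℚ_[2]) / 2) (z := (z : ℚ_[2])) (by simp) ?_
  have := congrArg (fun t : ℤ_[2] => (t : ℚ_[2])) hz
  push_cast at this ⊢
  rw [this]; ring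

theorem hilbertSym_two_eq_neg_one (hb : (8 : ℤ_[2]) ∣ x - b)
    (h : ∀ u w z : ZMod 8, z ^ 2 = b * u ^ 2 + e * w ^ 2 → 4 * u = 0 ∧ 4 * w = 0 ∧ 4 * z = 0) :
    hilbertSym (x : ℚ_[2]) (((4 * e : ℤ)) : ℚ_[2]) = -1 := by
  refine if_neg ?_
  rintro ⟨u, v, z, h0, heq⟩
  obtain ⟨u, w, z, h0, heq⟩ := exists_primitive_solution (p := 2) (a := x) (b := (e : ℤ_[2]))
    (x := u) (y := 2 * v) (z := z) (by simpa using h0) (by push_cast at heq ⊢; rw [heq]; ring)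
  have hker : ∀ t : ℤ_[2], PadicInt.toZModPow 3 t = 0 ↔ (8 : ℤ_[2]) ∣ t := fun t => by
    rw [← RingHom.mem_ker, PadicInt.ker_toZModPow, Ideal.mem_span_singleton]
    norm_num
  have hx : PadicInt.toZModPow (p := 2) 3 x = ((b : ℤ) : ZMod (2 ^ 3)) := by
    have := (hker _).2 hb
    rwa [map_sub, map_intCast, sub_eq_zero] at this
  have h3 := congrArg (PadicInt.toZModPow (p := 2) 3) heq
  rw [map_add, map_mul, map_mul, map_pow, map_pow, map_pow, map_intCast, hx] at h3
  obtain ⟨h4, h5, h6⟩ := h _ _ _ h3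
  have hdvd : ∀ t : ℤ_[2], (4 : ZMod 8) * PadicInt.toZModPow (p := 2) 3 t = 0 →
      ((2 : ℕ) : ℤ_[2]) ∣ t := fun t ht => by
    have h7 : PadicInt.toZModPow (p := 2) 3 (4 * t) = 0 := by
      rw [map_mul, map_ofNat]; exact ht
    obtain ⟨k, hk⟩ := (hker _).1 h7
    exact ⟨k, mul_left_cancel₀ (OfNat.ofNat_ne_zero 4 : (4 : ℤ_[2]) ≠ 0) (by rw [hk]; push_cast; ring)⟩
  exact h0 ⟨hdvd u h4, hdvd w h5, hdvd z h6⟩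

end TwoAdic

namespace IsFundamentalDiscriminant

variable {D : ℤ} (hD : IsFundamentalDiscriminant D)
include hD

theorem hilbertSym_two (hpD : (2 : ℤ) ∣ D) {x : ℤ_[2]} {a : ℤ} (ha : ¬ (2 : ℤ) ∣ a)
    (hx : (D : ℤ_[2]) ∣ x - a) :
    hilbertSym (x : ℚ_[2]) (D : ℚ_[2]) = localChar D 2 (a : ZMod D.natAbs) := by
  obtain ⟨b, hb⟩ : ∃ b : ℤ, (8 : ℤ_[2]) ∣ x - b := by
    refine ⟨x.appr 3, ?_⟩
    have := PadicInt.appr_spec 3 x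
    rw [Ideal.mem_span_singleton] at this
    norm_num at this ⊢
    exact this
  have hdvd : ∀ (n : ℕ) (k : ℤ), ((2 : ℕ) : ℤ_[2]) ^ n ∣ (k : ℤ_[2]) → (2 : ℤ) ^ n ∣ k := by
    intro n k h
    have := (PadicInt.norm_int_le_pow_iff_dvd (p := 2)).1
      ((PadicInt.norm_le_pow_iff_mem_span_pow (k : ℤ_[2]) n).2 (Ideal.mem_span_singleton.2 h))
    exact_mod_cast this
  have hval : ∀ k : ℤ, ((k : ℤ) : ZMod 8) = ((k % 8 : ℤ) : ZMod 8) := fun k => by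
    rw [ZMod.intCast_eq_intCast_iff]; exact (Int.mod_modEq k 8).symm
  have hab : ∀ n : ℕ, n ≤ 3 → (2 : ℤ) ^ n ∣ D → (2 : ℤ) ^ n ∣ a - b := fun n hn hd => by
    refine hdvd n _ ?_
    have h1 : ((2 : ℕ) : ℤ_[2]) ^ n ∣ x - a := by
      refine Dvd.dvd.trans ?_ hx
      exact_mod_cast Int.cast_dvd_cast (α := ℤ_[2]) _ _ hd
    have h2 : ((2 : ℕ) : ℤ_[2]) ^ n ∣ x - b := by
      refine Dvd.dvd.trans ?_ hb
      have := pow_dvd_pow ((2 : ℕ) : ℤ_[2]) hn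
      norm_num at this ⊢
      exact this
    have := dvd_sub h2 h1
    rwa [sub_sub_sub_cancel_left, ← Int.cast_sub] at this
  rcases hD.two_dvd_cases hpD with ⟨h', h''⟩ | h' | h'
  · obtain ⟨e, rfl⟩ : ∃ e, D = 4 * e := ⟨D / 4, by omega⟩
    have h4 := hab 2 (by norm_num) (by norm_num)
    norm_num at h4
    rw [localChar_two_four h', ZMod.χ₄_int_eq_if_mod_four, if_neg (by omega)]
    split_ifs with h1
    · rcases (by omega : b % 8 = 1 ∨ b % 8 = 5) with h2 | h2
      · exact hilbertSym_two_eq_one hb 0 (by omega)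
      · exact hilbertSym_two_eq_one hb 2 (by omega)
    · refine hilbertSym_two_eq_neg_one hb ?_
      rw [hval b, hval e]
      rcases (by omega : b % 8 = 3 ∨ b % 8 = 7) with h2 | h2 <;>
      rcases (by omega : e % 8 = 3 ∨ e % 8 = 7) with h3 | h3 <;>
      · rw [h2, h3]; decide
  · obtain ⟨e, rfl⟩ : ∃ e, D = 4 * e := ⟨D / 4, by omega⟩
    have h4 := hab 3 (by norm_num) (by omega)
    norm_num at h4
    rw [localChar_two_eight h', ZMod.χ₈_int_eq_if_mod_eight, if_neg (by omega)]
    split_ifs with h1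
    · rcases h1 with h1 | h1
      · exact hilbertSym_two_eq_one hb 0 (by omega)
      · exact hilbertSym_two_eq_one hb 1 (by omega)
    · refine hilbertSym_two_eq_neg_one hb ?_
      rw [hval b, hval e, (by omega : e % 8 = 2)]
      rcases (by omega : b % 8 = 3 ∨ b % 8 = 5) with h2 | h2 <;>
      · rw [h2]; decide
  · obtain ⟨e, rfl⟩ : ∃ e, D = 4 * e := ⟨D / 4, by omega⟩
    have h4 := hab 3 (by norm_num) (by omega)
    norm_num at h4
    rw [localChar_two_eight' h', ZMod.χ₈'_int_eq_if_mod_eight, if_neg (by omega)]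
    split_ifs with h1
    · rcases h1 with h1 | h1
      · exact hilbertSym_two_eq_one hb 0 (by omega)
      · exact hilbertSym_two_eq_one hb 1 (by omega)
    · refine hilbertSym_two_eq_neg_one hb ?_
      rw [hval b, hval e, (by omega : e % 8 = 6)]
      rcases (by omega : b % 8 = 5 ∨ b % 8 = 7) with h2 | h2 <;>
      · rw [h2]; decide

/-- At a ramified prime the Hilbert symbol `(x, D)_p` of a `p`-adic unit `x` is the value at `x` of
the local component of the quadratic character modulo `|D|`. -/
theorem hilbertSym_eq_localChar (hpD : (p : ℤ) ∣ D) {x : ℤ_[p]} {a : ℤ}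
    (ha : ¬ (p : ℤ) ∣ a) (hx : (D : ℤ_[p]) ∣ x - a) :
    hilbertSym (x : ℚ_[p]) (D : ℚ_[p]) = localChar D p (a : ZMod D.natAbs) := by
  by_cases h2 : p = 2
  · subst h2
    exact hD.hilbertSym_two hpD ha hx
  · exact hD.hilbertSym_odd h2 hpD ha hx

end IsFundamentalDiscriminant

end Hilbert

/-! ### Strong approximation for the additive group -/

section Approximation

/-- A rational number that is integral at all primes is an integer. -/
theorem exists_int_of_norm_le_one {x : ℚ} (h : ∀ p : Nat.Primes, ‖(x : ℚ_[p.1])‖ ≤ 1) :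
    ∃ n : ℤ, (n : ℚ) = x := by
  refine ⟨x.num, Rat.coe_int_num_of_den_eq_one ?_⟩
  by_contra hd
  obtain ⟨p, hp, hpd⟩ := Nat.exists_prime_and_dvd hd
  have := Fact.mk hp
  have h1 : ‖(x : ℚ_[p])‖ ≤ 1 := h ⟨p, hp⟩
  rw [Padic.norm_rat_le_one_iff_padicValuation_le_one, Rat.padicValuation_le_one_iff] at h1
  exact h1 hpd

theorem norm_natCast_prime {p q : Nat.Primes} (h : q ≠ p) : ‖((p.1 : ℕ) : ℚ_[q.1])‖ = 1 := by
  rw [Padic.norm_natCast_eq_one_iff]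
  exact (Nat.coprime_primes q.2 p.2).2 fun h' => h (Subtype.ext h')

/-- A `p`-adic number agrees up to a `p`-adic integer with a rational number that is integral away
from `p`. -/
theorem exists_principal_part (p : Nat.Primes) (u : ℚ_[p.1]) :
    ∃ r : ℚ, ‖u - r‖ ≤ 1 ∧ ∀ q : Nat.Primes, q ≠ p → ‖(r : ℚ_[q.1])‖ ≤ 1 := by
  have hp0 : ((p.1 : ℕ) : ℚ_[p.1]) ≠ 0 := Nat.cast_ne_zero.2 p.2.ne_zero
  obtain ⟨j, hj⟩ : ∃ j : ℕ, ‖((p.1 : ℕ) : ℚ_[p.1]) ^ j * u‖ ≤ 1 := by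
    obtain ⟨j, hj⟩ := pow_unbounded_of_one_lt ‖u‖ (Nat.one_lt_cast.2 p.2.one_lt : (1 : ℝ) < p.1)
    refine ⟨j, ?_⟩
    rw [norm_mul, norm_pow, Padic.norm_p, inv_pow]
    exact inv_mul_le_one_of_le₀ hj.le (by positivity)
  obtain ⟨w, hw⟩ : ∃ w : ℤ_[p.1], (w : ℚ_[p.1]) = ((p.1 : ℕ) : ℚ_[p.1]) ^ j * u := ⟨⟨_, hj⟩, rfl⟩
  obtain ⟨k, hk⟩ := Ideal.mem_span_singleton.1 (PadicInt.appr_spec j w)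
  refine ⟨(w.appr j : ℚ) / (p.1 : ℚ) ^ j, ?_, fun q hq => ?_⟩
  · have h1 : u - (((w.appr j : ℚ) / (p.1 : ℚ) ^ j : ℚ) : ℚ_[p.1]) = (k : ℚ_[p.1]) := by
      have := congrArg (fun t : ℤ_[p.1] => (t : ℚ_[p.1])) hk
      push_cast at this ⊢
      rw [hw] at this
      field_simp
      linear_combination this
    rw [h1]; exact k.2
  · push_cast
    rw [norm_div, norm_pow, norm_natCast_prime hq, one_pow, div_one]
    exact_mod_cast Padic.norm_int_le_one (p := q.1) (w.appr j : ℤ)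

theorem isUnit_natCast_padicInt (p : Nat.Primes) {m : ℕ} (h : ¬ p.1 ∣ m) :
    IsUnit (m : ℤ_[p.1]) := by
  rw [PadicInt.isUnit_iff, PadicInt.norm_natCast_eq_one_iff]
  exact (p.2.coprime_iff_not_dvd).2 h

theorem natCast_dvd_prime_pow (p : Nat.Primes) {m : ℕ} (hm : m ≠ 0) :
    (m : ℤ_[p.1]) ∣ ((p.1 : ℕ) : ℤ_[p.1]) ^ m := by
  obtain ⟨e, n, hn, h⟩ := Nat.exists_eq_pow_mul_and_not_dvd hm p.1 p.2.ne_one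
  have he : e ≤ m := by
    refine (Nat.lt_pow_self p.2.one_lt).le.trans (Nat.le_of_dvd (Nat.pos_of_ne_zero hm) ?_)
    exact ⟨n, h⟩
  have h1 : (m : ℤ_[p.1]) = ((p.1 : ℕ) : ℤ_[p.1]) ^ e * n := by exact_mod_cast congrArg (Nat.cast : ℕ → ℤ_[p.1]) h
  rw [h1, (isUnit_natCast_padicInt p hn).mul_right_dvd]
  exact pow_dvd_pow _ he

/-- Strong approximation for the additive group over `ℚ`: prescribed congruences at finitely many
primes, integrality at the others. -/
theorem exists_rat_approx (T : Finset Nat.Primes) (u : ∀ p : Nat.Primes, ℚ_[p.1]) {m : ℕ}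
    (hm : m ≠ 0) : ∃ x : ℚ, (∀ p ∈ T, ∃ z : ℤ_[p.1], (x : ℚ_[p.1]) - u p = (m : ℚ_[p.1]) * z) ∧
      ∀ p ∉ T, ‖(x : ℚ_[p.1])‖ ≤ 1 := by
  choose r hr hr' using fun p => exists_principal_part p (u p)
  have hsum : ∀ (q : Nat.Primes) (s : Finset Nat.Primes), (∀ p ∈ s, p ≠ q) →
      ‖((∑ p ∈ s, r p : ℚ) : ℚ_[q.1])‖ ≤ 1 := fun q s hs => by
    rw [Rat.cast_sum]
    exact IsUltrametricDist.norm_sum_le_of_forall_le_of_nonneg zero_le_one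
      fun p hp => hr' p q (hs p hp).symm
  have hint : ∀ p ∈ T, ‖u p - ((∑ q ∈ T, r q : ℚ) : ℚ_[p.1])‖ ≤ 1 := fun p hp => by
    have e : u p - ((∑ q ∈ T, r q : ℚ) : ℚ_[p.1]) =
        (u p - r p) - ((∑ q ∈ T.erase p, r q : ℚ) : ℚ_[p.1]) := by
      rw [← Finset.add_sum_erase _ _ hp]; push_cast; ring
    rw [e, sub_eq_add_neg]
    refine (IsUltrametricDist.norm_add_le_max _ _).trans (max_le (hr p) ?_)
    rw [norm_neg]
    refine hsum p _ ?_
    exact fun q hq => Finset.ne_of_mem_erase hq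
  have hw : ∀ p : Nat.Primes, ∃ w : ℤ_[p.1], p ∈ T →
      (w : ℚ_[p.1]) = u p - ((∑ q ∈ T, r q : ℚ) : ℚ_[p.1]) := fun p => by
    by_cases hp : p ∈ T
    · exact ⟨⟨_, hint p hp⟩, fun _ => rfl⟩
    · exact ⟨0, fun h => absurd h hp⟩
  choose w hw using hw
  obtain ⟨n, hn⟩ := Nat.chineseRemainderOfFinset (fun p : Nat.Primes => (w p).appr m)
    (fun p => p.1 ^ m) T (fun p _ => pow_ne_zero _ p.2.ne_zero)
    (fun p _ q _ hpq => Nat.Coprime.pow _ _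
      ((Nat.coprime_primes p.2 q.2).2 fun h => hpq (Subtype.ext h)))
  refine ⟨∑ q ∈ T, r q + n, fun p hp => ?_, fun p hp => ?_⟩
  · obtain ⟨k, hk⟩ := Ideal.mem_span_singleton.1 (PadicInt.appr_spec m (w p))
    obtain ⟨l, hl⟩ := (Nat.modEq_iff_dvd.1 (hn p hp))
    obtain ⟨c, hc⟩ := natCast_dvd_prime_pow p hm
    refine ⟨c * (-k - l), ?_⟩
    have h1 := congrArg (fun t : ℤ_[p.1] => (t : ℚ_[p.1])) hk
    have h2 := congrArg (fun t : ℤ => (t : ℚ_[p.1])) hl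
    have h3 := congrArg (fun t : ℤ_[p.1] => (t : ℚ_[p.1])) hc
    push_cast at h1 h2 h3 ⊢
    have h4 := hw p hp
    push_cast at h4
    linear_combination -h1 - h2 + h4 - (k + l) * h3
  · push_cast
    refine (IsUltrametricDist.norm_add_le_max _ _).trans (max_le ?_ ?_)
    · have := hsum p T fun q hq h => hp (h ▸ hq)
      exact_mod_cast this
    · exact_mod_cast Padic.norm_int_le_one (p := p.1) (n : ℤ)

end Approximation

/-! ### Localization of the lattices -/

section Localization

/-- `D L_R`, for the lattice `L_R` over a ring `R`. -/
def modLattice (D : ℤ) (R F : Type) [CommRing R] [Field F] [Algebra R F] : Submodule R (V D F) :=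
  (lattice D R F).map (LinearMap.lsmul R (V D F) (D : R))

theorem mem_modLattice_iff {D : ℤ} {R F : Type} [CommRing R] [Field F] [Algebra R F] {X : V D F} :
    X ∈ modLattice D R F ↔ ∃ z, latVec D R F ((D : R) • z) = X := by
  rw [modLattice, Submodule.mem_map]
  constructor
  · rintro ⟨Y, hY, rfl⟩
    obtain ⟨z, rfl⟩ := mem_lattice_iff.1 hY
    exact ⟨z, by rw [map_smul]; rfl⟩
  · rintro ⟨z, rfl⟩
    exact ⟨_, mem_lattice_iff.2 ⟨z, rfl⟩, by rw [map_smul]; rfl⟩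

theorem modLattice_le_lattice {D : ℤ} {R F : Type} [CommRing R] [Field F] [Algebra R F] :
    modLattice D R F ≤ lattice D R F := fun X hX => by
  obtain ⟨z, rfl⟩ := mem_modLattice_iff.1 hX
  exact mem_lattice_iff.2 ⟨_, rfl⟩

/-- A map applied to all four coordinates. -/
def coordMap {R S : Type} (f : R → S) (x : R × R × R × R) : S × S × S × S :=
  (f x.1, f x.2.1, f x.2.2.1, f x.2.2.2)

variable {D : ℤ} {F : Type} [Field F]

theorem latVec_coordMap {R : Type} [CommRing R] [Algebra R F] (x : R × R × R × R) :
    latVec D F F (coordMap (algebraMap R F) x) = latVec D R F x := rfl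

theorem dualVec_coordMap {R : Type} [CommRing R] [Algebra R F] (x : R × R × R × R) :
    dualVec D F F (coordMap (algebraMap R F) x) = dualVec D R F x := rfl

theorem baseChange_latVec [Algebra ℚ F] (x : ℚ × ℚ × ℚ × ℚ) :
    baseChange F (latVec D ℚ ℚ x) = latVec D F F (coordMap (algebraMap ℚ F) x) := by
  simp [baseChange, latVec_apply, coordMap, -eq_ratCast, map_ofNat (algebraMap ℚ F)]

theorem baseChange_dualVec [Algebra ℚ F] (x : ℚ × ℚ × ℚ × ℚ) :
    baseChange F (dualVec D ℚ ℚ x) = dualVec D F F (coordMap (algebraMap ℚ F) x) := by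
  simp [baseChange, dualVec_apply, coordMap, -eq_ratCast, map_ofNat (algebraMap ℚ F)]

variable [CharZero F]

theorem latVec_surjective : Function.Surjective (latVec D F F) := fun X => by
  refine ⟨(X.1, X.2.1.re - 2 * X.2.1.im * (D / 2), 2 * X.2.1.im, X.2.2), ?_⟩
  ext <;> simp [latVec_apply]

theorem dualVec_surjective (hD : (D : F) ≠ 0) : Function.Surjective (dualVec D F F) := fun X => by
  refine ⟨(X.1, D * X.2.1.im - 2 * X.2.1.re * (D / 2), 2 * X.2.1.re, X.2.2), ?_⟩
  ext <;> simp [dualVec_apply, hD]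

section Padic

variable {p : ℕ} [Fact p.Prime]

theorem latVec_mem_lattice_padic {x : ℚ_[p] × ℚ_[p] × ℚ_[p] × ℚ_[p]} :
    latVec D ℚ_[p] ℚ_[p] x ∈ lattice D ℤ_[p] ℚ_[p] ↔
      ‖x.1‖ ≤ 1 ∧ ‖x.2.1‖ ≤ 1 ∧ ‖x.2.2.1‖ ≤ 1 ∧ ‖x.2.2.2‖ ≤ 1 := by
  rw [mem_lattice_iff]
  constructor
  · rintro ⟨z, hz⟩
    rw [← latVec_coordMap] at hz
    rw [← latVec_injective (R := ℚ_[p]) Function.injective_id hz]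
    exact ⟨z.1.2, z.2.1.2, z.2.2.1.2, z.2.2.2.2⟩
  · rintro ⟨h1, h2, h3, h4⟩
    exact ⟨(⟨_, h1⟩, ⟨_, h2⟩, ⟨_, h3⟩, ⟨_, h4⟩), rfl⟩

theorem dualVec_mem_dualLattice_padic (hD : (D : ℚ_[p]) ≠ 0)
    {x : ℚ_[p] × ℚ_[p] × ℚ_[p] × ℚ_[p]} :
    dualVec D ℚ_[p] ℚ_[p] x ∈ dualLattice D ℤ_[p] ℚ_[p] ↔
      ‖x.1‖ ≤ 1 ∧ ‖x.2.1‖ ≤ 1 ∧ ‖x.2.2.1‖ ≤ 1 ∧ ‖x.2.2.2‖ ≤ 1 := by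
  rw [mem_dualLattice_iff hD]
  constructor
  · rintro ⟨z, hz⟩
    rw [← dualVec_coordMap] at hz
    rw [← dualVec_injective (R := ℚ_[p]) hD Function.injective_id hz]
    exact ⟨z.1.2, z.2.1.2, z.2.2.1.2, z.2.2.2.2⟩
  · rintro ⟨h1, h2, h3, h4⟩
    exact ⟨(⟨_, h1⟩, ⟨_, h2⟩, ⟨_, h3⟩, ⟨_, h4⟩), rfl⟩

end Padic

theorem mem_lattice_of_forall_padic {X : V D ℚ}
    (h : ∀ p : Nat.Primes, baseChange ℚ_[p.1] X ∈ lattice D ℤ_[p.1] ℚ_[p.1]) :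
    X ∈ lattice D ℤ ℚ := by
  obtain ⟨x, rfl⟩ := latVec_surjective X
  simp only [baseChange_latVec, latVec_mem_lattice_padic] at h
  obtain ⟨a, ha⟩ := exists_int_of_norm_le_one fun p => (h p).1
  obtain ⟨m, hm⟩ := exists_int_of_norm_le_one fun p => (h p).2.1
  obtain ⟨n, hn⟩ := exists_int_of_norm_le_one fun p => (h p).2.2.1
  obtain ⟨c, hc⟩ := exists_int_of_norm_le_one fun p => (h p).2.2.2
  refine mem_lattice_iff.2 ⟨(a, m, n, c), ?_⟩
  rw [← latVec_coordMap]
  exact congrArg _ (Prod.ext ha (Prod.ext hm (Prod.ext hn hc)))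

theorem mem_dualLattice_of_forall_padic (hD : D ≠ 0) {X : V D ℚ}
    (h : ∀ p : Nat.Primes, baseChange ℚ_[p.1] X ∈ dualLattice D ℤ_[p.1] ℚ_[p.1]) :
    X ∈ dualLattice D ℤ ℚ := by
  obtain ⟨x, rfl⟩ := dualVec_surjective (Int.cast_ne_zero.2 hD) X
  have hD' : ∀ p : Nat.Primes, (D : ℚ_[p.1]) ≠ 0 := fun p => Int.cast_ne_zero.2 hD
  simp only [baseChange_dualVec, dualVec_mem_dualLattice_padic (hD' _)] at h
  obtain ⟨a, ha⟩ := exists_int_of_norm_le_one fun p => (h p).1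
  obtain ⟨m, hm⟩ := exists_int_of_norm_le_one fun p => (h p).2.1
  obtain ⟨n, hn⟩ := exists_int_of_norm_le_one fun p => (h p).2.2.1
  obtain ⟨c, hc⟩ := exists_int_of_norm_le_one fun p => (h p).2.2.2
  refine (mem_dualLattice_iff (Int.cast_ne_zero.2 hD)).2 ⟨(a, m, n, c), ?_⟩
  rw [← dualVec_coordMap]
  exact congrArg _ (Prod.ext ha (Prod.ext hm (Prod.ext hn hc)))

theorem baseChange_mem_lattice (p : Nat.Primes) {X : V D ℚ} (h : X ∈ lattice D ℤ ℚ) :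
    baseChange ℚ_[p.1] X ∈ lattice D ℤ_[p.1] ℚ_[p.1] := by
  obtain ⟨x, rfl⟩ := mem_lattice_iff.1 h
  rw [← latVec_coordMap, baseChange_latVec, latVec_mem_lattice_padic]
  have h : ∀ n : ℤ, ‖algebraMap ℚ ℚ_[p.1] (algebraMap ℤ ℚ n)‖ ≤ 1 := fun n => by
    simpa using Padic.norm_int_le_one (p := p.1) n
  exact ⟨h _, h _, h _, h _⟩

theorem baseChange_mem_dualLattice (hD : D ≠ 0) (p : Nat.Primes) {X : V D ℚ}
    (h : X ∈ dualLattice D ℤ ℚ) :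
    baseChange ℚ_[p.1] X ∈ dualLattice D ℤ_[p.1] ℚ_[p.1] := by
  obtain ⟨x, rfl⟩ := (mem_dualLattice_iff (Int.cast_ne_zero.2 hD)).1 h
  rw [← dualVec_coordMap, baseChange_dualVec,
    dualVec_mem_dualLattice_padic (Int.cast_ne_zero.2 hD)]
  have h : ∀ n : ℤ, ‖algebraMap ℚ ℚ_[p.1] (algebraMap ℤ ℚ n)‖ ≤ 1 := fun n => by
    simpa using Padic.norm_int_le_one (p := p.1) n
  exact ⟨h _, h _, h _, h _⟩

omit [CharZero F] in
theorem mem_modLattice_iff_inv_smul {R : Type} [CommRing R] [Algebra R F] (hD : (D : F) ≠ 0)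
    {X : V D F} :
    X ∈ modLattice D R F ↔ (D : F)⁻¹ • X ∈ lattice D R F := by
  have h : ∀ Y : V D F, (D : R) • Y = (D : F) • Y := fun Y => by
    rw [← algebraMap_smul F (D : R) Y, map_intCast]
  rw [modLattice, Submodule.mem_map]
  constructor
  · rintro ⟨Y, hY, rfl⟩
    rw [LinearMap.lsmul_apply, h, inv_smul_smul₀ hD]
    exact hY
  · intro hX
    exact ⟨_, hX, by rw [LinearMap.lsmul_apply, h, smul_inv_smul₀ hD]⟩

theorem baseChange_smul {F : Type} [Field F] [Algebra ℚ F] (c : ℚ) (X : V D ℚ) :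
    baseChange F (c • X) = algebraMap ℚ F c • baseChange F X := by
  simp only [baseChange]
  ext <;> simp [-eq_ratCast, Algebra.smul_def (A := F)]

theorem mem_rescaledLattice_iff_forall_padic (hD : D ≠ 0) {X : V D ℚ} :
    X ∈ rescaledLattice D ↔
      ∀ p : Nat.Primes, baseChange ℚ_[p.1] X ∈ modLattice D ℤ_[p.1] ℚ_[p.1] := by
  have e : X ∈ rescaledLattice D ↔ (D : ℚ)⁻¹ • X ∈ lattice D ℤ ℚ := by
    rw [← mem_modLattice_iff_inv_smul (Int.cast_ne_zero.2 hD), mem_rescaledLattice_iff,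
      mem_modLattice_iff]
    rfl
  have e' : ∀ p : Nat.Primes, baseChange ℚ_[p.1] X ∈ modLattice D ℤ_[p.1] ℚ_[p.1] ↔
      baseChange ℚ_[p.1] ((D : ℚ)⁻¹ • X) ∈ lattice D ℤ_[p.1] ℚ_[p.1] := fun p => by
    rw [mem_modLattice_iff_inv_smul (Int.cast_ne_zero.2 hD), baseChange_smul, map_inv₀,
      map_intCast]
  simp_rw [e, e']
  exact ⟨fun h p => baseChange_mem_lattice p h, mem_lattice_of_forall_padic⟩

theorem dualLattice_le_modLattice (hD : D % 4 = 0 ∨ D % 4 = 1) (p : Nat.Primes)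
    (hp : ¬ (p.1 : ℤ) ∣ D) :
    dualLattice D ℤ_[p.1] ℚ_[p.1] ≤ modLattice D ℤ_[p.1] ℚ_[p.1] := by
  have hD0 : D ≠ 0 := by rintro rfl; simp at hp
  have hu : IsUnit (D : ℤ_[p.1]) := by
    have := isUnit_natCast_padicInt p (m := D.natAbs) (by rwa [← Int.natCast_dvd])
    rcases Int.natAbs_eq D with h | h
    · rw [h, Int.cast_natCast]; exact this
    · rw [h, Int.cast_neg, Int.cast_natCast]; exact this.neg
  have h2 : (2 : ℤ_[p.1]) ∣ 1 - D := by
    by_cases h : p.1 = 2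
    · obtain ⟨k, hk⟩ : ∃ k, 1 - D = 2 * k := ⟨(1 - D) / 2, by rw [h] at hp; omega⟩
      exact ⟨k, by exact_mod_cast congrArg (Int.cast : ℤ → ℤ_[p.1]) hk⟩
    · have := isUnit_natCast_padicInt p (m := 2)
        fun h' => h ((Nat.prime_dvd_prime_iff_eq p.2 Nat.prime_two).1 h')
      exact this.dvd
  intro X hX
  obtain ⟨x, rfl⟩ := (mem_dualLattice_iff (Int.cast_ne_zero.2 hD0)).1 hX
  obtain ⟨z, hz⟩ := mem_lattice_iff.1 (dualVec_mem_lattice (R := ℤ_[p.1]) (F := ℚ_[p.1]) (x := x)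
    (Int.cast_ne_zero.2 hD0) hu.dvd (h2.mul_left _))
  obtain ⟨u, hu⟩ := hu
  refine mem_modLattice_iff.2 ⟨(↑u⁻¹ : ℤ_[p.1]) • z, ?_⟩
  rw [← hu, smul_smul, Units.mul_inv, one_smul, hz]

end Localization

/-! ### Strong approximation for lattices -/

section LatticeApproximation

variable {D : ℤ}

theorem exists_lattice_approx (T : Finset Nat.Primes) (W : ∀ p : Nat.Primes, V D ℚ_[p.1]) {m : ℕ}
    (hm : m ≠ 0) : ∃ X : V D ℚ,
      (∀ p ∈ T, ∃ Z ∈ lattice D ℤ_[p.1] ℚ_[p.1], baseChange ℚ_[p.1] X = W p + m • Z) ∧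
      ∀ p ∉ T, baseChange ℚ_[p.1] X ∈ lattice D ℤ_[p.1] ℚ_[p.1] := by
  choose w hw using fun p : Nat.Primes => latVec_surjective (F := ℚ_[p.1]) (W p)
  obtain ⟨a, ha, ha'⟩ := exists_rat_approx T (fun p => (w p).1) hm
  obtain ⟨b, hb, hb'⟩ := exists_rat_approx T (fun p => (w p).2.1) hm
  obtain ⟨c, hc, hc'⟩ := exists_rat_approx T (fun p => (w p).2.2.1) hm
  obtain ⟨d, hd, hd'⟩ := exists_rat_approx T (fun p => (w p).2.2.2) hm
  refine ⟨latVec D ℚ ℚ (a, b, c, d), fun p hp => ?_, fun p hp => ?_⟩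
  · obtain ⟨z1, h1⟩ := ha p hp
    obtain ⟨z2, h2⟩ := hb p hp
    obtain ⟨z3, h3⟩ := hc p hp
    obtain ⟨z4, h4⟩ := hd p hp
    refine ⟨latVec D ℤ_[p.1] ℚ_[p.1] (z1, z2, z3, z4), mem_lattice_iff.2 ⟨_, rfl⟩, ?_⟩
    rw [baseChange_latVec, ← hw p, ← map_nsmul, ← latVec_coordMap (R := ℤ_[p.1]), ← map_add]
    refine congrArg _ ?_
    rw [sub_eq_iff_eq_add'] at h1 h2 h3 h4
    refine Prod.ext ?_ (Prod.ext ?_ (Prod.ext ?_ ?_))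
    · simpa [coordMap] using h1
    · simpa [coordMap] using h2
    · simpa [coordMap] using h3
    · simpa [coordMap] using h4
  · rw [baseChange_latVec, latVec_mem_lattice_padic]
    exact ⟨ha' p hp, hb' p hp, hc' p hp, hd' p hp⟩

theorem nsmul_mem_lattice_of_le {p : ℕ} [Fact p.Prime] {Y : V D ℚ_[p]} {i j : ℕ} (hij : i ≤ j)
    (h : (p ^ i) • Y ∈ lattice D ℤ_[p] ℚ_[p]) : (p ^ j) • Y ∈ lattice D ℤ_[p] ℚ_[p] := by
  obtain ⟨k, rfl⟩ := Nat.exists_eq_add_of_le hij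
  rw [pow_add, mul_comm, mul_smul]
  exact nsmul_mem h _

theorem exists_pow_nsmul_mem_lattice (p : Nat.Primes) (Y : V D ℚ_[p.1]) :
    ∃ j : ℕ, (p.1 ^ j) • Y ∈ lattice D ℤ_[p.1] ℚ_[p.1] := by
  have h1 : ∀ u : ℚ_[p.1], ∃ j : ℕ, ‖((p.1 : ℕ) : ℚ_[p.1]) ^ j * u‖ ≤ 1 := fun u => by
    obtain ⟨j, hj⟩ := pow_unbounded_of_one_lt ‖u‖ (Nat.one_lt_cast.2 p.2.one_lt : (1 : ℝ) < p.1)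
    refine ⟨j, ?_⟩
    rw [norm_mul, norm_pow, Padic.norm_p, inv_pow]
    exact inv_mul_le_one_of_le₀ hj.le (by positivity)
  obtain ⟨y, rfl⟩ := latVec_surjective Y
  obtain ⟨i, hi⟩ := h1 y.1
  obtain ⟨j, hj⟩ := h1 y.2.1
  obtain ⟨k, hk⟩ := h1 y.2.2.1
  obtain ⟨l, hl⟩ := h1 y.2.2.2
  have hle : ∀ (u : ℚ_[p.1]) (i n : ℕ), i ≤ n → ‖((p.1 : ℕ) : ℚ_[p.1]) ^ i * u‖ ≤ 1 →
      ‖(p.1 ^ n : ℕ) • u‖ ≤ 1 := by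
    intro u i n hin h
    obtain ⟨k, rfl⟩ := Nat.exists_eq_add_of_le hin
    rw [nsmul_eq_mul, Nat.cast_pow, pow_add, mul_comm (_ ^ i), mul_assoc, norm_mul, norm_pow]
    refine mul_le_one₀ (pow_le_one₀ (norm_nonneg _) ?_) (norm_nonneg _) h
    exact_mod_cast Padic.norm_int_le_one (p := p.1) (p.1 : ℤ)
  refine ⟨i + j + k + l, ?_⟩
  rw [← map_nsmul, latVec_mem_lattice_padic]
  exact ⟨hle _ i _ (by omega) hi, hle _ j _ (by omega) hj, hle _ k _ (by omega) hk,
    hle _ l _ (by omega) hl⟩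

/-- A linear map is bounded on the local lattice. -/
theorem exists_pow_nsmul_map_mem_lattice (p : Nat.Primes)
    (g : V D ℚ_[p.1] →ₗ[ℚ_[p.1]] V D ℚ_[p.1]) :
    ∃ j : ℕ, ∀ Z ∈ lattice D ℤ_[p.1] ℚ_[p.1], (p.1 ^ j) • g Z ∈ lattice D ℤ_[p.1] ℚ_[p.1] := by
  have h2 := exists_pow_nsmul_mem_lattice (D := D) p
  obtain ⟨i, hi⟩ := h2 (g (latVec D ℤ_[p.1] ℚ_[p.1] (1, 0, 0, 0)))
  obtain ⟨j, hj⟩ := h2 (g (latVec D ℤ_[p.1] ℚ_[p.1] (0, 1, 0, 0)))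
  obtain ⟨k, hk⟩ := h2 (g (latVec D ℤ_[p.1] ℚ_[p.1] (0, 0, 1, 0)))
  obtain ⟨l, hl⟩ := h2 (g (latVec D ℤ_[p.1] ℚ_[p.1] (0, 0, 0, 1)))
  refine ⟨i + j + k + l, fun Z hZ => ?_⟩
  obtain ⟨z, rfl⟩ := mem_lattice_iff.1 hZ
  have e : z = z.1 • (1, 0, 0, 0) + z.2.1 • (0, 1, 0, 0) + z.2.2.1 • (0, 0, 1, 0) +
      z.2.2.2 • (0, 0, 0, 1) := by ext <;> simp
  have hg : ∀ (r : ℤ_[p.1]) (Y : V D ℚ_[p.1]), g (r • Y) = r • g Y := fun r Y =>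
    (g.restrictScalars ℤ_[p.1]).map_smul r Y
  rw [e]
  simp only [map_add, map_smul, hg, smul_add]
  refine add_mem (add_mem (add_mem ?_ ?_) ?_) ?_ <;> rw [smul_comm] <;>
    refine Submodule.smul_mem _ _ ?_
  · exact nsmul_mem_lattice_of_le (by omega) hi
  · exact nsmul_mem_lattice_of_le (by omega) hj
  · exact nsmul_mem_lattice_of_le (by omega) hk
  · exact nsmul_mem_lattice_of_le (by omega) hl

variable (h : GAf D)

/-- The primes at which an adelic isometry does not preserve the lattice. -/
theorem finite_notMem_stabLattice : {p : Nat.Primes | h p ∉ stabLattice D p}.Finite :=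
  h.2

theorem comp_mem_lattice {p : Nat.Primes} (hp : h p ∈ stabLattice D p) {Z : V D ℚ_[p.1]} :
    h.comp p Z ∈ lattice D ℤ_[p.1] ℚ_[p.1] ↔ Z ∈ lattice D ℤ_[p.1] ℚ_[p.1] := by
  have e : (h.comp p) '' (lattice D ℤ_[p.1] ℚ_[p.1]) = lattice D ℤ_[p.1] ℚ_[p.1] := hp
  constructor
  · intro hZ
    rw [← SetLike.mem_coe, ← e] at hZ
    obtain ⟨Y, hY, hYZ⟩ := hZ
    rwa [← (h.comp p).injective hYZ]
  · intro hZ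
    rw [← SetLike.mem_coe, ← e]
    exact ⟨Z, hZ, rfl⟩

/-- A common denominator for an adelic isometry and its inverse. -/
theorem exists_nsmul_comp_mem_lattice : ∃ n : ℕ, n ≠ 0 ∧ ∀ p : Nat.Primes,
    ∀ Z ∈ lattice D ℤ_[p.1] ℚ_[p.1], n • h.comp p Z ∈ lattice D ℤ_[p.1] ℚ_[p.1] ∧
      n • (h.comp p).symm Z ∈ lattice D ℤ_[p.1] ℚ_[p.1] := by
  choose i hi using fun p : Nat.Primes => exists_pow_nsmul_map_mem_lattice p
    (h.comp p : V D ℚ_[p.1] →ₗ[ℚ_[p.1]] V D ℚ_[p.1])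
  choose j hj using fun p : Nat.Primes => exists_pow_nsmul_map_mem_lattice p
    ((h.comp p).symm : V D ℚ_[p.1] →ₗ[ℚ_[p.1]] V D ℚ_[p.1])
  set s := (finite_notMem_stabLattice h).toFinset with hs
  refine ⟨∏ p ∈ s, p.1 ^ (i p + j p), Finset.prod_ne_zero_iff.2 fun p _ => pow_ne_zero _ p.2.ne_zero,
    fun p Z hZ => ?_⟩
  by_cases hp : h p ∈ stabLattice D p
  · exact ⟨nsmul_mem ((comp_mem_lattice h hp).2 hZ) _, nsmul_mem ((comp_mem_lattice h hp).1 (by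
      rwa [LinearEquiv.apply_symm_apply])) _⟩
  · have hps : p ∈ s := by rw [hs, Set.Finite.mem_toFinset]; exact hp
    rw [← Finset.mul_prod_erase _ _ hps, pow_add]
    constructor
    · rw [mul_assoc, mul_comm, mul_smul]
      exact nsmul_mem (hi p Z hZ) _
    · rw [mul_comm (p.1 ^ i p), mul_assoc, mul_comm, mul_smul]
      exact nsmul_mem (hj p Z hZ) _

/-- Strong approximation for the lattices `h_p L_p`. -/
theorem exists_translate_approx (T : Finset Nat.Primes) (W : ∀ p : Nat.Primes, V D ℚ_[p.1]) {m : ℕ}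
    (hm : m ≠ 0) : ∃ X : V D ℚ,
      (∀ p ∈ T, ∃ Z ∈ lattice D ℤ_[p.1] ℚ_[p.1],
        (h.comp p).symm (baseChange ℚ_[p.1] X) = W p + m • Z) ∧
      ∀ p ∉ T, (h.comp p).symm (baseChange ℚ_[p.1] X) ∈ lattice D ℤ_[p.1] ℚ_[p.1] := by
  classical
  obtain ⟨n, hn, hn'⟩ := exists_nsmul_comp_mem_lattice h
  set s := (finite_notMem_stabLattice h).toFinset with hs
  set W' : ∀ p : Nat.Primes, V D ℚ_[p.1] := fun p => if p ∈ T then W p else 0 with hW'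
  obtain ⟨X, hX, hX'⟩ := exists_lattice_approx (T ∪ s) (fun p => h.comp p (W' p)) (mul_ne_zero hm hn)
  have key : ∀ p ∈ T ∪ s, ∃ Z ∈ lattice D ℤ_[p.1] ℚ_[p.1],
      (h.comp p).symm (baseChange ℚ_[p.1] X) = W' p + m • Z := fun p hp => by
    obtain ⟨Z, hZ, e⟩ := hX p hp
    refine ⟨_, (hn' p Z hZ).2, ?_⟩
    rw [e, map_add, LinearEquiv.symm_apply_apply, map_nsmul, mul_smul]
  refine ⟨X, fun p hp => ?_, fun p hp => ?_⟩
  · obtain ⟨Z, hZ, e⟩ := key p (Finset.mem_union_left _ hp)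
    exact ⟨Z, hZ, by rw [e, hW']; simp only [if_pos hp]⟩
  · by_cases hps : p ∈ s
    · obtain ⟨Z, hZ, e⟩ := key p (Finset.mem_union_right _ hps)
      rw [e, hW']
      simp only [if_neg hp, zero_add]
      exact nsmul_mem hZ _
    · have hst : h p ∈ stabLattice D p := by
        by_contra hst
        exact hps (by rw [hs, Set.Finite.mem_toFinset]; exact hst)
      refine (comp_mem_lattice h hst).1 ?_
      rw [LinearEquiv.apply_symm_apply]
      exact hX' p (by rw [Finset.mem_union]; tauto)

end LatticeApproximation

/-! ### The global lattice of an adelic isometry and its dual -/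

section Translate

variable {D : ℤ}

/-- The bilinear form on `V(ℚ)`. -/
def bilForm (D : ℤ) : LinearMap.BilinForm ℚ (V D ℚ) :=
  LinearMap.mk₂ ℚ bil
    (fun X Y Z => by rw [bil_comm, bil_add_right, bil_comm Z, bil_comm Z])
    (fun r X Y => by rw [bil_comm, bil_smul_right, bil_comm Y, smul_eq_mul])
    (fun X Y Z => bil_add_right X Y Z)
    (fun r X Y => bil_smul_right r X Y)

theorem bilForm_apply (X Y : V D ℚ) : bilForm D X Y = bil X Y := rfl

theorem bil_dualVec_one {F : Type} [Field F] [CharZero F] (hD : (D : F) ≠ 0) (y : F × F × F × F) :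
    bil (latVec D F F (0, 0, 0, 1)) (dualVec D F F y) = y.1 ∧
    bil (latVec D F F (0, 0, 1, 0)) (dualVec D F F y) = y.2.1 ∧
    bil (latVec D F F (0, -1, 0, 0)) (dualVec D F F y) = y.2.2.1 ∧
    bil (latVec D F F (1, 0, 0, 0)) (dualVec D F F y) = y.2.2.2 := by
  refine ⟨?_, ?_, ?_, ?_⟩ <;> rw [bil_latVec_dualVec hD] <;> simp

theorem bilForm_nondegenerate (hD : D ≠ 0) : (bilForm D).Nondegenerate := by
  have hD' : (D : ℚ) ≠ 0 := Int.cast_ne_zero.2 hD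
  have hl : ∀ Y : V D ℚ, (∀ X, bil X Y = 0) → Y = 0 := fun Y hY => by
    obtain ⟨y, rfl⟩ := dualVec_surjective hD' Y
    obtain ⟨h1, h2, h3, h4⟩ := bil_dualVec_one hD' y
    rw [hY] at h1 h2 h3 h4
    have : y = 0 := Prod.ext h1.symm (Prod.ext h2.symm (Prod.ext h3.symm h4.symm))
    rw [this, map_zero]
  exact ⟨fun X hX => hl X fun Y => by rw [bil_comm]; exact hX Y, fun Y hY => hl Y hY⟩

/-- The local dual lattice consists of the vectors with integral products with the lattice. -/
theorem mem_dualLattice_padic_iff (hD : D ≠ 0) {p : ℕ} [Fact p.Prime] {Y : V D ℚ_[p]} :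
    Y ∈ dualLattice D ℤ_[p] ℚ_[p] ↔ ∀ Z ∈ lattice D ℤ_[p] ℚ_[p], ‖bil Z Y‖ ≤ 1 := by
  have hD' : (D : ℚ_[p]) ≠ 0 := Int.cast_ne_zero.2 hD
  constructor
  · intro hY Z hZ
    obtain ⟨y, rfl⟩ := (mem_dualLattice_iff hD').1 hY
    obtain ⟨z, rfl⟩ := mem_lattice_iff.1 hZ
    rw [bil_latVec_dualVec hD']
    exact PadicInt.norm_le_one _
  · intro h
    obtain ⟨y, rfl⟩ := dualVec_surjective hD' Y
    obtain ⟨h1, h2, h3, h4⟩ := bil_dualVec_one hD' y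
    rw [dualVec_mem_dualLattice_padic hD']
    refine ⟨h1 ▸ h _ ?_, h2 ▸ h _ ?_, h3 ▸ h _ ?_, h4 ▸ h _ ?_⟩ <;>
    · rw [latVec_mem_lattice_padic]; simp

variable (h : GAf D)

theorem Q_comp_symm (p : Nat.Primes) (X : V D ℚ_[p.1]) : Q ((h.comp p).symm X) = Q X := by
  rw [← (h p).2.1 ((h.comp p).symm X)]
  exact congrArg Q ((h.comp p).apply_symm_apply X)

theorem bil_comp_symm (p : Nat.Primes) (X Y : V D ℚ_[p.1]) :
    bil ((h.comp p).symm X) ((h.comp p).symm Y) = bil X Y := by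
  have h1 := Q_add ((h.comp p).symm X) ((h.comp p).symm Y)
  rw [← map_add, Q_comp_symm, Q_comp_symm, Q_comp_symm, Q_add] at h1
  exact (add_left_cancel h1).symm

/-- The `p`-component `h_p⁻¹ X` of `h⁻¹ X`, for `X ∈ V(ℚ)`. -/
def pullback (h : GAf D) (p : Nat.Primes) : V D ℚ →+ V D ℚ_[p.1] :=
  ((h.comp p).symm : V D ℚ_[p.1] →+ V D ℚ_[p.1]).comp (baseChangeHom D ℚ_[p.1])

theorem pullback_apply (p : Nat.Primes) (X : V D ℚ) :
    pullback h p X = (h.comp p).symm (baseChange ℚ_[p.1] X) := rfl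

theorem Q_pullback (p : Nat.Primes) (X : V D ℚ) : Q (pullback h p X) = ((Q X : ℚ) : ℚ_[p.1]) := by
  rw [pullback_apply, Q_comp_symm, Q_baseChange, eq_ratCast]

theorem bil_pullback (p : Nat.Primes) (X Y : V D ℚ) :
    bil (pullback h p X) (pullback h p Y) = ((bil X Y : ℚ) : ℚ_[p.1]) := by
  rw [pullback_apply, pullback_apply, bil_comp_symm, bil_baseChange, eq_ratCast]

/-- The lattice `h L`. -/
def translateGroup (h : GAf D) : AddSubgroup (V D ℚ) :=
  ⨅ p : Nat.Primes, (lattice D ℤ_[p.1] ℚ_[p.1]).toAddSubgroup.comap (pullback h p)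

/-- The dual `h L'` of the lattice `h L`. -/
def dualTranslate (h : GAf D) : AddSubgroup (V D ℚ) :=
  ⨅ p : Nat.Primes, (dualLattice D ℤ_[p.1] ℚ_[p.1]).toAddSubgroup.comap (pullback h p)

variable {h}

theorem mem_translateGroup_iff {X : V D ℚ} : X ∈ translateGroup h ↔
    ∀ p : Nat.Primes, pullback h p X ∈ lattice D ℤ_[p.1] ℚ_[p.1] := by
  rw [translateGroup, AddSubgroup.mem_iInf]; rfl

theorem mem_dualTranslate_iff {X : V D ℚ} : X ∈ dualTranslate h ↔
    ∀ p : Nat.Primes, pullback h p X ∈ dualLattice D ℤ_[p.1] ℚ_[p.1] := by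
  rw [dualTranslate, AddSubgroup.mem_iInf]; rfl

theorem mem_translate_iff {X : V D ℚ} : X ∈ translate h ↔ X ∈ translateGroup h := by
  rw [mem_translateGroup_iff]
  refine forall_congr' fun p => ?_
  rw [pullback_apply]
  constructor
  · rintro ⟨Y, hY, e⟩
    rwa [← e, LinearEquiv.symm_apply_apply]
  · intro hX
    exact ⟨_, hX, LinearEquiv.apply_symm_apply _ _⟩

variable (hD : IsFundamentalDiscriminant D)
include hD

/-- The lattice `h L'` is dual to `h L`. -/
theorem mem_dualTranslate_iff_bil {X : V D ℚ} :
    X ∈ dualTranslate h ↔ ∀ Y ∈ translateGroup h, ∃ k : ℤ, bil X Y = k := by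
  have hD0 := hD.ne_zero
  rw [mem_dualTranslate_iff]
  constructor
  · intro hX Y hY
    rw [mem_translateGroup_iff] at hY
    obtain ⟨k, hk⟩ := exists_int_of_norm_le_one (x := bil X Y) fun p => by
      rw [← bil_pullback h, bil_comm]
      exact (mem_dualLattice_padic_iff hD0).1 (hX p) _ (hY p)
    exact ⟨k, hk.symm⟩
  · intro hX p
    rw [mem_dualLattice_padic_iff hD0]
    intro Z hZ
    obtain ⟨j, hj⟩ := exists_pow_nsmul_mem_lattice p (pullback h p X)
    -- a vector of `h L` close to `h_p Z`
    obtain ⟨Y, hY, hY'⟩ := exists_translate_approx h {p}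
      (Function.update (fun _ => 0) p Z) (pow_ne_zero j p.2.ne_zero)
    obtain ⟨Z', hZ', e⟩ := hY p (Finset.mem_singleton_self p)
    rw [Function.update_self] at e
    have hYh : Y ∈ translateGroup h := mem_translateGroup_iff.2 fun q => by
      by_cases hq : q = p
      · subst hq
        rw [pullback_apply, e]
        exact add_mem hZ (nsmul_mem hZ' _)
      · exact hY' q (by simpa using hq)
    obtain ⟨k, hk⟩ := hX Y hYh
    have h1 := bil_pullback h p X Y
    rw [hk, pullback_apply h p Y, e, bil_add_right, ← Nat.cast_smul_eq_nsmul ℚ_[p.1],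
      bil_smul_right] at h1
    have h2 := (mem_dualLattice_padic_iff hD0).1
      (lattice_le_dualLattice hD.four_mul_normOmega (hD.cast_ne_zero _) hj) Z' hZ'
    rw [← Nat.cast_smul_eq_nsmul ℚ_[p.1], bil_smul_right, bil_comm Z'] at h2
    rw [bil_comm, eq_sub_of_add_eq h1, sub_eq_add_neg]
    refine (IsUltrametricDist.norm_add_le_max _ _).trans (max_le ?_ ?_)
    · exact_mod_cast Padic.norm_int_le_one (p := p.1) k
    · rwa [norm_neg]

variable (h) in
omit hD in
theorem exists_nsmul_mem_translateGroup : ∃ n : ℕ, n ≠ 0 ∧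
    (∀ X ∈ lattice D ℤ ℚ, n • X ∈ translateGroup h) ∧
    ∀ X ∈ translateGroup h, n • X ∈ lattice D ℤ ℚ := by
  obtain ⟨n, hn, hn'⟩ := exists_nsmul_comp_mem_lattice h
  refine ⟨n, hn, fun X hX => mem_translateGroup_iff.2 fun p => ?_,
    fun X hX => mem_lattice_of_forall_padic fun p => ?_⟩
  · rw [map_nsmul, pullback_apply]
    exact (hn' p _ (baseChange_mem_lattice p hX)).2
  · have h1 := (hn' p _ (mem_translateGroup_iff.1 hX p)).1
    rw [pullback_apply, LinearEquiv.apply_symm_apply] at h1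
    have : baseChange ℚ_[p.1] (n • X) = n • baseChange ℚ_[p.1] X := map_nsmul (baseChangeHom D _) n X
    rwa [this]

variable (h) in
/-- Dual `ℤ`-bases of `h L` and `h L'`. -/
theorem exists_dual_bases : ∃ e e' : Fin 4 → V D ℚ,
    (∀ i j, bil (e i) (e' j) = if i = j then 1 else 0) ∧
    (∀ X, X ∈ translateGroup h ↔ ∃ n : Fin 4 → ℤ, ∑ j, n j • e j = X) ∧
    ∀ X, X ∈ dualTranslate h ↔ ∃ n : Fin 4 → ℤ, ∑ j, n j • e' j = X := by
  obtain ⟨n, hn, h1, h2⟩ := exists_nsmul_mem_translateGroup h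
  set M : Submodule ℤ (V D ℚ) := AddSubgroup.toIntSubmodule (translateGroup h) with hM
  -- `n h L` is contained in `L`, so `h L` is finitely generated
  let f : M →ₗ[ℤ] LinearMap.range (latVec D ℤ ℚ) :=
    ((n • LinearMap.id : V D ℚ →ₗ[ℤ] V D ℚ).comp M.subtype).codRestrict _ fun X =>
      mem_lattice_iff.1 (h2 X X.2)
  have hf : Function.Injective f := fun X Y hXY => by
    have : n • (X : V D ℚ) = n • (Y : V D ℚ) := congrArg Subtype.val hXY
    exact Subtype.ext (smul_right_injective _ hn this)
  have : Module.Finite ℤ M := Module.Finite.of_injective f hf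
  have : Module.Free ℤ M := inferInstance
  have hinj : Function.Injective (latVec D ℤ ℚ) := latVec_injective Int.cast_injective
  let g : (ℤ × ℤ × ℤ × ℤ) →ₗ[ℤ] M :=
    ((n • LinearMap.id : V D ℚ →ₗ[ℤ] V D ℚ).comp (latVec D ℤ ℚ)).codRestrict M fun x =>
      h1 _ (mem_lattice_iff.2 ⟨x, rfl⟩)
  have hg : Function.Injective g := fun x y hxy => by
    have : n • latVec D ℤ ℚ x = n • latVec D ℤ ℚ y := congrArg Subtype.val hxy
    exact hinj (smul_right_injective _ hn this)
  have hrank : 4 ≤ Module.finrank ℤ M := by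
    have := LinearMap.finrank_le_finrank_of_injective hg
    simpa using this
  let E : (ℚ × ℚ × ℚ × ℚ) ≃ₗ[ℚ] V D ℚ := LinearEquiv.ofBijective (latVec D ℚ ℚ)
    ⟨latVec_injective Function.injective_id, latVec_surjective⟩
  have hdim : Module.finrank ℚ (V D ℚ) = 4 := by
    rw [← E.finrank_eq]; simp
  have : Module.Finite ℚ (V D ℚ) := Module.Finite.equiv E
  have hli : LinearIndependent ℚ (fun i => ((Module.finBasis ℤ M i : M) : V D ℚ)) := by
    rw [← LinearIndependent.iff_fractionRing (R := ℤ) (K := ℚ)]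
    exact (Module.finBasis ℤ M).linearIndependent.map' M.subtype (Submodule.ker_subtype M)
  have hcard : Module.finrank ℤ M = 4 := by
    refine le_antisymm ?_ hrank
    have := hli.fintype_card_le_finrank
    rwa [hdim, Fintype.card_fin] at this
  let b : Module.Basis (Fin 4) ℤ M := (Module.finBasis ℤ M).reindex (finCongr hcard)
  have hli' : LinearIndependent ℚ (fun i => ((b i : M) : V D ℚ)) := by
    rw [← LinearIndependent.iff_fractionRing (R := ℤ) (K := ℚ)]
    exact b.linearIndependent.map' M.subtype (Submodule.ker_subtype M)
  let e : Module.Basis (Fin 4) ℚ (V D ℚ) :=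
    basisOfLinearIndependentOfCardEqFinrank hli' (by rw [hdim, Fintype.card_fin])
  have he : ∀ i, e i = b i := fun i => by
    simp only [e, coe_basisOfLinearIndependentOfCardEqFinrank]
  have hB := bilForm_nondegenerate hD.ne_zero
  have hmem : ∀ X, X ∈ translateGroup h ↔ ∃ n : Fin 4 → ℤ, ∑ j, n j • e j = X := fun X => by
    simp_rw [he]
    constructor
    · intro hX
      refine ⟨b.repr ⟨X, hX⟩, ?_⟩
      have := congrArg M.subtype (b.sum_repr ⟨X, hX⟩)
      simp only [map_sum, map_smul] at this
      exact this
    · rintro ⟨n, rfl⟩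
      exact sum_mem fun j _ => zsmul_mem (b j).2 _
  refine ⟨e, (bilForm D).dualBasis hB e, fun i j => ?_, hmem, fun X => ?_⟩
  · rw [bil_comm]
    exact (bilForm D).apply_dualBasis_left hB e j i
  · rw [mem_dualTranslate_iff_bil hD]
    constructor
    · intro hX
      have : ∀ j, ∃ k : ℤ, bil X (e j) = k := fun j => hX _ (by rw [he]; exact (b j).2)
      choose k hk using this
      refine ⟨k, ?_⟩
      rw [← ((bilForm D).dualBasis hB e).sum_repr X]
      refine Finset.sum_congr rfl fun j _ => ?_
      rw [LinearMap.BilinForm.dualBasis_repr_apply, bilForm_apply, hk, Int.cast_smul_eq_zsmul]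
    · rintro ⟨n, rfl⟩ Y hY
      obtain ⟨m, rfl⟩ := (hmem Y).1 hY
      refine ⟨∑ i, m i * ∑ j, n j * if i = j then 1 else 0, ?_⟩
      rw [← bilForm_apply]
      simp only [map_sum, LinearMap.sum_apply, map_zsmul, LinearMap.smul_apply,
        (bilForm D).apply_dualBasis_left hB e]
      push_cast
      simp only [zsmul_eq_mul]

end Translate

/-! ### Transfer of the discriminant group along an adelic isometry -/

section Transfer

variable {D : ℤ}

theorem natAbs_nsmul_mem_modLattice {p : ℕ} [Fact p.Prime] {Z : V D ℚ_[p]}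
    (hZ : Z ∈ lattice D ℤ_[p] ℚ_[p]) : D.natAbs • Z ∈ modLattice D ℤ_[p] ℚ_[p] := by
  have h1 : (D : ℤ_[p]) • Z ∈ modLattice D ℤ_[p] ℚ_[p] := Submodule.mem_map.2 ⟨Z, hZ, rfl⟩
  rw [Int.cast_smul_eq_zsmul] at h1
  rw [← natCast_zsmul]
  rcases Int.natAbs_eq D with h | h
  · rwa [show (D.natAbs : ℤ) = D by omega]
  · rw [show (D.natAbs : ℤ) = -D by omega, neg_zsmul]
    exact neg_mem h1

/-- The set of primes dividing `D`. -/
def ramifiedPrimes (D : ℤ) : Finset Nat.Primes := D.natAbs.primeFactors.subtype Nat.Prime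

theorem mem_ramifiedPrimes_iff (hD : D ≠ 0) {p : Nat.Primes} :
    p ∈ ramifiedPrimes D ↔ (p.1 : ℤ) ∣ D := by
  have : p ∈ ramifiedPrimes D ↔ p.1 ∈ D.natAbs.primeFactors := Finset.mem_subtype
  rw [this, Nat.mem_primeFactors, Int.natCast_dvd]
  exact ⟨fun h => h.2.1, fun h => ⟨p.2, h, by simpa using hD⟩⟩

/-- The vector `X' ∈ L'` represents `h⁻¹ X` modulo `D L` at all primes. -/
def IsRepresentative (h : GAf D) (X : V D ℚ) (X' : V D ℚ) : Prop :=
  ∀ p : Nat.Primes, pullback h p X - baseChangeHom D ℚ_[p.1] X' ∈ modLattice D ℤ_[p.1] ℚ_[p.1]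

variable {h : GAf D} (hD : IsFundamentalDiscriminant D)
include hD

theorem modLattice_le_dualLattice (p : Nat.Primes) :
    modLattice D ℤ_[p.1] ℚ_[p.1] ≤ dualLattice D ℤ_[p.1] ℚ_[p.1] :=
  modLattice_le_lattice.trans
    (lattice_le_dualLattice hD.four_mul_normOmega (hD.cast_ne_zero _))

theorem exists_isRepresentative (X : dualTranslate h) :
    ∃ X' : dualGroup D, IsRepresentative h X X' := by
  have hX := mem_dualTranslate_iff.1 X.2
  obtain ⟨X', h1, h2⟩ := exists_lattice_approx (ramifiedPrimes D) (fun p => pullback h p X)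
    (Int.natAbs_ne_zero.2 hD.ne_zero)
  have hle : ∀ p : Nat.Primes, lattice D ℤ_[p.1] ℚ_[p.1] ≤ dualLattice D ℤ_[p.1] ℚ_[p.1] :=
    fun p => lattice_le_dualLattice hD.four_mul_normOmega (hD.cast_ne_zero _)
  have hX' : X' ∈ dualLattice D ℤ ℚ := mem_dualLattice_of_forall_padic hD.ne_zero fun p => by
    by_cases hp : p ∈ ramifiedPrimes D
    · obtain ⟨Z, hZ, e⟩ := h1 p hp
      rw [e]
      exact add_mem (hX p) (hle p (nsmul_mem hZ _))
    · exact hle p (h2 p hp)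
  refine ⟨⟨X', hX'⟩, fun p => ?_⟩
  by_cases hp : p ∈ ramifiedPrimes D
  · obtain ⟨Z, hZ, e⟩ := h1 p hp
    have e' : baseChangeHom D ℚ_[p.1] X' = pullback h p X + D.natAbs • Z := e
    rw [e', sub_add_cancel_left, neg_mem_iff]
    exact natAbs_nsmul_mem_modLattice hZ
  · rw [mem_ramifiedPrimes_iff hD.ne_zero] at hp
    exact dualLattice_le_modLattice hD.emod_four p hp
      (sub_mem (hX p) (baseChange_mem_dualLattice hD.ne_zero p hX'))

theorem exists_isRepresentative' (X' : dualGroup D) :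
    ∃ X : dualTranslate h, IsRepresentative h X X' := by
  obtain ⟨X, h1, h2⟩ := exists_translate_approx h (ramifiedPrimes D)
    (fun p => baseChange ℚ_[p.1] (X' : V D ℚ)) (Int.natAbs_ne_zero.2 hD.ne_zero)
  have hle : ∀ p : Nat.Primes, lattice D ℤ_[p.1] ℚ_[p.1] ≤ dualLattice D ℤ_[p.1] ℚ_[p.1] :=
    fun p => lattice_le_dualLattice hD.four_mul_normOmega (hD.cast_ne_zero _)
  have hX' : ∀ p : Nat.Primes, baseChange ℚ_[p.1] (X' : V D ℚ) ∈ dualLattice D ℤ_[p.1] ℚ_[p.1] :=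
    fun p => baseChange_mem_dualLattice hD.ne_zero p X'.2
  have hX : ∀ p : Nat.Primes, pullback h p X ∈ dualLattice D ℤ_[p.1] ℚ_[p.1] := fun p => by
    by_cases hp : p ∈ ramifiedPrimes D
    · obtain ⟨Z, hZ, e⟩ := h1 p hp
      rw [pullback_apply, e]
      exact add_mem (hX' p) (hle p (nsmul_mem hZ _))
    · exact hle p (h2 p hp)
  refine ⟨⟨X, mem_dualTranslate_iff.2 hX⟩, fun p => ?_⟩
  by_cases hp : p ∈ ramifiedPrimes D
  · obtain ⟨Z, hZ, e⟩ := h1 p hp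
    have e' : pullback h p X = baseChangeHom D ℚ_[p.1] X' + D.natAbs • Z := e
    rw [e', add_sub_cancel_left]
    exact natAbs_nsmul_mem_modLattice hZ
  · rw [mem_ramifiedPrimes_iff hD.ne_zero] at hp
    exact dualLattice_le_modLattice hD.emod_four p hp (sub_mem (hX p) (hX' p))

theorem IsRepresentative.discMk_eq {X : V D ℚ} {X' X'' : dualGroup D}
    (h1 : IsRepresentative h X X') (h2 : IsRepresentative h X X'') :
    discMk D X' = discMk D X'' := by
  rw [← sub_eq_zero, ← map_sub, discMk_eq_zero, mem_rescaledLattice_iff_forall_padic hD.ne_zero]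
  intro p
  have := sub_mem (h2 p) (h1 p)
  rw [sub_sub_sub_cancel_left, ← map_sub] at this
  exact this

variable (h) in
/-- The isomorphism of `h L' / D h L` with the discriminant group `L' / D L`, as a map on `h L'`. -/
def transfer : dualTranslate h →+ DiscGroup D :=
  AddMonoidHom.mk' (fun X => discMk D (exists_isRepresentative hD X).choose) fun X Y => by
    rw [← map_add]
    refine IsRepresentative.discMk_eq hD (h := h) (exists_isRepresentative hD (X + Y)).choose_spec
      fun p => ?_
    have h1 := add_mem ((exists_isRepresentative hD X).choose_spec p)
      ((exists_isRepresentative hD Y).choose_spec p)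
    rw [sub_add_sub_comm, ← map_add, ← map_add] at h1
    exact h1

theorem IsRepresentative.transfer_eq {X : dualTranslate h} {X' : dualGroup D}
    (h1 : IsRepresentative h X X') : transfer h hD X = discMk D X' :=
  IsRepresentative.discMk_eq hD (exists_isRepresentative hD X).choose_spec h1

theorem transfer_surjective : Function.Surjective (transfer h hD) := fun δ => by
  obtain ⟨X', rfl⟩ := discMk_surjective δ
  obtain ⟨X, hX⟩ := exists_isRepresentative' (h := h) hD X'
  exact ⟨X, hX.transfer_eq hD⟩

theorem transfer_eq_zero_iff {X : dualTranslate h} : transfer h hD X = 0 ↔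
    ∀ p : Nat.Primes, pullback h p X ∈ modLattice D ℤ_[p.1] ℚ_[p.1] := by
  obtain ⟨X', hX'⟩ := exists_isRepresentative hD X
  rw [hX'.transfer_eq hD, discMk_eq_zero, mem_rescaledLattice_iff_forall_padic hD.ne_zero]
  refine forall_congr' fun p => ⟨fun h1 => ?_, fun h1 => ?_⟩
  · have := add_mem (hX' p) h1
    rwa [show baseChange ℚ_[p.1] (X' : V D ℚ) = baseChangeHom D ℚ_[p.1] X' from rfl,
      sub_add_cancel] at this
  · have := sub_mem h1 (hX' p)
    rwa [sub_sub_cancel] at this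

/-- The quadratic form on the dual lattice changes by a multiple of `D` under translation by
`D L_p`. -/
theorem Q_add_of_mem_modLattice (p : Nat.Primes) {Y W : V D ℚ_[p.1]}
    (hY : Y ∈ dualLattice D ℤ_[p.1] ℚ_[p.1]) (hW : W ∈ modLattice D ℤ_[p.1] ℚ_[p.1]) :
    ∃ k : ℤ_[p.1], Q (Y + W) = Q Y + D * (k : ℚ_[p.1]) := by
  obtain ⟨z, rfl⟩ := mem_modLattice_iff.1 hW
  obtain ⟨y, rfl⟩ := (mem_dualLattice_iff (hD.cast_ne_zero _)).1 hY
  rw [Q_add, Q_latVec hD.four_mul_normOmega, bil_comm, bil_latVec_dualVec (hD.cast_ne_zero _)]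
  refine ⟨D * (z.1 * z.2.2.2 - (z.2.1 ^ 2 + (normOmega D : ℤ) * z.2.2.1 ^ 2) -
    D * (z.2.1 * z.2.2.1)) + (z.1 * y.2.2.2 + y.1 * z.2.2.2 - z.2.1 * y.2.2.1 + z.2.2.1 * y.2.1),
    ?_⟩
  have e : ∀ t : ℤ_[p.1], algebraMap ℤ_[p.1] ℚ_[p.1] t = t := fun _ => rfl
  simp only [e, genusForm, Prod.smul_fst, Prod.smul_snd, smul_eq_mul]
  push_cast
  ring

theorem discQ_transfer (X : dualTranslate h) : discQ D (transfer h hD X) =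
    (((Q (X : V D ℚ) / ((|D| : ℤ) : ℚ) : ℚ) : ℝ) : UnitAddCircle) := by
  have hD0 := hD.cast_ne_zero ℚ
  obtain ⟨X', hX'⟩ := exists_isRepresentative hD X
  have e0 : discQ D (discMk D X') =
    (((Q (X' : V D ℚ) / ((|D| : ℤ) : ℚ) : ℚ) : ℝ) : UnitAddCircle) := discQ_mk hD X'
  rw [hX'.transfer_eq hD, e0]
  obtain ⟨k, hk⟩ := exists_int_of_norm_le_one (x := (Q (X : V D ℚ) - Q (X' : V D ℚ)) / D) fun p => by
    obtain ⟨k, hk⟩ := Q_add_of_mem_modLattice hD p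
      (baseChange_mem_dualLattice hD.ne_zero p X'.2) (hX' p)
    rw [show baseChange ℚ_[p.1] (X' : V D ℚ) = baseChangeHom D ℚ_[p.1] X' from rfl,
      add_sub_cancel, Q_pullback] at hk
    have e : Q (baseChangeHom D ℚ_[p.1] X') = ((Q (X' : V D ℚ) : ℚ) : ℚ_[p.1]) := by
      rw [← eq_ratCast (algebraMap ℚ ℚ_[p.1]), ← Q_baseChange]; rfl
    have hDp := hD.cast_ne_zero ℚ_[p.1]
    rw [e] at hk
    push_cast
    rw [hk, add_sub_cancel_left, mul_div_cancel_left₀ _ hDp]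
    exact k.2
  have hQ : Q (X : V D ℚ) = Q (X' : V D ℚ) + D * k := by
    rw [hk, mul_div_cancel₀ _ hD0]; ring
  rw [eq_comm, ← sub_eq_zero, ← AddCircle.coe_sub, AddCircle.coe_eq_zero_iff, ← Rat.cast_sub, hQ]
  rcases abs_choice D with h | h
  · refine ⟨k, ?_⟩
    rw [h, add_div, add_sub_cancel_left, mul_div_cancel_left₀ _ hD0]; simp
  · refine ⟨-k, ?_⟩
    rw [h, add_div, add_sub_cancel_left, Int.cast_neg, div_neg, mul_div_cancel_left₀ _ hD0]; simp

variable (h) in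
/-- The lattice `h L'` together with its projection to the discriminant group of `L(D)`. -/
theorem isThetaLattice_dualTranslate : IsThetaLattice D (dualTranslate h) (transfer h hD) := by
  obtain ⟨e, e', h1, h2, h3⟩ := exists_dual_bases h hD
  refine ⟨transfer_surjective hD, discQ_transfer hD, fun j => |D| • e j, e', fun i j => ?_, h3,
    fun X => ?_⟩
  · beta_reduce
    rw [← Int.cast_smul_eq_zsmul ℚ, bil_comm, bil_smul_right, bil_comm, h1]
    simp
  · have hD0 := hD.cast_ne_zero ℚ
    have key : (∃ hX : X ∈ dualTranslate h, transfer h hD ⟨X, hX⟩ = 0) ↔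
        (D : ℚ)⁻¹ • X ∈ translateGroup h := by
      have e : ∀ p : Nat.Primes, pullback h p X ∈ modLattice D ℤ_[p.1] ℚ_[p.1] ↔
          pullback h p ((D : ℚ)⁻¹ • X) ∈ lattice D ℤ_[p.1] ℚ_[p.1] := fun p => by
        rw [mem_modLattice_iff_inv_smul (hD.cast_ne_zero _), pullback_apply, pullback_apply,
          baseChange_smul, map_smul, map_inv₀, map_intCast]
      rw [mem_translateGroup_iff]
      simp_rw [transfer_eq_zero_iff, ← e]
      exact ⟨fun ⟨_, h4⟩ => h4, fun h4 =>
        ⟨mem_dualTranslate_iff.2 fun p => modLattice_le_dualLattice hD p (h4 p), h4⟩⟩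
    rw [key, h2]
    have hs : ∃ s : ℤ, s * s = 1 ∧ |D| = s * D := by
      rcases abs_choice D with h | h
      · exact ⟨1, rfl, by rw [h, one_mul]⟩
      · exact ⟨-1, rfl, by rw [h, neg_one_mul]⟩
    obtain ⟨s, hs, habs⟩ := hs
    have hsum : ∀ n : Fin 4 → ℤ, ∑ j, (s * n j) • |D| • e j = (D : ℚ) • ∑ j, n j • e j := fun n => by
      rw [Int.cast_smul_eq_zsmul, Finset.smul_sum]
      refine Finset.sum_congr rfl fun j _ => ?_
      rw [habs, smul_smul, smul_smul]
      congr 1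
      linear_combination n j * D * hs
    constructor
    · rintro ⟨n, hn⟩
      exact ⟨fun j => s * n j, by rw [hsum, hn, smul_inv_smul₀ hD0]⟩
    · rintro ⟨n, rfl⟩
      refine ⟨fun j => s * n j, ?_⟩
      rw [eq_inv_smul_iff₀ hD0, ← hsum]
      refine Finset.sum_congr rfl fun j _ => ?_
      rw [← mul_assoc, hs, one_mul]

end Transfer

/-! ### The adelic twisting function -/

section ChiAdelic

variable {D : ℤ} (hD : IsFundamentalDiscriminant D)
include hD

omit hD in
theorem chiLocal_unramified {p : Nat.Primes} (hp : ¬ (p.1 : ℤ) ∣ D) {Y : V D ℚ_[p.1]}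
    (hY : Y ∈ dualLattice D ℤ_[p.1] ℚ_[p.1]) : chiLocal D p Y = 1 := by
  rw [chiLocal, if_pos hY, if_neg hp]

theorem hilbertSym_entry {p : Nat.Primes} (hp : (p.1 : ℤ) ∣ D) (a : ℤ) (z : ℤ_[p.1]) :
    (‖(a + D * z : ℚ_[p.1])‖ = 1 ↔ ¬ (p.1 : ℤ) ∣ a) ∧ (¬ (p.1 : ℤ) ∣ a →
      hilbertSym (a + D * z : ℚ_[p.1]) (D : ℚ_[p.1]) = kronecker (primeDisc D p.1) a) := by
  have e : (a + D * z : ℚ_[p.1]) = ((a + D * z : ℤ_[p.1]) : ℚ_[p.1]) := by push_cast; rfl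
  rw [e]
  constructor
  · rw [← PadicInt.norm_def, ← not_iff_not, not_not]
    have h1 : ¬ ‖(a + D * z : ℤ_[p.1])‖ = 1 ↔ ‖(a + D * z : ℤ_[p.1])‖ < 1 :=
      ⟨fun h => lt_of_le_of_ne (PadicInt.norm_le_one _) h, fun h => h.ne⟩
    rw [h1, PadicInt.norm_lt_one_iff_dvd, ← dvd_intCast_iff]
    exact dvd_add_left ((dvd_intCast_iff.2 hp).mul_right z)
  · intro ha
    rw [hD.kronecker_primeDisc p.2 hp ha]
    exact hD.hilbertSym_eq_localChar hp ha ⟨z, by ring⟩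

/-- The local twisting function at a ramified prime, near a vector of `L_D`. -/
theorem chiLocal_ramified {p : Nat.Primes} (hp : (p.1 : ℤ) ∣ D) {X : V D ℚ} (hX : X ∈ LD D)
    {W : V D ℚ_[p.1]} (hW : W ∈ modLattice D ℤ_[p.1] ℚ_[p.1]) :
    chiLocal D p (baseChange ℚ_[p.1] X + W) = chiPrime D p.1 X := by
  obtain ⟨hXd, k, hk⟩ := hX
  have hXp := baseChange_mem_dualLattice hD.ne_zero p hXd
  have h1 := add_mem hXp (modLattice_le_dualLattice hD p hW)
  have h2 : ∃ l : ℤ_[p.1], Q (baseChange ℚ_[p.1] X + W) = (D : ℚ_[p.1]) * l := by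
    obtain ⟨l, hl⟩ := Q_add_of_mem_modLattice hD p hXp hW
    refine ⟨k + l, ?_⟩
    rw [hl, Q_baseChange, hk]
    simp
    ring
  rw [chiLocal, if_pos h1, if_pos hp, if_pos h2]
  obtain ⟨z, rfl⟩ := mem_modLattice_iff.1 hW
  obtain ⟨x, rfl⟩ := (mem_dualLattice_iff (hD.cast_ne_zero ℚ)).1 hXd
  have e1 : (baseChange ℚ_[p.1] (dualVec D ℤ ℚ x) +
      latVec D ℤ_[p.1] ℚ_[p.1] ((D : ℤ_[p.1]) • z)).1 = x.1 + D * z.1 := by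
    simp [baseChange, dualVec_apply, latVec_apply]
    rw [Algebra.smul_def, map_intCast]
  have e2 : (baseChange ℚ_[p.1] (dualVec D ℤ ℚ x) +
      latVec D ℤ_[p.1] ℚ_[p.1] ((D : ℤ_[p.1]) • z)).2.2 = x.2.2.2 + D * z.2.2.2 := by
    simp [baseChange, dualVec_apply, latVec_apply]
    rw [Algebra.smul_def, map_intCast]
  have e3 : (dualVec D ℤ ℚ x).1.num = x.1 := Rat.num_intCast _
  have e4 : (dualVec D ℤ ℚ x).2.2.num = x.2.2.2 := Rat.num_intCast _
  obtain ⟨h3, h4⟩ := hilbertSym_entry hD hp x.1 z.1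
  obtain ⟨h5, h6⟩ := hilbertSym_entry hD hp x.2.2.2 z.2.2.2
  rw [chiPrime, e1, e2, e3, e4]
  simp only [h3, h5]
  split_ifs with h7 h8
  · rfl
  · exact h6 h8
  · exact h4 h7

theorem chiAdelic_eq_prod {Y : ∀ p : Nat.Primes, V D ℚ_[p.1]}
    (hY : ∀ p : Nat.Primes, Y p ∈ dualLattice D ℤ_[p.1] ℚ_[p.1]) :
    chiAdelic D Y = ∏ p ∈ ramifiedPrimes D, chiLocal D p (Y p) := by
  refine finprod_eq_prod_of_mulSupport_subset _ fun p hp => ?_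
  rw [Finset.mem_coe, mem_ramifiedPrimes_iff hD.ne_zero]
  by_contra hpD
  exact hp (chiLocal_unramified hpD (hY p))

/-- The adelic twisting function at `h⁻¹ X` is the value of `χ_D` at a representative of `h⁻¹ X`
modulo `D L`. -/
theorem chiAdelic_pullback {h : GAf D} {X : V D ℚ} {X' : dualGroup D}
    (hX : IsRepresentative h X X') : chiAdelic D (fun p => pullback h p X) = chi D X' := by
  have hX'p := fun p => baseChange_mem_dualLattice hD.ne_zero p X'.2
  have e : ∀ p : Nat.Primes, ∃ W ∈ modLattice D ℤ_[p.1] ℚ_[p.1],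
      pullback h p X = baseChange ℚ_[p.1] (X' : V D ℚ) + W := fun p =>
    ⟨_, hX p, (add_sub_cancel (baseChangeHom D ℚ_[p.1] (X' : V D ℚ)) (pullback h p X)).symm⟩
  choose W hW e using e
  rw [chiAdelic_eq_prod hD fun p => by
    rw [e]; exact add_mem (hX'p p) (modLattice_le_dualLattice hD p (hW p))]
  simp_rw [e]
  by_cases hLD : (X' : V D ℚ) ∈ LD D
  · rw [chi, if_pos hLD]
    have h1 : ∏ p ∈ ramifiedPrimes D, chiPrime D p.1 X' =
        ∏ p ∈ D.natAbs.primeFactors, chiPrime D p X' :=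
      Finset.prod_subtype_of_mem (fun p => chiPrime D p X') fun p hp =>
        Nat.prime_of_mem_primeFactors hp
    rw [← h1]
    refine Finset.prod_congr rfl fun p hp => ?_
    exact chiLocal_ramified hD ((mem_ramifiedPrimes_iff hD.ne_zero).1 hp) hLD (hW p)
  · rw [chi, if_neg hLD]
    -- some prime divides the denominator of `Q(X') / D`, and it is ramified
    have h1 : ¬ ∀ p : Nat.Primes, ‖((Q (X' : V D ℚ) / D : ℚ) : ℚ_[p.1])‖ ≤ 1 := fun h1 => by
      obtain ⟨k, hk⟩ := exists_int_of_norm_le_one h1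
      exact hLD ⟨X'.2, k, by rw [hk, mul_div_cancel₀ _ (hD.cast_ne_zero ℚ)]⟩
    push Not at h1
    obtain ⟨p, hp⟩ := h1
    have hQ : ((Q (X' : V D ℚ) : ℚ) : ℚ_[p.1]) = Q (baseChange ℚ_[p.1] (X' : V D ℚ)) := by
      rw [Q_baseChange, eq_ratCast]
    have hDp := hD.cast_ne_zero ℚ_[p.1]
    have hno : ¬ ∃ k : ℤ_[p.1], Q (baseChange ℚ_[p.1] (X' : V D ℚ)) = (D : ℚ_[p.1]) * k := by
      rintro ⟨k, hk⟩
      rw [← hQ] at hk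
      refine hp.not_ge ?_
      push_cast
      rw [hk, mul_div_cancel_left₀ _ hDp]
      exact k.2
    have hpD : (p.1 : ℤ) ∣ D := by
      by_contra hpD
      obtain ⟨z, hz⟩ := mem_modLattice_iff.1
        (dualLattice_le_modLattice hD.emod_four p hpD (hX'p p))
      refine hno ?_
      obtain ⟨k, hk⟩ := Q_add_of_mem_modLattice hD p (Y := 0) (zero_mem _)
        (mem_modLattice_iff.2 ⟨z, hz⟩)
      exact ⟨k, by rw [zero_add] at hk; rw [hk, Q_def]; simp⟩
    refine Finset.prod_eq_zero ((mem_ramifiedPrimes_iff hD.ne_zero).2 hpD) ?_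
    have hne : ¬ ∃ k : ℤ_[p.1], Q (baseChange ℚ_[p.1] (X' : V D ℚ) + W p) = (D : ℚ_[p.1]) * k := by
      rintro ⟨k, hk⟩
      obtain ⟨l, hl⟩ := Q_add_of_mem_modLattice hD p (hX'p p) (hW p)
      exact hno ⟨k - l, by push_cast; linear_combination hk - hl⟩
    rw [chiLocal, if_pos hpD, if_neg hne, ite_self]

end ChiAdelic

/-! ### The twisted theta function -/

section Theta

variable {D : ℤ} (hD : IsFundamentalDiscriminant D) (hneg : D < 0) (h : GAf D) (P : H3)
include hD

theorem translateGroup_le_dualTranslate : translateGroup h ≤ dualTranslate h := fun _ hX =>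
  mem_dualTranslate_iff.2 fun p =>
    lattice_le_dualLattice hD.four_mul_normOmega (hD.cast_ne_zero _) (mem_translateGroup_iff.1 hX p)

variable {h} in
theorem chiAdelic_eq_chiDisc (X : dualTranslate h) :
    (chiAdelic D (fun p => (h.comp p).symm (baseChange ℚ_[p.1] (X : V D ℚ))) : ℂ) =
      chiDisc D (transfer h hD X) := by
  obtain ⟨X', hX'⟩ := exists_isRepresentative hD X
  have h1 := chiDisc_mk hD X'
  have h2 := chiAdelic_pullback hD hX'
  rw [hX'.transfer_eq hD]
  exact (congrArg (Int.cast : ℤ → ℂ) h2).trans h1.symm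

variable {h} in
/-- The twisting function is supported on the lattice `h L` itself. -/
theorem mem_translate_of_chiDisc_ne_zero {X : dualTranslate h}
    (hX : chiDisc D (transfer h hD X) ≠ 0) : (X : V D ℚ) ∈ translate h := by
  obtain ⟨X', hX'⟩ := exists_isRepresentative hD X
  rw [hX'.transfer_eq hD] at hX
  have h1 : chiDisc D (discMk D X') = (chi D X' : ℂ) := chiDisc_mk hD X'
  have h2 : (X' : V D ℚ) ∈ lattice D ℤ ℚ := by
    by_contra h2
    exact hX (by rw [h1, chi_of_notMem_lattice hD h2, Int.cast_zero])
  rw [mem_translate_iff, mem_translateGroup_iff]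
  intro p
  have := add_mem (modLattice_le_lattice (hX' p)) (baseChange_mem_lattice p h2)
  rwa [show baseChange ℚ_[p.1] (X' : V D ℚ) = baseChangeHom D ℚ_[p.1] X' from rfl,
    sub_add_cancel] at this

include hneg

theorem thetaTerm_eq_dualTranslate (τ : ℍ) (X : dualTranslate h) :
    thetaTerm D h P τ X = (scale D : ℂ) * (chiDisc D (transfer h hD X) *
      minkGauss (scale D) τ (coordsQ D P X)) := by
  rw [thetaTerm_eq hneg, chiAdelic_eq_chiDisc hD, scale]
  ring

theorem summable_thetaTerm (τ : ℍ) :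
    Summable fun X : translate h => thetaTerm D h P τ X := by
  have h1 := (((isThetaLattice_dualTranslate h hD).summable hneg (χ := chiDisc D) P τ.im_pos).mul_left
    (scale D : ℂ))
  have hle : ∀ X : translate h, (X : V D ℚ) ∈ dualTranslate h := fun X =>
    translateGroup_le_dualTranslate hD h (mem_translate_iff.1 X.2)
  have h2 := h1.comp_injective (i := fun X : translate h => (⟨X, hle X⟩ : dualTranslate h))
    fun X Y hXY => Subtype.ext (congrArg (fun Z : dualTranslate h => (Z : V D ℚ)) hXY)
  refine h2.congr fun X => ?_
  exact (thetaTerm_eq_dualTranslate hD hneg h P τ ⟨X, hle X⟩).symm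

theorem theta_eq_latticeTheta (τ : ℍ) :
    theta D h P τ = (scale D : ℂ) * latticeTheta (transfer h hD) (chiDisc D) P τ := by
  have hle : ∀ X : translate h, (X : V D ℚ) ∈ dualTranslate h := fun X =>
    translateGroup_le_dualTranslate hD h (mem_translate_iff.1 X.2)
  have h1 : ∑' X : translate h, thetaTerm D h P τ X =
      ∑' X : dualTranslate h, (scale D : ℂ) * (chiDisc D (transfer h hD X) *
        minkGauss (scale D) τ (coordsQ D P X)) := by
    have hinj : Function.Injective (fun X : translate h => (⟨X, hle X⟩ : dualTranslate h)) :=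
      fun X Y hXY => Subtype.ext (congrArg (fun Z : dualTranslate h => (Z : V D ℚ)) hXY)
    rw [← hinj.tsum_eq]
    · exact tsum_congr fun X => thetaTerm_eq_dualTranslate hD hneg h P τ ⟨X, hle X⟩
    · intro X hX
      refine ⟨⟨X, mem_translate_of_chiDisc_ne_zero hD (X := X) fun h0 => hX ?_⟩, rfl⟩
      beta_reduce
      rw [h0, zero_mul, mul_zero]
  rw [theta, latticeTheta, h1, tsum_mul_left]
  ring

theorem theta_slash (γ : SL(2, ℤ)) : (theta D h P) ∣[(0 : ℤ)] γ = theta D h P := by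
  have H := isThetaLattice_dualTranslate h hD
  obtain ⟨r, -, hr⟩ := H.exists_inversion hneg (χ := chiDisc D) (fourier_chiDisc hD) P
  refine slash_eq_of_inversion
    (C := -Complex.I * r * ((D.natAbs : ℂ) ^ 2 * gaussSum D)) (fun τ => ?_) (fun τ => ?_) γ
  · rw [theta_eq_latticeTheta hD hneg, theta_eq_latticeTheta hD hneg,
      H.latticeTheta_T hneg (fun δ hδ => discQ_of_chiDisc_ne_zero hD hδ)]
  · rw [theta_eq_latticeTheta hD hneg, theta_eq_latticeTheta hD hneg, hr]
    exact mul_left_comm _ _ _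

end Theta

end TwistedTheta

end

theorem mainTheorem9 (D : ℤ) (hD : TwistedTheta.IsFundamentalDiscriminant D) (hneg : D < 0) :
    -- `χ_D` is well defined on `L' / L(D)`, so that `ψ_D` has the coefficients `χ_D(δ)`
    (∀ X : TwistedTheta.dualLattice D ℤ ℚ,
      TwistedTheta.psi D (Submodule.Quotient.mk X) = (TwistedTheta.chi D X : ℂ)) ∧
    -- `ψ_D` is invariant under the dual Weil representation of `L(D)`
    (∀ g : TwistedTheta.Mp2Z,
      (∃ B, TwistedTheta.IsDualWeilOperator D g B) ∧
      ∀ B, TwistedTheta.IsDualWeilOperator D g B →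
        B (TwistedTheta.psi D) = TwistedTheta.psi D) ∧
    -- the twisted theta function converges absolutely and has weight `0` for `SL₂(ℤ)` in `τ`
    (∀ (h : TwistedTheta.GAf D) (P : TwistedTheta.H3),
      (∀ τ : ℍ, Summable fun X : TwistedTheta.translate h => TwistedTheta.thetaTerm D h P τ X) ∧
      ∀ γ : SL(2, ℤ), (TwistedTheta.theta D h P) ∣[(0 : ℤ)] γ = TwistedTheta.theta D h P) :=
  ⟨TwistedTheta.psi_mk hD,
    fun g => ⟨TwistedTheta.exists_isWeilOperator _ 3 1 g,
      fun _ hB => TwistedTheta.weil_invariant hD hneg hB⟩,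
    fun h P => ⟨TwistedTheta.summable_thetaTerm hD hneg h P, TwistedTheta.theta_slash hD hneg h P⟩⟩
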